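/- Let $\mathbb S=\{e^{i\theta}\}$ be the unit circle and let $\Lambda=(-d^2/d\theta^2)^{1/2}$ be the Dirichlet-to-Neumann operator of the unit disc, i.e. the linear operator on $C^\infty(\mathbb S)$ with $\Lambda e^{in\theta}=|n|e^{in\theta}$ for $n\in\mathbb Z$. Let $a\in C^\infty(\mathbb S)$ be a positive function, put $\Lambda_a=a^{1/2}\Lambda a^{1/2}$ on $C^\infty(\mathbb S)$ and $L=L(a)=\int_{-\pi}^{\pi}a(e^{i\theta})^{-1}\,d\theta$. Let $0=\lambda_0(a)<\lambda_1(a)\le\lambda_2(a)\le\dots$ be the eigenvalues of $\Lambda_a$, each repeated according to its multiplicity. The series $\zeta_a(s)=\sum_{n\ge1}\lambda_n(a)^{-s}$ converges for $\operatorname{Re}s>1$ and extends to a meromorphic function $\zeta_a$ on $\mathbb C$ whose only pole is a simple pole at $s=1$. Let $\zeta_R$ be the Riemann zeta function and $$\psi(s)=\Big(\frac{L}{2\pi}\Big)^{s}\zeta_a(-s)-2\zeta_R(-s).$$ Then exactly one of the following two alternatives holds: (1) $\zeta_a(s)=2\big(\frac{L}{2\pi}\big)^{s}\zeta_R(s)$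 identically in $s$; (2) for every $\alpha>0$ there are constants $C(\alpha)>0$ and $C_1(\alpha)>0$ such that $\psi$ is real-valued on $[1,\infty)$ with $$\psi'(s)\ge C(\alpha)e^{\alpha s}\quad\text{and}\quad \psi(s)\ge C_1(\alpha)e^{\alpha s}\qquad\text{for all real } s\ge1.$$ Moreover, (1) holds if and only if the normalized function $\frac{L}{2\pi}a$ is conformally equivalent to the constant function $1$. Here positive functions $a,b\in C^\infty(\mathbb S)$ are called conformally equivalent if there is a conformal or anticonformal transformation $\Psi$ of the unit disc (a homeomorphism of the closed disc that maps the open disc biholomorphically onto itself, or the complex conjugate of such a map) with $b=(a\circ\psi_0)\,\big|\frac{d\psi_0}{d\theta}\big|^{-1}$, where $\psi_0=\Psi|_{\mathbb S}$. -/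

import Mathlib

noncomputable section

/-- A function on the unit circle `𝕊 = {e^{iθ}}` is `C^∞` if it is `C^∞` in the angle `θ`. -/
def IsSmoothOnCircle {E : Type*} [NormedAddCommGroup E] [NormedSpace ℝ E] (u : Circle → E) : Prop :=
  ContDiff ℝ ((⊤ : ℕ∞) : WithTop ℕ∞) (fun θ : ℝ => u (Circle.exp θ))

/-- The complex vector space `C^∞(𝕊)`. -/
def SmoothCircle : Submodule ℂ (Circle → ℂ) where
  carrier := {u | IsSmoothOnCircle u}
  zero_mem' := by
    change ContDiff ℝ ((⊤ : ℕ∞) : WithTop ℕ∞) (fun _ : ℝ => (0 : ℂ))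
    exact contDiff_const
  add_mem' := by
    intro u v hu hv
    change ContDiff ℝ ((⊤ : ℕ∞) : WithTop ℕ∞) (fun θ : ℝ => u (Circle.exp θ) + v (Circle.exp θ))
    exact ContDiff.add hu hv
  smul_mem' := by
    intro c u hu
    change ContDiff ℝ ((⊤ : ℕ∞) : WithTop ℕ∞) (fun θ : ℝ => c * u (Circle.exp θ))
    exact ContDiff.mul contDiff_const hu

/-- The Fourier coefficient `û_n = (2π)⁻¹ ∫_{-π}^{π} u(e^{iθ}) e^{-inθ} dθ`. -/
def circleCoeff (u : Circle → ℂ) (n : ℤ) : ℂ :=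
  (1 / (2 * Real.pi) : ℂ) *
    ∫ θ in (-Real.pi)..Real.pi, u (Circle.exp θ) * Complex.exp (-(n * θ * Complex.I))

theorem circleCoeff_decay_aux (k : ℕ) : ∀ F : ℝ → ℂ, ContDiff ℝ ((⊤ : ℕ∞) : WithTop ℕ∞) F →
    (∀ θ, F (θ + 2 * Real.pi) = F θ) → ∃ C : ℝ, ∀ n : ℤ,
      |(n : ℝ)| ^ k * ‖∫ θ in (-Real.pi)..Real.pi, F θ * Complex.exp (-(n * θ * Complex.I))‖ ≤ C := by
  induction k with
  | zero =>
    intro F hF _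
    refine ⟨∫ θ in (-Real.pi)..Real.pi, ‖F θ‖, fun n => ?_⟩
    have h : (-Real.pi) ≤ Real.pi := by linarith [Real.pi_pos]
    rw [pow_zero, one_mul]
    refine (intervalIntegral.norm_integral_le_integral_norm h).trans (le_of_eq ?_)
    refine intervalIntegral.integral_congr fun θ _ => ?_
    have : Complex.exp (-(n * θ * Complex.I)) = Complex.exp (((-(n * θ) : ℝ) : ℂ) * Complex.I) := by
      congr 1; push_cast; ring
    simp only [norm_mul, this, Complex.norm_exp_ofReal_mul_I, mul_one]
  | succ k ih =>
    intro F hF hper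
    have hd : ContDiff ℝ ((⊤ : ℕ∞) : WithTop ℕ∞) (deriv F) := (contDiff_infty_iff_deriv.1 hF).2
    have hper' : ∀ θ, deriv F (θ + 2 * Real.pi) = deriv F θ := by
      intro θ
      rw [← deriv_comp_add_const]
      congr 1
      funext x
      exact hper x
    obtain ⟨C, hC⟩ := ih (deriv F) hd hper'
    refine ⟨C, fun n => ?_⟩
    have hFd : ∀ x, HasDerivAt F (deriv F x) x := fun x =>
      ((contDiff_infty_iff_deriv.1 hF).1 x).hasDerivAt
    have hE : ∀ x : ℝ, HasDerivAt (fun θ : ℝ => Complex.exp (-(n * θ * Complex.I)))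
        (Complex.exp (-(n * x * Complex.I)) * (-(n * Complex.I))) x := by
      intro x
      have h1 : HasDerivAt (fun θ : ℝ => -((n : ℂ) * (θ : ℂ) * Complex.I)) (-(n * Complex.I)) x := by
        have := (((hasDerivAt_id x).ofReal_comp.const_mul (n : ℂ)).mul_const Complex.I).fun_neg
        simpa using this
      exact h1.cexp
    have hparts := intervalIntegral.integral_mul_deriv_eq_deriv_mul_of_hasDerivAt
      (a := -Real.pi) (b := Real.pi) hF.continuous.continuousOn
      (fun x _ => (hE x).continuousAt.continuousWithinAt)
      (fun x _ => hFd x) (fun x _ => hE x) (hd.continuous.intervalIntegrable _ _)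
      ((by fun_prop : Continuous fun x : ℝ =>
        Complex.exp (-(n * x * Complex.I)) * (-(n * Complex.I))).intervalIntegrable _ _)
    have hb : F Real.pi * Complex.exp (-(n * (Real.pi : ℝ) * Complex.I))
        = F (-Real.pi) * Complex.exp (-(n * ((-Real.pi : ℝ) : ℂ) * Complex.I)) := by
      have e1 : F Real.pi = F (-Real.pi) := by
        have := hper (-Real.pi)
        rw [← this]; congr 1; ring
      have e2 : Complex.exp (-(n * ((-Real.pi : ℝ) : ℂ) * Complex.I))
          = Complex.exp (-(n * (Real.pi : ℝ) * Complex.I)) := by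
        rw [Complex.exp_eq_exp_iff_exists_int]
        exact ⟨n, by push_cast; ring⟩
      rw [e1, e2]
    rw [hb, sub_self, zero_sub] at hparts
    have hl : (∫ θ in (-Real.pi)..Real.pi, F θ *
          (Complex.exp (-(n * θ * Complex.I)) * (-(n * Complex.I))))
        = (∫ θ in (-Real.pi)..Real.pi, F θ * Complex.exp (-(n * θ * Complex.I))) *
          (-(n * Complex.I)) := by
      rw [← intervalIntegral.integral_mul_const]
      congr 1; funext θ; ring
    rw [hl] at hparts
    have hnorm := congrArg norm hparts
    rw [norm_mul, norm_neg, norm_neg, norm_mul, Complex.norm_I, mul_one, Complex.norm_intCast]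
      at hnorm
    have := hC n
    rw [← hnorm] at this
    calc _ = _ := by ring
      _ ≤ C := this

theorem circleCoeff_decay {u : Circle → ℂ} (hu : IsSmoothOnCircle u) (k : ℕ) :
    ∃ C : ℝ, ∀ n : ℤ, |(n : ℝ)| ^ k * ‖circleCoeff u n‖ ≤ C := by
  obtain ⟨C, hC⟩ := circleCoeff_decay_aux k (fun θ : ℝ => u (Circle.exp θ)) hu
    (fun θ => by simp [Circle.exp_add])
  refine ⟨‖(1 / (2 * Real.pi) : ℂ)‖ * C, fun n => ?_⟩
  have := mul_le_mul_of_nonneg_left (hC n) (norm_nonneg (1 / (2 * Real.pi) : ℂ))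
  rw [circleCoeff, norm_mul]
  calc _ = _ := by ring
    _ ≤ _ := this

theorem summable_circleCoeff {u : Circle → ℂ} (hu : IsSmoothOnCircle u) (k : ℕ) :
    Summable fun n : ℤ => |(n : ℝ)| ^ k * ‖circleCoeff u n‖ := by
  obtain ⟨C, hC⟩ := circleCoeff_decay hu (k + 2)
  have hs : Summable fun n : ℤ => C * (1 / (n : ℝ) ^ 2) :=
    (Real.summable_one_div_int_pow.2 (by norm_num)).mul_left C
  refine Summable.of_norm_bounded_eventually hs ?_
  rw [Filter.eventually_cofinite]
  refine (Set.finite_singleton (0 : ℤ)).subset fun n hn => ?_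
  by_contra h0
  apply hn
  have hn0 : (0 : ℝ) < (n : ℝ) ^ 2 := by
    have : (n : ℝ) ≠ 0 := by exact_mod_cast h0
    positivity
  rw [Real.norm_of_nonneg (by positivity), mul_one_div, le_div_iff₀ hn0]
  have := hC n
  rw [pow_add, sq_abs] at this
  calc _ = _ := by ring
    _ ≤ _ := this

/-- The function `Λu = ∑_n |n| û_n e^{inθ}`. -/
def dnFun (u : Circle → ℂ) (z : Circle) : ℂ :=
  ∑' n : ℤ, ((|n| : ℤ) : ℂ) * circleCoeff u n * (z : ℂ) ^ n

theorem norm_circle_zpow (z : Circle) (n : ℤ) : ‖(z : ℂ) ^ n‖ = 1 := by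
  rw [norm_zpow, Circle.norm_coe, one_zpow]

theorem summable_dnFun {u : Circle → ℂ} (hu : IsSmoothOnCircle u) (z : Circle) :
    Summable fun n : ℤ => ((|n| : ℤ) : ℂ) * circleCoeff u n * (z : ℂ) ^ n := by
  refine Summable.of_norm ?_
  refine (summable_circleCoeff hu 1).congr fun n => ?_
  rw [norm_mul, norm_mul, norm_circle_zpow, mul_one, pow_one]
  simp

theorem dnFun_smooth {u : Circle → ℂ} (hu : IsSmoothOnCircle u) : IsSmoothOnCircle (dnFun u) := by
  have key : ∀ (n : ℤ) (θ : ℝ), ((Circle.exp θ : Circle) : ℂ) ^ n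
      = Complex.exp ((n * Complex.I) * θ) := by
    intro n θ
    rw [Circle.coe_exp, ← Complex.exp_int_mul]
    congr 1; ring
  have hiter : ∀ (c : ℂ) (k : ℕ), iteratedDeriv k (fun θ : ℝ => Complex.exp (c * θ))
      = fun θ : ℝ => c ^ k * Complex.exp (c * θ) := by
    intro c k
    induction k with
    | zero => simp
    | succ k ih =>
      rw [iteratedDeriv_succ, ih]
      funext θ
      have h1 : HasDerivAt (fun θ : ℝ => c * (θ : ℂ)) c θ := by
        simpa using (hasDerivAt_id θ).ofReal_comp.const_mul c
      rw [(h1.cexp.const_mul (c ^ k)).deriv]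
      ring
  unfold IsSmoothOnCircle dnFun
  refine contDiff_tsum (v := fun k (n : ℤ) => |(n : ℝ)| ^ (k + 1) * ‖circleCoeff u n‖) ?_ ?_ ?_
  · intro n
    simp only [key]
    have : ContDiff ℝ ((⊤ : ℕ∞) : WithTop ℕ∞) fun θ : ℝ => (n * Complex.I) * (θ : ℂ) :=
      contDiff_const.mul Complex.ofRealCLM.contDiff
    exact contDiff_const.mul this.cexp
  · intro k _
    exact summable_circleCoeff hu (k + 1)
  · intro k n θ _
    simp only [key]
    rw [norm_iteratedFDeriv_eq_norm_iteratedDeriv, iteratedDeriv_const_mul_field, hiter]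
    have hx : ‖Complex.exp ((n * Complex.I) * θ)‖ = 1 := by
      rw [← key, norm_circle_zpow]
    rw [norm_mul, norm_mul, norm_mul, hx, norm_pow, norm_mul, Complex.norm_I, mul_one,
      Complex.norm_intCast, mul_one, pow_succ]
    refine le_of_eq ?_
    simp
    ring

theorem circle_intervalIntegrable {u : Circle → ℂ} (hu : IsSmoothOnCircle u) (n : ℤ) :
    IntervalIntegrable (fun θ : ℝ => u (Circle.exp θ) * Complex.exp (-(n * θ * Complex.I)))
      MeasureTheory.volume (-Real.pi) Real.pi := by
  have h : Continuous fun θ : ℝ => u (Circle.exp θ) := ContDiff.continuous hu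
  exact (h.mul (by fun_prop)).intervalIntegrable _ _

/-- The Dirichlet-to-Neumann operator `Λ = (-d²/dθ²)^{1/2}` of the unit disc on `C^∞(𝕊)`:
the linear operator with `Λ e^{inθ} = |n| e^{inθ}`. -/
def dnDisc : Module.End ℂ SmoothCircle where
  toFun u := ⟨dnFun u, dnFun_smooth u.2⟩
  map_add' u v := by
    have hc : ∀ n, circleCoeff (fun z => (u : Circle → ℂ) z + (v : Circle → ℂ) z) n
        = circleCoeff u n + circleCoeff v n := by
      intro n
      unfold circleCoeff
      rw [← mul_add, ← intervalIntegral.integral_add (circle_intervalIntegrable u.2 n)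
        (circle_intervalIntegrable v.2 n)]
      simp only [add_mul]
    refine Subtype.ext (funext fun z => ?_)
    change dnFun (fun z => (u : Circle → ℂ) z + (v : Circle → ℂ) z) z = dnFun u z + dnFun v z
    unfold dnFun
    rw [← (summable_dnFun u.2 z).tsum_add (summable_dnFun v.2 z)]
    simp only [hc, mul_add, add_mul]
  map_smul' c u := by
    have hc : ∀ n, circleCoeff (fun z => c * (u : Circle → ℂ) z) n = c * circleCoeff u n := by
      intro n
      unfold circleCoeff
      simp only [mul_assoc]
      rw [intervalIntegral.integral_const_mul]
      ring
    refine Subtype.ext (funext fun z => ?_)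
    change dnFun (fun z => c * (u : Circle → ℂ) z) z = c * dnFun u z
    unfold dnFun
    rw [← tsum_mul_left]
    simp only [hc]
    congr 1; funext n; ring

/-- The operator of multiplication by a smooth function `f` on `C^∞(𝕊)`. -/
def mulOp (f : Circle → ℂ) (hf : IsSmoothOnCircle f) : Module.End ℂ SmoothCircle where
  toFun u := ⟨fun z => f z * (u : Circle → ℂ) z,
    (ContDiff.mul hf u.2 : ContDiff ℝ _ (fun θ : ℝ => f (Circle.exp θ) *
      (u : Circle → ℂ) (Circle.exp θ)))⟩
  map_add' u v := by ext z; exact mul_add _ _ _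
  map_smul' c u := by ext z; exact mul_left_comm _ _ _

theorem sqrt_smooth {a : Circle → ℝ} (ha : IsSmoothOnCircle a) (hpos : ∀ z, 0 < a z) :
    IsSmoothOnCircle fun z => ((Real.sqrt (a z) : ℝ) : ℂ) :=
  Complex.ofRealCLM.contDiff.comp (ContDiff.sqrt ha fun θ => (hpos (Circle.exp θ)).ne')

/-- The operator `Λ_a = a^{1/2} Λ a^{1/2}` on `C^∞(𝕊)`. -/
def steklovOp (a : Circle → ℝ) (ha : IsSmoothOnCircle a) (hpos : ∀ z, 0 < a z) :
    Module.End ℂ SmoothCircle :=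
  mulOp _ (sqrt_smooth ha hpos) ∘ₗ dnDisc ∘ₗ mulOp _ (sqrt_smooth ha hpos)

/-- `lam 0 = 0 < lam 1 ≤ lam 2 ≤ …` is the Steklov spectrum of `a`: the list of all eigenvalues of
`Λ_a`, each repeated according to its multiplicity. -/
structure IsSteklovSpectrum (a : Circle → ℝ) (ha : IsSmoothOnCircle a) (hpos : ∀ z, 0 < a z)
    (lam : ℕ → ℝ) : Prop where
  zero : lam 0 = 0
  pos : 0 < lam 1
  mono : Monotone lam
  multiplicity : ∀ μ : ℂ, Set.encard {n : ℕ | (lam n : ℂ) = μ} =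
    Cardinal.toENat (Module.rank ℂ (Module.End.eigenspace (steklovOp a ha hpos) μ))

/-- `Z` is the zeta function `ζ_a`: the meromorphic function on `ℂ`, holomorphic away from a simple
pole at `s = 1`, which is given by the convergent series `∑_{n ≥ 1} λ_n(a)^{-s}` for `Re s > 1`.
(The value `Z 1` at the pole carries no information.) -/
structure IsSteklovZeta (a : Circle → ℝ) (ha : IsSmoothOnCircle a) (hpos : ∀ z, 0 < a z)
    (Z : ℂ → ℂ) : Prop where
  hasSum : ∃ lam : ℕ → ℝ, IsSteklovSpectrum a ha hpos lam ∧
    ∀ s : ℂ, 1 < s.re → HasSum (fun n : ℕ => (lam (n + 1) : ℂ) ^ (-s)) (Z s)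
  holomorphic : DifferentiableOn ℂ Z {1}ᶜ
  simplePole : meromorphicOrderAt Z 1 = -1

/-- `L(a) = ∫_{-π}^{π} a(e^{iθ})⁻¹ dθ`. -/
def steklovLength (a : Circle → ℝ) : ℝ :=
  ∫ θ in (-Real.pi)..Real.pi, (a (Circle.exp θ))⁻¹

/-- `ψ(s) = (L(a)/2π)^s ζ_a(-s) - 2 ζ_R(-s)` for real `s`, where `Z` stands for `ζ_a`. -/
def zetaExcess (a : Circle → ℝ) (Z : ℂ → ℂ) (s : ℝ) : ℂ :=
  ((steklovLength a / (2 * Real.pi) : ℝ) : ℂ) ^ (s : ℂ) * Z (-(s : ℂ)) - 2 * riemannZeta (-(s : ℂ))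

/-- `Ψ` is a conformal transformation of the unit disc: it is continuous on the closed disc and
maps the open disc biholomorphically onto itself. -/
structure IsConformalOfDisc (Ψ : ℂ → ℂ) : Prop where
  continuousOn : ContinuousOn Ψ (Metric.closedBall 0 1)
  holomorphic : DifferentiableOn ℂ Ψ (Metric.ball 0 1)
  mapsTo : Set.MapsTo Ψ (Metric.ball 0 1) (Metric.ball 0 1)
  exists_inverse : ∃ Φ : ℂ → ℂ, DifferentiableOn ℂ Φ (Metric.ball 0 1) ∧
    Set.MapsTo Φ (Metric.ball 0 1) (Metric.ball 0 1) ∧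
    Set.InvOn Φ Ψ (Metric.ball 0 1) (Metric.ball 0 1)

/-- `Ψ` is anticonformal if its complex conjugate is conformal. -/
def IsAnticonformalOfDisc (Ψ : ℂ → ℂ) : Prop :=
  IsConformalOfDisc fun z => (starRingEnd ℂ) (Ψ z)

/-- `a` and `b` are conformally equivalent: there is a conformal or anticonformal transformation
`Ψ` of the disc such that `b = a ∘ ψ · |dψ/dθ|⁻¹`, where `ψ = Ψ|_𝕊 : 𝕊 → 𝕊`. -/
def ConformallyEquivalent (a b : Circle → ℝ) : Prop :=
  ∃ Ψ : ℂ → ℂ, (IsConformalOfDisc Ψ ∨ IsAnticonformalOfDisc Ψ) ∧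
    ∃ ψ : Circle → Circle, (∀ z : Circle, (ψ z : ℂ) = Ψ z) ∧
      ∀ θ : ℝ, b (Circle.exp θ) =
        a (ψ (Circle.exp θ)) * ‖deriv (fun t : ℝ => (ψ (Circle.exp t) : ℂ)) θ‖⁻¹

end

/-! ### Fourier analysis on the circle and the arc-length coordinate -/

noncomputable section

open ComplexConjugate

/-! Put `l = L / 2π` and `τ = 1 / (l a)`, a density of mass `2π` with primitive `T`, and let `e =
exp (i T)` be the arc-length coordinate, `σ` its inverse. With `w = a^(1/2) u`, the equation `Λ_a u
= μ u` becomes `Λ w = (l μ) τ w`. For the Fourier coefficients of `w ∘ σ` this is the eigenvalue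
equation of the Hermitian matrix `P n m = ⟨Λ e^m, e^n⟩ = ∑ |k| U m k conj (U n k)`, where `U m k`
are the coefficients of `e^m`. When `m` and `k` have opposite signs, `U m k` is an oscillatory
integral without stationary points, so `P = |n| + K` with `K` rapidly decreasing in both indices
(`isSmoothing_K`). Min-max then shows that the numbers `lam k = l λ_k(a)` approach `0, 1, 1, 2, 2,
…` faster than any power (`exists_abs_sub_le`). Hence `ζ_a` is `l^s` times the sum of `2 ζ_R(s)` and
an entire function, and for `s ≥ 1` the excess `ψ(s)` is the sum of the differences of the `s`-th
powers of the two spectra.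

Growth comes from a trace inequality. The degree identity `∑ k |U n k|² = n` gives `d n = P n n ≥
|n|`, and for `n ≥ 0` equality means that `e^n` has no negative frequencies, that is, extends
holomorphically to the disc. Jensen's inequality for the spectral measures of the basis vectors,
summed over all of them, yields `f (d n) - f n ≤ ∑ (f (lam k) - f (discEigenvalue k))` for every
single `n` (`le_tsum_sub`). For `f = x^s` and `f = x^s log x` the right side is `ψ(s)` and `ψ'(s)`.
Some `n` with `d n > n`, `n ≥ e^α` and `n ≥ e` therefore gives both lower bounds.

It remains to treat the case where `d n = n` for all large `n`. Then two consecutive powers of `e`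
extend to the disc, and so does their quotient `e` (`HasDiscExtension.of_pow`). Then all `d n = n`,
`K = 0`, the spectrum is that of the disc, and alternative (1) holds. Extension of `e` is equivalent
to extension of `σ`, which satisfies `|σ'| = l a ∘ σ`; this is conformal equivalence to `1`
(`conformallyEquivalent_iff`). -/

instance fact_two_pi_pos : Fact (0 < 2 * Real.pi) := ⟨Real.two_pi_pos⟩

theorem Circle.isQuotientMap_exp : Topology.IsQuotientMap Circle.exp :=
  isLocalHomeomorph_circleExp.isOpenMap.isQuotientMap Circle.exp.continuous
    fun z => ⟨_, Circle.exp_arg z⟩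

theorem IsSmoothOnCircle.continuous {E : Type*} [NormedAddCommGroup E] [NormedSpace ℝ E]
    {u : Circle → E} (hu : IsSmoothOnCircle u) : Continuous u :=
  Circle.isQuotientMap_exp.continuous_iff.2 (ContDiff.continuous hu)

theorem Circle.coe_exp_zpow (n : ℤ) (θ : ℝ) :
    ((Circle.exp θ : Circle) : ℂ) ^ n = Complex.exp (n * θ * Complex.I) := by
  rw [Circle.coe_exp, ← Complex.exp_int_mul, mul_assoc]

theorem continuous_circle_coe : Continuous fun z : Circle => (z : ℂ) := by fun_prop

theorem continuous_circle_zpow (n : ℤ) : Continuous fun z : Circle => (z : ℂ) ^ n :=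
  continuous_circle_coe.zpow₀ n fun z => Or.inl (Circle.coe_ne_zero z)

theorem Circle.conj_coe_zpow (z : Circle) (n : ℤ) : conj ((z : ℂ) ^ n) = (z : ℂ) ^ (-n) := by
  rw [map_zpow₀, ← Circle.coe_inv_eq_conj, Circle.coe_inv, inv_zpow, zpow_neg]

/-- The mean of a function over the circle. -/
def circleMean (u : Circle → ℂ) : ℂ :=
  (1 / (2 * Real.pi) : ℂ) * ∫ θ in (-Real.pi)..Real.pi, u (Circle.exp θ)

theorem circleCoeff_eq_circleMean (u : Circle → ℂ) (n : ℤ) :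
    circleCoeff u n = circleMean fun z => u z * (z : ℂ) ^ (-n) := by
  simp only [circleCoeff, circleMean, Circle.coe_exp_zpow]
  congr 2; funext θ; push_cast; congr 2; ring

theorem circleMean_eq_circleCoeff (u : Circle → ℂ) : circleMean u = circleCoeff u 0 := by
  simp [circleCoeff_eq_circleMean]

theorem circleMean_const (c : ℂ) : circleMean (fun _ => c) = c := by
  have := Real.pi_ne_zero
  simp only [circleMean, intervalIntegral.integral_const, Complex.real_smul]
  push_cast
  field_simp
  ring

theorem circleMean_mul_left (c : ℂ) (u : Circle → ℂ) :
    circleMean (fun z => c * u z) = c * circleMean u := by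
  simp only [circleMean, intervalIntegral.integral_const_mul]; ring

theorem circleMean_conj (u : Circle → ℂ) :
    circleMean (fun z => conj (u z)) = conj (circleMean u) := by
  simp only [circleMean, map_mul, intervalIntegral, map_sub, integral_conj]
  simp [Complex.conj_ofNat]

theorem circleCoeff_conj (u : Circle → ℂ) (n : ℤ) :
    circleCoeff (fun z => conj (u z)) n = conj (circleCoeff u (-n)) := by
  simp only [circleCoeff_eq_circleMean, ← circleMean_conj, map_mul, Circle.conj_coe_zpow, neg_neg]

/-- The function on `ℝ / 2πℤ` that corresponds to a continuous function on the circle. -/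
def toAddCircleFun (u : Circle → ℂ) (hu : Continuous u) : C(AddCircle (2 * Real.pi), ℂ) :=
  ⟨fun x => u x.toCircle, hu.comp AddCircle.continuous_toCircle⟩

theorem AddCircle.toCircle_two_pi_coe (x : ℝ) :
    AddCircle.toCircle (x : AddCircle (2 * Real.pi)) = Circle.exp x := by
  rw [AddCircle.toCircle_apply_mk, div_self Real.two_pi_pos.ne', one_mul]

theorem fourierCoeff_toAddCircleFun (u : Circle → ℂ) (hu : Continuous u) (n : ℤ) :
    fourierCoeff (toAddCircleFun u hu) n = circleCoeff u n := by
  rw [fourierCoeff_eq_intervalIntegral _ n (-Real.pi), circleCoeff]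
  have h : -Real.pi + 2 * Real.pi = Real.pi := by ring
  rw [h, Complex.real_smul]
  push_cast
  congr 1
  refine intervalIntegral.integral_congr fun x _ => ?_
  simp only [fourier_coe_apply, toAddCircleFun, ContinuousMap.coe_mk, smul_eq_mul,
    AddCircle.toCircle_two_pi_coe]
  rw [mul_comm]
  congr 2
  have := Real.pi_ne_zero
  push_cast
  field_simp

/-- Parseval, transported from the Hilbert basis of exponentials on `AddCircle (2 * Real.pi)`. -/
theorem hasSum_circleCoeff_mul_conj {u v : Circle → ℂ} (hu : Continuous u) (hv : Continuous v) :
    HasSum (fun n : ℤ => circleCoeff u n * conj (circleCoeff v n))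
      (circleMean fun z => u z * conj (v z)) := by
  have h := (fourierBasis (T := 2 * Real.pi)).hasSum_inner_mul_inner
    (ContinuousMap.toLp (E := ℂ) 2 AddCircle.haarAddCircle ℂ (toAddCircleFun v hv))
    (ContinuousMap.toLp (E := ℂ) 2 AddCircle.haarAddCircle ℂ (toAddCircleFun u hu))
  have e : ∀ (w : Circle → ℂ) (hw : Continuous w) (n : ℤ),
      inner ℂ (fourierBasis (T := 2 * Real.pi) n)
        (ContinuousMap.toLp (E := ℂ) 2 AddCircle.haarAddCircle ℂ (toAddCircleFun w hw))
        = circleCoeff w n := by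
    intro w hw n
    rw [← HilbertBasis.repr_apply_apply, fourierBasis_repr, fourierCoeff_toLp,
      fourierCoeff_toAddCircleFun]
  convert! h using 1
  · funext n
    rw [e u hu n, ← inner_conj_symm, e v hv n, mul_comm]
  · rw [MeasureTheory.ContinuousMap.inner_toLp, circleMean_eq_circleCoeff,
      ← fourierCoeff_toAddCircleFun (fun z => u z * conj (v z)) (hu.mul (Complex.continuous_conj.comp hv))]
    simp only [fourierCoeff, neg_zero, fourier_zero, one_smul]
    rfl

theorem summable_norm_circleCoeff_sq {u : Circle → ℂ} (hu : Continuous u) :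
    Summable fun n : ℤ => ‖circleCoeff u n‖ ^ 2 := by
  have := (hasSum_circleCoeff_mul_conj hu hu).summable.norm
  refine this.congr fun n => ?_
  rw [norm_mul, RCLike.norm_conj, sq]

theorem hasSum_circleCoeff_of_summable {u : Circle → ℂ} (hu : Continuous u)
    (hs : Summable (circleCoeff u)) (z : Circle) :
    HasSum (fun n : ℤ => circleCoeff u n * (z : ℂ) ^ n) (u z) := by
  have hs' : Summable (fourierCoeff (toAddCircleFun u hu)) := by
    simpa only [funext (fourierCoeff_toAddCircleFun u hu)] using hs
  have h := has_pointwise_sum_fourier_series_of_summable hs' ((Complex.arg z : ℝ) : AddCircle _)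
  have hz : AddCircle.toCircle ((Complex.arg z : ℝ) : AddCircle (2 * Real.pi)) = z := by
    rw [AddCircle.toCircle_two_pi_coe, Circle.exp_arg]
  convert! h using 1
  · funext n
    rw [fourierCoeff_toAddCircleFun, fourier_apply, AddCircle.toCircle_zsmul, hz, smul_eq_mul]
    simp
  · simp only [toAddCircleFun, ContinuousMap.coe_mk, hz]

theorem eq_zero_of_circleCoeff_eq_zero {u : Circle → ℂ} (hu : Continuous u)
    (h : ∀ n, circleCoeff u n = 0) : u = 0 := by
  funext z
  have hs : Summable (circleCoeff u) := by rw [funext h]; exact summable_zero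
  have := hasSum_circleCoeff_of_summable hu hs z
  simp only [h, zero_mul] at this
  exact this.unique hasSum_zero

theorem circleMean_add {u v : Circle → ℂ} (hu : Continuous u) (hv : Continuous v) :
    circleMean (fun z => u z + v z) = circleMean u + circleMean v := by
  simp only [circleMean]
  rw [intervalIntegral.integral_add, mul_add]
  · exact (hu.comp Circle.exp.continuous).intervalIntegrable _ _
  · exact (hv.comp Circle.exp.continuous).intervalIntegrable _ _

theorem circleCoeff_sub {u v : Circle → ℂ} (hu : Continuous u) (hv : Continuous v) (n : ℤ) :
    circleCoeff (fun z => u z - v z) n = circleCoeff u n - circleCoeff v n := by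
  have hz : Continuous fun z : Circle => (z : ℂ) ^ (-n) :=
    continuous_circle_zpow _
  simp only [circleCoeff_eq_circleMean, sub_eq_add_neg, add_mul]
  rw [circleMean_add (u := fun z => u z * (z : ℂ) ^ (-n)) (v := fun z => -v z * (z : ℂ) ^ (-n))
    (hu.mul hz) (hv.neg.mul hz)]
  congr 1
  simpa using circleMean_mul_left (-1) fun z => v z * (z : ℂ) ^ (-n)

theorem circleCoeff_const_mul (c : ℂ) (u : Circle → ℂ) (n : ℤ) :
    circleCoeff (fun z => c * u z) n = c * circleCoeff u n := by
  simp only [circleCoeff_eq_circleMean, mul_assoc, circleMean_mul_left]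

/-- Integration by parts over a period of the circle. -/
theorem integral_mul_deriv_circle {F G F' G' : ℝ → ℂ} (hF : ∀ x, HasDerivAt F (F' x) x)
    (hG : ∀ x, HasDerivAt G (G' x) x) (hF' : Continuous F') (hG' : Continuous G')
    (pF : F Real.pi = F (-Real.pi)) (pG : G Real.pi = G (-Real.pi)) :
    ∫ x in (-Real.pi)..Real.pi, F x * G' x = -∫ x in (-Real.pi)..Real.pi, F' x * G x := by
  rw [intervalIntegral.integral_mul_deriv_eq_deriv_mul (fun x _ => hF x) (fun x _ => hG x)
    (hF'.intervalIntegrable _ _) (hG'.intervalIntegrable _ _), pF, pG, sub_self, zero_sub]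

theorem circleExp_neg_pi : Circle.exp (-Real.pi) = Circle.exp Real.pi := by
  rw [← Circle.exp_add_two_pi]; congr 1; ring

theorem circleCoeff_of_hasDerivAt {u v : Circle → ℂ} (hv : Continuous v)
    (h : ∀ θ : ℝ, HasDerivAt (fun t : ℝ => u (Circle.exp t)) (Complex.I * v (Circle.exp θ)) θ)
    (n : ℤ) : (n : ℂ) * circleCoeff u n = circleCoeff v n := by
  have hE : ∀ x : ℝ, HasDerivAt (fun θ : ℝ => Complex.exp (-(n * θ * Complex.I)))
      (Complex.exp (-(n * x * Complex.I)) * (-(n * Complex.I))) x := by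
    intro x
    have h1 : HasDerivAt (fun θ : ℝ => -((n : ℂ) * (θ : ℂ) * Complex.I)) (-(n * Complex.I)) x := by
      simpa using (((hasDerivAt_id x).ofReal_comp.const_mul (n : ℂ)).mul_const Complex.I).fun_neg
    exact h1.cexp
  have hper : Complex.exp (-(n * (Real.pi : ℝ) * Complex.I))
      = Complex.exp (-(n * ((-Real.pi : ℝ) : ℂ) * Complex.I)) := by
    rw [Complex.exp_eq_exp_iff_exists_int]
    exact ⟨-n, by push_cast; ring⟩
  have := integral_mul_deriv_circle h hE
    (continuous_const.mul (hv.comp Circle.exp.continuous)) (by fun_prop)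
    (by rw [circleExp_neg_pi]) hper
  simp only [← mul_assoc] at this
  simp only [mul_assoc Complex.I] at this
  rw [intervalIntegral.integral_mul_const, intervalIntegral.integral_const_mul] at this
  simp only [circleCoeff]
  have hI := Complex.I_ne_zero
  apply mul_left_cancel₀ hI
  linear_combination (-1 / (2 * Real.pi) : ℂ) * this

end

/-! ### Circle densities, the diffeomorphism `e` and its powers -/

noncomputable section

open ComplexConjugate

/-- The derivative of a function on the circle with respect to the angle. -/
def circleDeriv {E : Type*} [NormedAddCommGroup E] [NormedSpace ℝ E] (u : Circle → E)
    (z : Circle) : E :=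
  deriv (fun t : ℝ => u (Circle.exp t)) (Complex.arg z)

theorem Circle.exists_arg_exp (θ : ℝ) :
    ∃ n : ℤ, Complex.arg (Circle.exp θ) = θ + n * (2 * Real.pi) := by
  have h : Circle.exp (Complex.arg (Circle.exp θ)) = Circle.exp θ := Circle.exp_arg _
  obtain ⟨n, hn⟩ := Circle.exp_eq_exp.1 h
  exact ⟨n, hn⟩

theorem circleDeriv_exp {E : Type*} [NormedAddCommGroup E] [NormedSpace ℝ E] (u : Circle → E)
    (θ : ℝ) : circleDeriv u (Circle.exp θ) = deriv (fun t : ℝ => u (Circle.exp t)) θ := by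
  obtain ⟨n, hn⟩ := Circle.exists_arg_exp θ
  rw [circleDeriv, hn, ← deriv_comp_add_const]
  congr 1; funext t
  rw [(Circle.periodic_exp.int_mul n) t]

theorem IsSmoothOnCircle.hasDerivAt {E : Type*} [NormedAddCommGroup E] [NormedSpace ℝ E]
    {u : Circle → E} (hu : IsSmoothOnCircle u) (θ : ℝ) :
    HasDerivAt (fun t : ℝ => u (Circle.exp t)) (circleDeriv u (Circle.exp θ)) θ := by
  rw [circleDeriv_exp]
  exact ((contDiff_infty_iff_deriv.1 hu).1 θ).hasDerivAt

theorem IsSmoothOnCircle.circleDeriv {E : Type*} [NormedAddCommGroup E] [NormedSpace ℝ E]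
    {u : Circle → E} (hu : IsSmoothOnCircle u) : IsSmoothOnCircle (circleDeriv u) := by
  have : (fun θ : ℝ => _root_.circleDeriv u (Circle.exp θ))
      = deriv fun t : ℝ => u (Circle.exp t) := funext (circleDeriv_exp u)
  rw [IsSmoothOnCircle, this]
  exact (contDiff_infty_iff_deriv.1 hu).2

theorem IsSmoothOnCircle.mul {u v : Circle → ℂ} (hu : IsSmoothOnCircle u)
    (hv : IsSmoothOnCircle v) : IsSmoothOnCircle fun z => u z * v z := ContDiff.mul hu hv

theorem IsSmoothOnCircle.ofReal {u : Circle → ℝ} (hu : IsSmoothOnCircle u) :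
    IsSmoothOnCircle fun z => (u z : ℂ) := Complex.ofRealCLM.contDiff.comp hu

theorem isSmoothOnCircle_const (c : ℂ) : IsSmoothOnCircle fun _ => c := contDiff_const

/-- A positive smooth density on the circle of total mass `2π`. -/
structure CircleDensity where
  /-- the density -/
  τ : Circle → ℝ
  smooth : IsSmoothOnCircle τ
  pos : ∀ z, 0 < τ z
  mass : ∫ θ in (-Real.pi)..Real.pi, τ (Circle.exp θ) = 2 * Real.pi

namespace CircleDensity

variable (D : CircleDensity)

/-- The primitive of the density. -/
def T (θ : ℝ) : ℝ := ∫ x in (0 : ℝ)..θ, D.τ (Circle.exp x)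

theorem continuous_τ_exp : Continuous fun x : ℝ => D.τ (Circle.exp x) := ContDiff.continuous D.smooth

theorem hasDerivAt_T (θ : ℝ) : HasDerivAt D.T (D.τ (Circle.exp θ)) θ :=
  intervalIntegral.integral_hasDerivAt_right (D.continuous_τ_exp.intervalIntegrable _ _)
    (D.continuous_τ_exp.stronglyMeasurableAtFilter _ _) D.continuous_τ_exp.continuousAt

theorem continuous_T : Continuous D.T :=
  continuous_iff_continuousAt.2 fun θ => (D.hasDerivAt_T θ).continuousAt

theorem contDiff_T : ContDiff ℝ ((⊤ : ℕ∞) : WithTop ℕ∞) D.T := by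
  rw [contDiff_infty_iff_deriv]
  refine ⟨fun θ => (D.hasDerivAt_T θ).differentiableAt, ?_⟩
  rw [funext fun θ => (D.hasDerivAt_T θ).deriv]
  exact D.smooth

theorem strictMono_T : StrictMono D.T :=
  strictMono_of_hasDerivAt_pos D.hasDerivAt_T fun _ => D.pos _

theorem T_add_two_pi (θ : ℝ) : D.T (θ + 2 * Real.pi) = D.T θ + 2 * Real.pi := by
  have hper : Function.Periodic (fun x : ℝ => D.τ (Circle.exp x)) (2 * Real.pi) := fun x => by
    simp only [Circle.exp_add_two_pi]
  rw [T, T, ← intervalIntegral.integral_add_adjacent_intervals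
    (D.continuous_τ_exp.intervalIntegrable 0 θ) (D.continuous_τ_exp.intervalIntegrable θ _),
    hper.intervalIntegral_add_eq θ (-Real.pi), show -Real.pi + 2 * Real.pi = Real.pi by ring,
    D.mass]

/-- `T x - x` is continuous and periodic, hence bounded, so `T` is unbounded in both directions. -/
theorem surjective_T : Function.Surjective D.T := by
  have hper : Function.Periodic (fun x : ℝ => D.T x - x) (2 * Real.pi) := fun x => by
    simp only [D.T_add_two_pi]; ring
  obtain ⟨C, hC⟩ := (hper.isBounded_of_continuous Real.two_pi_pos.ne'
    (D.continuous_T.sub continuous_id)).exists_norm_le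
  have hb : ∀ x, |D.T x - x| ≤ C := fun x => hC _ ⟨x, rfl⟩
  refine D.continuous_T.surjective ?_ ?_
  · refine Filter.tendsto_atTop_mono (f := fun x => x - C) (fun x => ?_)
      (Filter.tendsto_atTop_add_const_right _ _ Filter.tendsto_id)
    linarith [(abs_le.1 (hb x)).1]
  · refine Filter.tendsto_atBot_mono (g := D.T) (f := fun x => x + C) (fun x => ?_)
      (Filter.tendsto_atBot_add_const_right _ _ Filter.tendsto_id)
    linarith [(abs_le.1 (hb x)).2]

/-- The primitive of the density as an order isomorphism of the line. -/
def orderIso : ℝ ≃o ℝ := StrictMono.orderIsoOfSurjective D.T D.strictMono_T D.surjective_T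

/-- The inverse of the primitive of the density. -/
def S : ℝ → ℝ := D.orderIso.symm

theorem S_T (θ : ℝ) : D.S (D.T θ) = θ := D.orderIso.symm_apply_apply θ

theorem T_S (t : ℝ) : D.T (D.S t) = t := D.orderIso.apply_symm_apply t

theorem continuous_S : Continuous D.S := D.orderIso.symm.continuous

theorem hasDerivAt_S (t : ℝ) : HasDerivAt D.S (D.τ (Circle.exp (D.S t)))⁻¹ t :=
  (D.hasDerivAt_T (D.S t)).of_local_left_inverse D.continuous_S.continuousAt (D.pos _).ne'
    (Filter.Eventually.of_forall D.T_S)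

/-- Bootstrap: `S' = 1 / τ (exp S)` is as smooth as `S`, so `S` gains one derivative at each stage.
-/
theorem contDiff_S : ContDiff ℝ ((⊤ : ℕ∞) : WithTop ℕ∞) D.S := by
  rw [contDiff_infty]
  intro n
  induction n with
  | zero => exact contDiff_zero.2 D.continuous_S
  | succ n ih =>
    push_cast
    rw [contDiff_succ_iff_deriv]
    refine ⟨fun t => (D.hasDerivAt_S t).differentiableAt, by simp, ?_⟩
    rw [funext fun t => (D.hasDerivAt_S t).deriv]
    exact ((contDiff_infty.1 D.smooth n).comp ih).inv fun t => (D.pos _).ne'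

/-- The diffeomorphism of the circle whose angular derivative is the density. -/
def e (z : Circle) : Circle := Circle.exp (D.T (Complex.arg z))

/-- The inverse of `CircleDensity.e`. -/
def σ (z : Circle) : Circle := Circle.exp (D.S (Complex.arg z))

theorem T_add_int (θ : ℝ) (n : ℤ) :
    D.T (θ + n * (2 * Real.pi)) = D.T θ + n * (2 * Real.pi) := by
  have hper : Function.Periodic (fun x : ℝ => D.T x - x) (2 * Real.pi) := fun x => by
    simp only [D.T_add_two_pi]; ring
  have : D.T (θ + n * (2 * Real.pi)) - (θ + n * (2 * Real.pi)) = D.T θ - θ := hper.int_mul n θ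
  linarith

theorem S_add_int (t : ℝ) (n : ℤ) :
    D.S (t + n * (2 * Real.pi)) = D.S t + n * (2 * Real.pi) := by
  apply D.strictMono_T.injective
  rw [T_S, T_add_int, T_S]

theorem e_exp (θ : ℝ) : D.e (Circle.exp θ) = Circle.exp (D.T θ) := by
  obtain ⟨n, hn⟩ := Circle.exists_arg_exp θ
  rw [e, hn, T_add_int, (Circle.periodic_exp.int_mul n) _]

theorem σ_exp (t : ℝ) : D.σ (Circle.exp t) = Circle.exp (D.S t) := by
  obtain ⟨n, hn⟩ := Circle.exists_arg_exp t
  rw [σ, hn, S_add_int, (Circle.periodic_exp.int_mul n) _]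

theorem σ_e (z : Circle) : D.σ (D.e z) = z := by rw [e, σ_exp, S_T, Circle.exp_arg]

theorem e_σ (z : Circle) : D.e (D.σ z) = z := by rw [σ, e_exp, T_S, Circle.exp_arg]

theorem continuous_σ : Continuous D.σ :=
  Circle.isQuotientMap_exp.continuous_iff.2 <| by
    simpa only [Function.comp_def, σ_exp] using Circle.exp.continuous.comp D.continuous_S

theorem contDiff_exp_mul {f : ℝ → ℝ} (hf : ContDiff ℝ ((⊤ : ℕ∞) : WithTop ℕ∞) f) (n : ℤ) :
    ContDiff ℝ ((⊤ : ℕ∞) : WithTop ℕ∞) fun θ : ℝ => ((Circle.exp (f θ) : Circle) : ℂ) ^ n := by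
  simp only [Circle.coe_exp_zpow]
  exact ((contDiff_const.mul (Complex.ofRealCLM.contDiff.comp hf)).mul contDiff_const).cexp

theorem smooth_e_zpow (n : ℤ) : IsSmoothOnCircle fun z => (D.e z : ℂ) ^ n := by
  simpa only [IsSmoothOnCircle, e_exp] using contDiff_exp_mul D.contDiff_T n

theorem smooth_σ_zpow (n : ℤ) : IsSmoothOnCircle fun z => (D.σ z : ℂ) ^ n := by
  simpa only [IsSmoothOnCircle, σ_exp] using contDiff_exp_mul D.contDiff_S n

/-- Substitution `t = T θ`; the image of a period is a translated period, which periodicity moves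
back. -/
theorem circleMean_comp_e {W : Circle → ℂ} (hW : Continuous W) :
    circleMean (fun z => (D.τ z : ℂ) * W (D.e z)) = circleMean W := by
  simp only [circleMean, e_exp]
  congr 1
  have h := intervalIntegral.integral_deriv_smul_comp (a := -Real.pi) (b := Real.pi)
    (f := D.T) (f' := fun θ => D.τ (Circle.exp θ)) (g := fun t => W (Circle.exp t))
    (fun x _ => D.hasDerivAt_T x) D.continuous_τ_exp.continuousOn
    (hW.comp Circle.exp.continuous)
  simp only [Function.comp_def, Complex.real_smul] at h
  rw [h]
  have hp : D.T Real.pi = D.T (-Real.pi) + 2 * Real.pi := by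
    rw [← T_add_two_pi]; congr 1; ring
  have hper : Function.Periodic (fun x : ℝ => W (Circle.exp x)) (2 * Real.pi) := fun x => by
    simp only [Circle.exp_add_two_pi]
  rw [hp, hper.intervalIntegral_add_eq _ (-Real.pi)]
  congr 1; ring

/-- The coefficient with index `k` of the `n`-th power of `e`. -/
def U (n k : ℤ) : ℂ := circleCoeff (fun z => (D.e z : ℂ) ^ n) k

theorem hasDerivAt_e_zpow (n : ℤ) (θ : ℝ) :
    HasDerivAt (fun t : ℝ => (D.e (Circle.exp t) : ℂ) ^ n)
      (Complex.I * (n * ((D.τ (Circle.exp θ) : ℂ) * (D.e (Circle.exp θ) : ℂ) ^ n))) θ := by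
  simp only [e_exp, Circle.coe_exp_zpow]
  convert! (((D.hasDerivAt_T θ).ofReal_comp.const_mul (n : ℂ)).mul_const Complex.I).cexp using 1
  ring

theorem continuous_e_zpow (n : ℤ) : Continuous fun z => (D.e z : ℂ) ^ n :=
  (D.smooth_e_zpow n).continuous

theorem continuous_σ_zpow (n : ℤ) : Continuous fun z => (D.σ z : ℂ) ^ n :=
  (D.smooth_σ_zpow n).continuous

theorem continuous_τ : Continuous fun z => (D.τ z : ℂ) := D.smooth.ofReal.continuous

theorem mul_U (n k : ℤ) :
    (k : ℂ) * D.U n k = n * circleCoeff (fun z => (D.τ z : ℂ) * (D.e z : ℂ) ^ n) k := by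
  rw [U, circleCoeff_of_hasDerivAt
    (continuous_const.fun_mul (D.continuous_τ.fun_mul (D.continuous_e_zpow n))) (D.hasDerivAt_e_zpow n),
    circleCoeff_const_mul]

theorem circleCoeff_τ_mul {W : Circle → ℂ} (hW : Continuous W) (k : ℤ) :
    circleCoeff (fun z => (D.τ z : ℂ) * W (D.e z)) k
      = circleMean fun z => W z * (D.σ z : ℂ) ^ (-k) := by
  rw [circleCoeff_eq_circleMean, ← D.circleMean_comp_e (hW.fun_mul (D.continuous_σ_zpow _))]
  simp only [σ_e, mul_assoc]

/-- Duality between the coefficients of the powers of `e` and of its inverse. -/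
theorem mul_U_eq (n k : ℤ) :
    (k : ℂ) * D.U n k = n * circleCoeff (fun z => (D.σ z : ℂ) ^ (-k)) (-n) := by
  rw [mul_U, D.circleCoeff_τ_mul (W := fun z => (z : ℂ) ^ n) (continuous_circle_zpow n),
    circleCoeff_eq_circleMean]
  simp only [neg_neg, mul_comm]

theorem circleMean_zpow (n : ℤ) : circleMean (fun z => (z : ℂ) ^ n) = if n = 0 then 1 else 0 := by
  split_ifs with h
  · simp only [h, zpow_zero, circleMean_const]
  · have h1 : ∀ θ : ℝ, HasDerivAt (fun t : ℝ => ((Circle.exp t : Circle) : ℂ) ^ n)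
        (Complex.I * (n * ((Circle.exp θ : Circle) : ℂ) ^ n)) θ := by
      intro θ
      simp only [Circle.coe_exp_zpow]
      convert! (((hasDerivAt_id θ).ofReal_comp.const_mul (n : ℂ)).mul_const Complex.I).cexp using 1
      simp
      ring
    have := circleCoeff_of_hasDerivAt (u := fun z : Circle => (z : ℂ) ^ n)
      (continuous_const.fun_mul (continuous_circle_zpow n)) h1 0
    rw [circleCoeff_const_mul, ← circleMean_eq_circleCoeff] at this
    have hn : (n : ℂ) ≠ 0 := by exact_mod_cast h
    simpa [hn] using this.symm

/-- `k U m k` is `m` times a coefficient of `τ e^m`, so Parseval reduces the sum to the mean of `τ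
e^(m-n)`, which is the mean of `z^(m-n)` after the substitution by `e`. The case `m = n` expresses
that `e` has degree one. -/
theorem hasSum_mul_U_mul_conj (m n : ℤ) :
    HasSum (fun k : ℤ => (k : ℂ) * D.U m k * conj (D.U n k)) (if n = m then (m : ℂ) else 0) := by
  have hc := D.continuous_τ.fun_mul (D.continuous_e_zpow m)
  have := (hasSum_circleCoeff_mul_conj hc (D.continuous_e_zpow n)).mul_left (m : ℂ)
  convert! this using 1
  · funext k; rw [mul_U]; simp only [U]; ring
  · have hW : Continuous fun z : Circle => (z : ℂ) ^ m * conj ((z : ℂ) ^ n) :=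
      (continuous_circle_zpow m).mul (Complex.continuous_conj.comp (continuous_circle_zpow n))
    simp only [mul_assoc]
    rw [D.circleMean_comp_e hW]
    simp only [Circle.conj_coe_zpow, ← zpow_add₀ (Circle.coe_ne_zero _), circleMean_zpow]
    rcases eq_or_ne n m with h | h
    · simp [h]
    · rw [if_neg h, if_neg (by omega), mul_zero]

theorem U_neg (n k : ℤ) : D.U (-n) k = conj (D.U n (-k)) := by
  simp only [U, ← circleCoeff_conj, Circle.conj_coe_zpow]

theorem norm_U_le (n k : ℤ) : ‖D.U n k‖ ≤ 1 := by
  rw [U, circleCoeff, norm_mul]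
  have h : ∀ θ ∈ Set.uIoc (-Real.pi) Real.pi, ‖(D.e (Circle.exp θ) : ℂ) ^ n
      * Complex.exp (-(k * θ * Complex.I))‖ ≤ 1 := by
    intro θ _
    have : Complex.exp (-(k * θ * Complex.I)) = ((Circle.exp θ : Circle) : ℂ) ^ (-k) := by
      rw [Circle.coe_exp_zpow]; push_cast; congr 1; ring
    rw [this, norm_mul, norm_circle_zpow, norm_circle_zpow, one_mul]
  have h1 := intervalIntegral.norm_integral_le_of_norm_le_const h
  have hpi := Real.pi_pos
  have h2 : ‖(1 / (2 * Real.pi) : ℂ)‖ = 1 / (2 * Real.pi) := by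
    rw [show (1 / (2 * Real.pi) : ℂ) = ((1 / (2 * Real.pi) : ℝ) : ℂ) by push_cast; rfl,
      Complex.norm_real, Real.norm_of_nonneg (by positivity)]
  rw [h2]
  calc _ ≤ 1 / (2 * Real.pi) * (1 * |Real.pi - -Real.pi|) := by gcongr
    _ = 1 := by rw [abs_of_pos (by linarith)]; field_simp; ring

end CircleDensity
end

/-! ### Oscillatory integrals without stationary points -/

noncomputable section

open ComplexConjugate

theorem exists_norm_le_of_continuous_circle {E : Type*} [NormedAddCommGroup E] {u : Circle → E}
    (hu : Continuous u) : ∃ C, 0 < C ∧ ∀ z, ‖u z‖ ≤ C := by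
  obtain ⟨C, hC⟩ := (isCompact_range hu).isBounded.exists_pos_norm_le
  exact ⟨C, hC.1, fun z => hC.2 _ ⟨z, rfl⟩⟩

namespace CircleDensity

variable (D : CircleDensity)

theorem exists_pos_le_τ : ∃ c, 0 < c ∧ c ≤ 1 ∧ ∀ z, c ≤ D.τ z := by
  have hc : Continuous fun z => (D.τ z)⁻¹ := D.smooth.continuous.inv₀ fun z => (D.pos z).ne'
  obtain ⟨C, hC, h⟩ := exists_norm_le_of_continuous_circle hc
  refine ⟨min 1 C⁻¹, by positivity, min_le_left _ _, fun z => (min_le_right _ _).trans ?_⟩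
  rw [inv_le_comm₀ hC (D.pos z)]
  exact (le_abs_self _).trans (h z)

/-- Non-stationary phase. -/
theorem exists_norm_integral_exp_le (j : ℕ) : ∀ h : Circle → ℂ, IsSmoothOnCircle h → ∀ a b : ℕ,
    ∃ C : ℝ, 0 ≤ C ∧ ∀ m k : ℕ, 0 < m + k →
      ‖∫ θ in (-Real.pi)..Real.pi, Complex.exp ((m * D.T θ + k * θ) * Complex.I) *
        (h (Circle.exp θ) * ((m : ℂ) ^ a / (m * D.τ (Circle.exp θ) + k) ^ (a + b)))‖
        ≤ C / ((m : ℝ) + k) ^ (b + j) := by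
  obtain ⟨c, hc0, hc1, hc⟩ := D.exists_pos_le_τ
  have hw : ∀ (m k : ℕ) (z : Circle), c * ((m : ℝ) + k) ≤ m * D.τ z + k := by
    intro m k z
    have h1 := mul_le_mul_of_nonneg_left (hc z) (Nat.cast_nonneg (α := ℝ) m)
    have h2 : c * k ≤ k := mul_le_of_le_one_left (Nat.cast_nonneg k) hc1
    linarith
  -- The powers `a`, `b` are free in order that the amplitudes form a class stable under integration
  -- by parts. Dividing by the phase derivative `m τ + k` and differentiating gives the amplitude of
  -- `(h', a, b + 1)` minus `a + b + 1` times that of `(h τ', a + 1, b + 1)`. Each round gains one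
  -- power of `m + k`, and `m ^ a` is always compensated by the denominator.
  induction j with
  | zero =>
    intro h hh a b
    obtain ⟨B, hB0, hB⟩ := exists_norm_le_of_continuous_circle hh.continuous
    refine ⟨B / c ^ (a + b) * (2 * Real.pi), by have := Real.pi_pos; positivity,
      fun m k hmk => ?_⟩
    have hN : 0 < (m : ℝ) + k := by exact_mod_cast hmk
    refine (intervalIntegral.norm_integral_le_of_norm_le_const
      (C := B / c ^ (a + b) / ((m : ℝ) + k) ^ b) fun θ _ => ?_).trans (le_of_eq ?_)
    · have e1 : ((m : ℂ) * D.T θ + k * θ) = ((m * D.T θ + k * θ : ℝ) : ℂ) := by push_cast; rfl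
      have e2 : ((m : ℂ) * D.τ (Circle.exp θ) + k) = ((m * D.τ (Circle.exp θ) + k : ℝ) : ℂ) := by
        push_cast; rfl
      have hp := hw m k (Circle.exp θ)
      have hp0 : 0 < c * ((m : ℝ) + k) := by positivity
      rw [e1, norm_mul, Complex.norm_exp_ofReal_mul_I, one_mul, norm_mul, norm_div, norm_pow,
        norm_pow, e2, Complex.norm_real, Real.norm_of_nonneg (hp0.le.trans hp), Complex.norm_natCast]
      calc ‖h (Circle.exp θ)‖ * ((m : ℝ) ^ a / (m * D.τ (Circle.exp θ) + k) ^ (a + b))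
          ≤ B * (((m : ℝ) + k) ^ a / (c * ((m : ℝ) + k)) ^ (a + b)) := by
            have hk := Nat.cast_nonneg (α := ℝ) k
            have := hp0.trans_le hp
            gcongr
            · exact hB _
            · exact le_add_of_nonneg_right hk
        _ = B / c ^ (a + b) / ((m : ℝ) + k) ^ b := by
            rw [mul_pow, pow_add ((m : ℝ) + k)]
            field_simp
    · rw [abs_of_pos (by linarith [Real.pi_pos])]
      simp only [add_zero]
      ring
  | succ j ih =>
    intro h hh a b
    have hτ' : IsSmoothOnCircle fun z => ((circleDeriv D.τ z : ℝ) : ℂ) := D.smooth.circleDeriv.ofReal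
    obtain ⟨C₁, hC₁, h₁⟩ := ih _ hh.circleDeriv a (b + 1)
    obtain ⟨C₂, hC₂, h₂⟩ := ih _ (hh.mul hτ') (a + 1) (b + 1)
    refine ⟨C₁ + (a + b + 1) * C₂, by positivity, fun m k hmk => ?_⟩
    have hN : 0 < (m : ℝ) + k := by exact_mod_cast hmk
    have hwne : ∀ z, ((m : ℂ) * D.τ z + k) ≠ 0 := by
      intro z
      have e2 : ((m : ℂ) * D.τ z + k) = ((m * D.τ z + k : ℝ) : ℂ) := by push_cast; rfl
      rw [e2]
      have : 0 < c * ((m : ℝ) + k) := by positivity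
      exact_mod_cast (this.trans_le (hw m k z)).ne'
    set E : ℝ → ℂ := fun θ => Complex.exp ((m * D.T θ + k * θ) * Complex.I) with hE
    have hEd : ∀ θ, HasDerivAt E (E θ * ((m * D.τ (Circle.exp θ) + k) * Complex.I)) θ := by
      intro θ
      have h1 := ((D.hasDerivAt_T θ).ofReal_comp.const_mul (m : ℂ)).fun_add
        ((hasDerivAt_id θ).ofReal_comp.const_mul (k : ℂ))
      convert! (h1.mul_const Complex.I).cexp using 1
      simp [hE]
    set W : ℝ → ℂ := fun θ => (m : ℂ) * D.τ (Circle.exp θ) + k with hW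
    have hWd : ∀ θ, HasDerivAt W (m * (circleDeriv D.τ (Circle.exp θ) : ℝ)) θ := fun θ =>
      ((D.smooth.hasDerivAt θ).ofReal_comp.const_mul (m : ℂ)).add_const _
    have hWc : Continuous W := continuous_iff_continuousAt.2 fun θ => (hWd θ).continuousAt
    have hW0 : ∀ θ, W θ ≠ 0 := fun θ => hwne _
    have hEc : Continuous E := continuous_iff_continuousAt.2 fun θ => (hEd θ).continuousAt
    set g₁ : ℝ → ℂ := fun θ => circleDeriv h (Circle.exp θ) * ((m : ℂ) ^ a / W θ ^ (a + (b + 1)))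
    set g₂ : ℝ → ℂ := fun θ => (h (Circle.exp θ) * ((circleDeriv D.τ (Circle.exp θ) : ℝ) : ℂ)) *
      ((m : ℂ) ^ (a + 1) / W θ ^ (a + 1 + (b + 1)))
    have c₁ : Continuous g₁ := (hh.circleDeriv.continuous.comp Circle.exp.continuous).mul
      (continuous_const.div (hWc.pow _) fun θ => pow_ne_zero _ (hW0 θ))
    have c₂ : Continuous g₂ := ((hh.mul hτ').continuous.comp Circle.exp.continuous).mul
      (continuous_const.div (hWc.pow _) fun θ => pow_ne_zero _ (hW0 θ))
    have hGd : ∀ θ, HasDerivAt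
        (fun θ => h (Circle.exp θ) * ((m : ℂ) ^ a / W θ ^ (a + (b + 1))))
        (g₁ θ - (a + b + 1) * g₂ θ) θ := by
      intro θ
      have h1 := (hh.hasDerivAt θ).fun_mul (((hWd θ).fun_pow (a + (b + 1))).fun_inv
        (pow_ne_zero _ (hW0 θ)) |>.const_mul ((m : ℂ) ^ a))
      simp only [← div_eq_mul_inv] at h1
      convert! h1 using 1
      simp only [g₁, g₂]
      have hx := hW0 θ
      have : a + (b + 1) - 1 = a + b := by omega
      rw [this]
      push_cast
      field_simp
      ring
    have hparts := integral_mul_deriv_circle hGd hEd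
      (c₁.sub (continuous_const.mul c₂)) (hEc.mul ((hWc).mul continuous_const))
      (by simp only [hW, circleExp_neg_pi]) (by
        have hT : D.T Real.pi = D.T (-Real.pi) + 2 * Real.pi := by
          rw [← T_add_two_pi]; congr 1; ring
        simp only [hE]
        rw [Complex.exp_eq_exp_iff_exists_int]
        -- Over the period `T` and `θ` both increase by `2π`, so the phase increases by `2π (m +
        -- k)`.
        refine ⟨m + k, ?_⟩
        rw [hT]; push_cast; ring)
    have hint : ∫ θ in (-Real.pi)..Real.pi, E θ * (h (Circle.exp θ) * ((m : ℂ) ^ a / W θ ^ (a + b)))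
        = Complex.I * ((∫ θ in (-Real.pi)..Real.pi, E θ * g₁ θ)
          - (a + b + 1) * ∫ θ in (-Real.pi)..Real.pi, E θ * g₂ θ) := by
      have e1 : ∀ θ, h (Circle.exp θ) * ((m : ℂ) ^ a / W θ ^ (a + (b + 1))) *
          (E θ * (W θ * Complex.I)) =
          Complex.I * (E θ * (h (Circle.exp θ) * ((m : ℂ) ^ a / W θ ^ (a + b)))) := by
        intro θ
        have hx := hW0 θ
        rw [← add_assoc, pow_succ]
        field_simp
      have e2 : ∀ θ, (g₁ θ - (a + b + 1) * g₂ θ) * E θ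
          = E θ * g₁ θ - (a + b + 1) * (E θ * g₂ θ) := fun θ => by ring
      have hparts' : ∫ x in (-Real.pi)..Real.pi, h (Circle.exp x) *
          ((m : ℂ) ^ a / W x ^ (a + (b + 1))) * (E x * (W x * Complex.I)) =
          -∫ x in (-Real.pi)..Real.pi, (g₁ x - (a + b + 1) * g₂ x) * E x := hparts
      simp only [e1, e2] at hparts'
      rw [intervalIntegral.integral_const_mul, intervalIntegral.integral_sub
        ((hEc.fun_mul c₁).intervalIntegrable _ _)
        ((continuous_const.fun_mul (hEc.fun_mul c₂)).intervalIntegrable _ _),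
        intervalIntegral.integral_const_mul] at hparts'
      linear_combination (-Complex.I) * hparts' +
        (∫ θ in (-Real.pi)..Real.pi, E θ * (h (Circle.exp θ) * ((m : ℂ) ^ a / W θ ^ (a + b)))) *
          Complex.I_mul_I
    change ‖∫ θ in (-Real.pi)..Real.pi, E θ *
      (h (Circle.exp θ) * ((m : ℂ) ^ a / W θ ^ (a + b)))‖ ≤ _
    rw [hint, norm_mul, Complex.norm_I, one_mul]
    have n1 : ‖∫ θ in (-Real.pi)..Real.pi, E θ * g₁ θ‖ ≤ C₁ / ((m : ℝ) + k) ^ (b + 1 + j) :=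
      h₁ m k hmk
    have n2 : ‖∫ θ in (-Real.pi)..Real.pi, E θ * g₂ θ‖ ≤ C₂ / ((m : ℝ) + k) ^ (b + 1 + j) :=
      h₂ m k hmk
    have n3 : ‖(a + b + 1 : ℂ)‖ = a + b + 1 := by
      rw [show (a + b + 1 : ℂ) = ((a + b + 1 : ℕ) : ℂ) by push_cast; rfl, Complex.norm_natCast]
      push_cast; rfl
    calc _ ≤ ‖∫ θ in (-Real.pi)..Real.pi, E θ * g₁ θ‖ +
          ‖(a + b + 1 : ℂ)‖ * ‖∫ θ in (-Real.pi)..Real.pi, E θ * g₂ θ‖ := by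
          rw [← norm_mul]; exact norm_sub_le _ _
      _ ≤ C₁ / ((m : ℝ) + k) ^ (b + 1 + j) +
          (a + b + 1) * (C₂ / ((m : ℝ) + k) ^ (b + 1 + j)) := by rw [n3]; gcongr
      _ = _ := by rw [show b + 1 + j = b + (j + 1) by omega]; ring

theorem exists_norm_U_le_of_nat (j : ℕ) : ∃ C : ℝ, 0 ≤ C ∧ ∀ m k : ℕ, 0 < m + k →
    ‖D.U m (-k)‖ ≤ C / ((m : ℝ) + k) ^ j := by
  obtain ⟨C, hC, h⟩ := D.exists_norm_integral_exp_le j (fun _ => 1) (isSmoothOnCircle_const 1) 0 0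
  refine ⟨C, hC, fun m k hmk => ?_⟩
  have h1 := h m k hmk
  have e1 : D.U m (-k) = (1 / (2 * Real.pi) : ℂ) * ∫ θ in (-Real.pi)..Real.pi,
      Complex.exp ((m * D.T θ + k * θ) * Complex.I) := by
    rw [U, circleCoeff]
    congr 2; funext θ
    rw [e_exp, Circle.coe_exp_zpow, ← Complex.exp_add]
    congr 1; push_cast; ring
  simp only [pow_zero, zero_add, div_one, mul_one] at h1
  rw [e1, norm_mul]
  have h2 : ‖(1 / (2 * Real.pi) : ℂ)‖ ≤ 1 := by
    rw [show (1 / (2 * Real.pi) : ℂ) = ((1 / (2 * Real.pi) : ℝ) : ℂ) by push_cast; rfl,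
      Complex.norm_real, Real.norm_of_nonneg (by positivity), div_le_one Real.two_pi_pos]
    linarith [Real.pi_gt_three]
  calc _ ≤ 1 * (C / ((m : ℝ) + k) ^ j) := by gcongr
    _ = _ := one_mul _

/-- For opposite signs the phase `m T(θ) - k θ` is monotone, with slope at least a fixed multiple of
`|m| + |k|`. Conjugation reduces both sign patterns to `k < 0 ≤ m`. -/
theorem exists_norm_U_le (j : ℕ) : ∃ C : ℝ, 0 ≤ C ∧ ∀ m k : ℤ, m * k ≤ 0 → k ≠ 0 →
    ‖D.U m k‖ ≤ C / (|(m : ℝ)| + |(k : ℝ)|) ^ j := by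
  obtain ⟨C, hC, h⟩ := D.exists_norm_U_le_of_nat j
  refine ⟨C, hC, ?_⟩
  have key : ∀ m k : ℤ, 0 ≤ m → k < 0 → ‖D.U m k‖ ≤ C / (|(m : ℝ)| + |(k : ℝ)|) ^ j := by
    intro m k hm hk
    lift m to ℕ using hm
    obtain ⟨l, rfl⟩ : ∃ l : ℕ, k = -(l : ℤ) := ⟨k.natAbs, by omega⟩
    have := h m l (by omega)
    simpa using this
  intro m k hmk hk
  have key2 : ‖D.U m k‖ = ‖D.U (-m) (-k)‖ := by rw [U_neg, neg_neg, RCLike.norm_conj]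
  rcases lt_or_gt_of_ne hk with hk' | hk'
  · exact key m k (by nlinarith) hk'
  · rw [key2]
    have := key (-m) (-k) (by nlinarith) (by omega)
    simpa using this

end CircleDensity
end

/-! ### The matrix in arc-length coordinates: smoothing part and diagonal -/

noncomputable section

open ComplexConjugate

/-- The weight `1 + |n|`. -/
def wt (n : ℤ) : ℝ := 1 + |(n : ℝ)|

theorem one_le_wt (n : ℤ) : 1 ≤ wt n := le_add_of_nonneg_right (abs_nonneg _)

theorem wt_pos (n : ℤ) : 0 < wt n := one_pos.trans_le (one_le_wt n)

/-- A Hermitian matrix all of whose entries decay rapidly. -/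
structure IsSmoothing (K : ℤ → ℤ → ℂ) : Prop where
  herm : ∀ m n, K m n = conj (K n m)
  decay : ∀ p : ℕ, ∃ C, 0 ≤ C ∧ ∀ m n, ‖K m n‖ ≤ C / (wt m ^ p * wt n ^ p)

namespace CircleDensity

variable (D : CircleDensity)

/-- The matrix of the Dirichlet-to-Neumann operator in the coordinate `T`. -/
def P (n m : ℤ) : ℂ := ∑' k : ℤ, ((|(k : ℝ)| : ℝ) : ℂ) * D.U m k * conj (D.U n k)

/-- The smoothing part of `CircleDensity.P`. -/
def K (n m : ℤ) : ℂ := D.P n m - if n = m then ((|(m : ℝ)| : ℝ) : ℂ) else 0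

theorem summable_P (n m : ℤ) :
    Summable fun k : ℤ => ((|(k : ℝ)| : ℝ) : ℂ) * D.U m k * conj (D.U n k) := by
  refine Summable.of_norm_bounded (summable_circleCoeff (D.smooth_e_zpow m) 1) fun k => ?_
  rw [norm_mul, norm_mul, RCLike.norm_conj, pow_one, Complex.norm_real, Real.norm_of_nonneg
    (abs_nonneg _)]
  exact mul_le_of_le_one_right (by positivity) (D.norm_U_le n k)

theorem P_herm (m n : ℤ) : D.P m n = conj (D.P n m) := by
  rw [P, P, Complex.conj_tsum]
  congr 1; funext k
  simp only [map_mul, Complex.conj_conj, Complex.conj_ofReal]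
  ring

theorem summable_abs_inv_sq : Summable fun k : ℤ => 1 / (k : ℝ) ^ 2 :=
  Real.summable_one_div_int_pow.2 (by norm_num)

/-- With `ε` the sign of `m`, subtracting `ε` times `hasSum_mul_U_mul_conj` removes exactly the
diagonal `|m|` and turns the weight `|k|` into `|k| - ε k`. This vanishes unless `k` has the sign
opposite to `ε`, where `exists_norm_U_le` applies. Of the `q + 3` powers, `q` give the decay in `m`;
the other three absorb the factor `|k|` and make the sum over `k` converge. -/
theorem exists_norm_K_le_right (q : ℕ) :
    ∃ C, 0 ≤ C ∧ ∀ n m, ‖D.K n m‖ ≤ C / wt m ^ q := by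
  obtain ⟨C, hC, h⟩ := D.exists_norm_U_le (q + 3)
  refine ⟨2 * C * ∑' k : ℤ, 1 / (k : ℝ) ^ 2, mul_nonneg (by positivity)
    (tsum_nonneg fun k => by positivity), fun n m => ?_⟩
  obtain ⟨ε, hε, hεm⟩ : ∃ ε : ℤ, (ε = 1 ∨ ε = -1) ∧ |m| = ε * m := by
    rcases le_or_gt 0 m with hm | hm
    · exact ⟨1, Or.inl rfl, by rw [abs_of_nonneg hm, one_mul]⟩
    · exact ⟨-1, Or.inr rfl, by rw [abs_of_neg hm]; ring⟩
  have hsum : HasSum (fun k : ℤ => (((|(k : ℝ)| - ε * k : ℝ)) : ℂ) * D.U m k * conj (D.U n k))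
      (D.K n m) := by
    have h1 := (D.summable_P n m).hasSum.sub ((D.hasSum_mul_U_mul_conj m n).mul_left (ε : ℂ))
    convert! h1 using 1
    · funext k; push_cast; ring
    · rw [K, P]
      congr 1
      split_ifs
      · rw [← Int.cast_abs, hεm]; push_cast; ring
      · ring
  have hb : ∀ k : ℤ, ‖(((|(k : ℝ)| - ε * k : ℝ)) : ℂ) * D.U m k * conj (D.U n k)‖
      ≤ 2 * C / wt m ^ q * (1 / (k : ℝ) ^ 2) := by
    intro k
    have hnn : 0 ≤ 2 * C / wt m ^ q * (1 / (k : ℝ) ^ 2) := by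
      have := wt_pos m
      positivity
    rcases le_or_gt 0 (ε * k) with hk | hk
    · have : |(k : ℝ)| - ε * k = 0 := by
        rw [← Int.cast_abs, ← Int.cast_mul, ← Int.cast_sub]
        have : |k| - ε * k = 0 := by
          rcases hε with rfl | rfl
          · rw [abs_of_nonneg (by omega)]; ring
          · rw [abs_of_nonpos (by omega)]; ring
        exact_mod_cast this
      rw [this, Complex.ofReal_zero, zero_mul, zero_mul, norm_zero]
      exact hnn
    · have hk0 : k ≠ 0 := by rintro rfl; simp at hk
      have hmk : m * k ≤ 0 := by
        have h0 := abs_nonneg m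
        rcases hε with rfl | rfl <;> nlinarith
      have habs : |(k : ℝ)| - ε * k = 2 * |(k : ℝ)| := by
        have : (ε * k : ℝ) = -|(k : ℝ)| := by
          rw [← Int.cast_abs, ← Int.cast_mul, ← Int.cast_neg]
          have : ε * k = -|k| := by
            rcases hε with rfl | rfl
            · rw [abs_of_neg (by omega)]; ring
            · rw [abs_of_pos (by omega)]; ring
          exact_mod_cast this
        rw [this]; ring
      have hk1 : (1 : ℝ) ≤ |(k : ℝ)| := by
        rw [← Int.cast_abs]; exact_mod_cast Int.one_le_abs hk0
      have hwt := wt_pos m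
      rw [norm_mul, norm_mul, RCLike.norm_conj, habs, Complex.norm_real,
        Real.norm_of_nonneg (by positivity)]
      calc 2 * |(k : ℝ)| * ‖D.U m k‖ * ‖D.U n k‖
          ≤ 2 * |(k : ℝ)| * (C / (|(m : ℝ)| + |(k : ℝ)|) ^ (q + 3)) * 1 := by
            gcongr
            · exact h m k hmk hk0
            · exact D.norm_U_le n k
        _ ≤ 2 * |(k : ℝ)| * (C / (wt m ^ q * |(k : ℝ)| ^ 3)) * 1 := by
            have e1 : wt m ≤ |(m : ℝ)| + |(k : ℝ)| := by rw [wt]; linarith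
            have e2 : |(k : ℝ)| ≤ |(m : ℝ)| + |(k : ℝ)| := le_add_of_nonneg_left (abs_nonneg _)
            rw [pow_add _ q 3]
            gcongr
        _ = 2 * C / wt m ^ q * (1 / (k : ℝ) ^ 2) := by
            rw [← sq_abs (k : ℝ)]
            field_simp
  rw [← hsum.tsum_eq]
  have hs := (summable_abs_inv_sq).mul_left (2 * C / wt m ^ q)
  refine (tsum_of_norm_bounded hs.hasSum hb).trans (le_of_eq ?_)
  rw [tsum_mul_left]
  ring

theorem K_herm (m n : ℤ) : D.K m n = conj (D.K n m) := by
  rw [K, K, map_sub, ← P_herm]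
  rcases eq_or_ne m n with rfl | h
  · simp only [if_true, Complex.conj_ofReal]
  · rw [if_neg h, if_neg h.symm, map_zero]

/-- Hermitian symmetry gives the one-sided bound in either index; their geometric mean is the
product bound, whence the exponent `2 * p`. -/
theorem isSmoothing_K : IsSmoothing D.K where
  herm := D.K_herm
  decay p := by
    obtain ⟨C, hC, h⟩ := D.exists_norm_K_le_right (2 * p)
    refine ⟨C, hC, fun m n => ?_⟩
    have h1 := h m n
    have h2 : ‖D.K m n‖ ≤ C / wt m ^ (2 * p) := by
      rw [D.K_herm m n, RCLike.norm_conj]; exact h n m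
    have hm := wt_pos m
    have hn := wt_pos n
    refine le_of_sq_le_sq ?_ (by positivity)
    calc ‖D.K m n‖ ^ 2 = ‖D.K m n‖ * ‖D.K m n‖ := sq _
      _ ≤ (C / wt n ^ (2 * p)) * (C / wt m ^ (2 * p)) := by gcongr
      _ = _ := by rw [pow_mul', pow_mul']; field_simp

/-- The diagonal entries of `CircleDensity.P`. -/
def d (n : ℤ) : ℝ := (D.P n n).re

theorem hasSum_d (n : ℤ) : HasSum (fun k : ℤ => |(k : ℝ)| * ‖D.U n k‖ ^ 2) (D.d n) := by
  have h := Complex.hasSum_re (D.summable_P n n).hasSum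
  convert! h using 1
  funext k
  rw [mul_assoc, Complex.mul_conj, ← Complex.ofReal_mul, Complex.ofReal_re,
    Complex.normSq_eq_norm_sq]

theorem hasSum_int_mul_norm_U (n : ℤ) : HasSum (fun k : ℤ => (k : ℝ) * ‖D.U n k‖ ^ 2) n := by
  have h := Complex.hasSum_re (D.hasSum_mul_U_mul_conj n n)
  simp only [if_true, Complex.intCast_re] at h
  convert! h using 1
  funext k
  rw [mul_assoc, Complex.mul_conj, ← Complex.ofReal_intCast, ← Complex.ofReal_mul,
    Complex.ofReal_re, Complex.normSq_eq_norm_sq]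

theorem hasSum_d_sub (n : ℤ) :
    HasSum (fun k : ℤ => (|(k : ℝ)| - k) * ‖D.U n k‖ ^ 2) (D.d n - n) := by
  simpa only [sub_mul] using (D.hasSum_d n).sub (D.hasSum_int_mul_norm_U n)

theorem d_sub_nonneg (n : ℤ) : (n : ℝ) ≤ D.d n := by
  have := (D.hasSum_d_sub n).nonneg fun k : ℤ => mul_nonneg (sub_nonneg.2 (le_abs_self (k : ℝ)))
    (sq_nonneg ‖D.U n k‖)
  linarith

theorem d_neg (n : ℤ) : D.d (-n) = D.d n := by
  refine (D.hasSum_d (-n)).unique ?_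
  have := (Equiv.neg ℤ).hasSum_iff.2 (D.hasSum_d n)
  convert! this using 1
  funext k
  simp [U_neg]

theorem abs_le_d (n : ℤ) : |(n : ℝ)| ≤ D.d n := by
  refine abs_le'.2 ⟨D.d_sub_nonneg n, ?_⟩
  have := D.d_sub_nonneg (-n)
  rw [d_neg] at this
  exact_mod_cast this

/-- `d n - n` is the sum of `(|k| - k) |U n k|²`, whose terms are nonnegative and carry a nonzero
weight exactly for `k < 0`. -/
theorem d_eq_iff (n : ℤ) : D.d n = n ↔ ∀ k < 0, D.U n k = 0 := by
  have hs := D.hasSum_d_sub n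
  have hnn : ∀ k : ℤ, 0 ≤ (|(k : ℝ)| - k) * ‖D.U n k‖ ^ 2 := fun k =>
    mul_nonneg (sub_nonneg.2 (le_abs_self (k : ℝ))) (sq_nonneg _)
  constructor
  · intro h k hk
    rw [h, sub_self, hasSum_zero_iff_of_nonneg hnn] at hs
    have h1 := congrFun hs k
    have hk' : (k : ℝ) < 0 := by exact_mod_cast hk
    have h2 : |(k : ℝ)| - k ≠ 0 := by rw [abs_of_neg hk']; linarith
    simpa [h2] using h1
  · intro h
    have : (fun k : ℤ => (|(k : ℝ)| - k) * ‖D.U n k‖ ^ 2) = fun _ => 0 := by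
      funext k
      rcases lt_or_ge k 0 with hk | hk
      · simp [h k hk]
      · rw [abs_of_nonneg (by exact_mod_cast hk), sub_self, zero_mul]
    rw [this] at hs
    linarith [hs.unique hasSum_zero]

theorem U_zero (k : ℤ) : D.U 0 k = if k = 0 then 1 else 0 := by
  simp only [U, zpow_zero, circleCoeff_eq_circleMean, one_mul, circleMean_zpow, neg_eq_zero]

end CircleDensity
end

/-! ### Compact resolvent and eigenbasis of `|n| + K` on square summable sequences -/

noncomputable section

open ComplexConjugate

/-- The Hilbert space of square summable sequences on `ℤ`. -/
abbrev EllTwo := lp (fun _ : ℤ => ℂ) 2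

/-- An injective compact symmetric operator on a Hilbert space has an orthonormal basis of
eigenvectors. -/
theorem exists_hilbertBasis_eigenvectors {H : Type} [NormedAddCommGroup H] [InnerProductSpace ℂ H]
    [CompleteSpace H] (R : H →L[ℂ] H) (hRc : IsCompactOperator R)
    (hRs : ∀ x y, inner ℂ (R x) y = inner ℂ x (R y)) (hinj : ∀ x, R x = 0 → x = 0) :
    ∃ (ι : Type) (b : HilbertBasis ι ℂ H) (r : ι → ℝ), ∀ i, R (b i) = (r i : ℂ) • b i := by
  have hS : (R : H →ₗ[ℂ] H).IsSymmetric := hRs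
  have hfin : ∀ μ, FiniteDimensional ℂ (Module.End.eigenspace (R : Module.End ℂ H) μ) := by
    intro μ
    -- Compactness makes only the eigenspaces of nonzero `μ` finite dimensional; injectivity
    -- disposes of the kernel.
    rcases eq_or_ne μ 0 with rfl | hμ
    · have : Module.End.eigenspace (R : Module.End ℂ H) 0 = ⊥ := by
        rw [eq_bot_iff]
        intro x hx
        rw [Module.End.mem_eigenspace_iff, zero_smul] at hx
        exact hinj x hx
      rw [this]; infer_instance
    · exact ContinuousLinearMap.finite_dimensional_eigenspace hRc μ hμ
  let bb : ∀ μ, OrthonormalBasis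
      (Fin (Module.finrank ℂ (Module.End.eigenspace (R : Module.End ℂ H) μ))) ℂ
      (Module.End.eigenspace (R : Module.End ℂ H) μ) := fun μ => stdOrthonormalBasis ℂ _
  have hv : Orthonormal ℂ fun i : Σ μ : ℂ,
      Fin (Module.finrank ℂ (Module.End.eigenspace (R : Module.End ℂ H) μ)) =>
        (bb i.1 i.2 : H) :=
    hS.orthogonalFamily_eigenspaces.orthonormal_sigma_orthonormal fun μ => (bb μ).orthonormal
  have hsp : (Submodule.span ℂ (Set.range fun i : Σ μ : ℂ,
      Fin (Module.finrank ℂ (Module.End.eigenspace (R : Module.End ℂ H) μ)) =>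
        (bb i.1 i.2 : H)))ᗮ = ⊥ := by
    have key := ContinuousLinearMap.orthogonalComplement_iSup_eigenspaces_eq_bot hRc hS
    rw [eq_bot_iff, ← key]
    refine Submodule.orthogonal_le (iSup_le fun μ x hx => ?_)
    have hx' := (bb μ).sum_repr ⟨x, hx⟩
    have := congrArg (Subtype.val) hx'
    simp only [Submodule.coe_sum, Submodule.coe_smul] at this
    rw [← this]
    exact Submodule.sum_mem _ fun i _ => Submodule.smul_mem _ _
      (Submodule.subset_span ⟨⟨μ, i⟩, rfl⟩)
  have hvi : ∀ i : Σ μ : ℂ,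
      Fin (Module.finrank ℂ (Module.End.eigenspace (R : Module.End ℂ H) μ)),
      R (bb i.1 i.2 : H) = i.1 • (bb i.1 i.2 : H) := fun i =>
    Module.End.mem_eigenspace_iff.1 (bb i.1 i.2).2
  have hreal : ∀ i : Σ μ : ℂ,
      Fin (Module.finrank ℂ (Module.End.eigenspace (R : Module.End ℂ H) μ)),
      ∃ r : ℝ, i.1 = r := by
    intro i
    have := hS.conj_eigenvalue_eq_self (μ := i.1)
      (Module.End.hasEigenvalue_of_hasEigenvector ⟨(bb i.1 i.2).2, hv.ne_zero i⟩)
    exact Complex.conj_eq_iff_real.1 this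
  choose r hr using hreal
  refine ⟨_, HilbertBasis.mkOfOrthogonalEqBot hv hsp, r, fun i => ?_⟩
  rw [HilbertBasis.coe_mkOfOrthogonalEqBot, hvi, ← hr]

namespace EllTwo

theorem two_ne_zero' : (2 : ENNReal) ≠ 0 := by norm_num

theorem toReal_two : (2 : ENNReal).toReal = 2 := by norm_num

theorem norm_apply_le (x : EllTwo) (n : ℤ) : ‖x n‖ ≤ ‖x‖ := lp.norm_apply_le_norm two_ne_zero' x n

theorem norm_le_mul {x y : EllTwo} {B : ℝ} (hB : 0 ≤ B) (h : ∀ n, ‖x n‖ ≤ B * ‖y n‖) :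
    ‖x‖ ≤ B * ‖y‖ := by
  have h1 : ∀ n, ‖x n‖ ≤ ‖((B : ℂ) • y) n‖ := by
    intro n
    rw [lp.coeFn_smul, Pi.smul_apply, norm_smul, Complex.norm_real, Real.norm_of_nonneg hB]
    exact h n
  refine (lp.norm_mono two_ne_zero' h1).trans ?_
  rw [norm_smul, Complex.norm_real, Real.norm_of_nonneg hB]

theorem hasSum_norm_sq (x : EllTwo) : HasSum (fun n => ‖x n‖ ^ 2) (‖x‖ ^ 2) := by
  have := lp.hasSum_norm (p := 2) (by norm_num) x
  simpa using this

theorem summable_wt_inv : Summable fun n : ℤ => 1 / wt n ^ 2 := by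
  have h0 := CircleDensity.summable_abs_inv_sq
  refine Summable.of_norm_bounded_eventually h0 ?_
  rw [Filter.eventually_cofinite]
  refine (Set.finite_singleton (0 : ℤ)).subset fun n hn => ?_
  by_contra h
  apply hn
  have h1 : (0 : ℝ) < |(n : ℝ)| := by
    have : (n : ℝ) ≠ 0 := by exact_mod_cast h
    positivity
  have h2 := wt_pos n
  rw [Real.norm_of_nonneg (by positivity), ← sq_abs (n : ℝ)]
  gcongr
  rw [wt]; linarith

/-- The sum of the inverse squares of the weights. -/
def wtSum : ℝ := ∑' n : ℤ, 1 / wt n ^ 2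

theorem wtSum_nonneg : 0 ≤ wtSum := tsum_nonneg fun n => by have := wt_pos n; positivity

theorem memℓp_of_le {f : ℤ → ℂ} {C : ℝ} (h : ∀ n, ‖f n‖ ≤ C / wt n) : Memℓp f 2 := by
  refine memℓp_gen ?_
  simp only [toReal_two, Real.rpow_ofNat]
  refine Summable.of_nonneg_of_le (fun n => by positivity) (fun n => ?_)
    (summable_wt_inv.mul_left (C ^ 2))
  calc ‖f n‖ ^ 2 ≤ (C / wt n) ^ 2 := by gcongr; exact h n
    _ = _ := by ring

theorem norm_sq_le {x : EllTwo} {C : ℝ} (h : ∀ n, ‖x n‖ ≤ C / wt n) :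
    ‖x‖ ^ 2 ≤ C ^ 2 * wtSum := by
  refine hasSum_le (fun n => ?_) (hasSum_norm_sq x) (summable_wt_inv.hasSum.mul_left (C ^ 2))
  calc ‖x n‖ ^ 2 ≤ (C / wt n) ^ 2 := by gcongr; exact h n
    _ = _ := by ring

theorem inner_hasSum (x y : EllTwo) : HasSum (fun n => conj (x n) * y n) (inner ℂ x y) := by
  have := lp.hasSum_inner (𝕜 := ℂ) x y
  convert! this using 1
  funext n
  simp [mul_comm]

/-- The diagonal operator with bounded real entries `g n`. -/
def diag (g : ℤ → ℝ) (B : ℝ) (hg : ∀ n, |g n| ≤ B) : EllTwo →L[ℂ] EllTwo :=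
  LinearMap.mkContinuous
    { toFun := fun x => ⟨fun n => (g n : ℂ) * x n, by
        refine Memℓp.mono (g := fun n => ‖(((B : ℂ) • x : EllTwo) n)‖)
          (lp.memℓp ((B : ℂ) • x)).norm fun n => ?_
        rw [lp.coeFn_smul, Pi.smul_apply, norm_smul, norm_mul, Complex.norm_real, Complex.norm_real]
        exact mul_le_mul_of_nonneg_right ((hg n).trans (le_abs_self B)) (norm_nonneg _)⟩
      map_add' := fun x y => by ext n; exact mul_add _ _ _
      map_smul' := fun c x => by ext n; exact mul_left_comm _ _ _ }
    B fun x => norm_le_mul ((abs_nonneg _).trans (hg 0)) fun n => by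
      change ‖(g n : ℂ) * x n‖ ≤ _
      rw [norm_mul, Complex.norm_real]
      exact mul_le_mul_of_nonneg_right (hg n) (norm_nonneg _)

theorem diag_apply (g : ℤ → ℝ) (B : ℝ) (hg : ∀ n, |g n| ≤ B) (x : EllTwo) (n : ℤ) :
    diag g B hg x n = g n * x n := rfl

theorem norm_diag_le (g : ℤ → ℝ) (B : ℝ) (hg : ∀ n, |g n| ≤ B) : ‖diag g B hg‖ ≤ B :=
  LinearMap.mkContinuous_norm_le _ ((abs_nonneg _).trans (hg 0)) _

theorem diag_symm (g : ℤ → ℝ) (B : ℝ) (hg : ∀ n, |g n| ≤ B) (x y : EllTwo) :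
    inner ℂ (diag g B hg x) y = inner ℂ x (diag g B hg y) := by
  refine (inner_hasSum _ _).unique ?_
  convert! inner_hasSum x (diag g B hg y) using 1
  funext n
  simp only [diag_apply, map_mul, Complex.conj_ofReal]
  ring

/-- Since `g` tends to zero, the operator is the norm limit of its truncations to finite sets of
indices, which have finite rank. -/
theorem isCompactOperator_diag (g : ℤ → ℝ) (B : ℝ) (hg : ∀ n, |g n| ≤ B)
    (h0 : Filter.Tendsto g Filter.cofinite (nhds 0)) : IsCompactOperator (diag g B hg) := by
  let F : Finset ℤ → EllTwo →L[ℂ] EllTwo := fun s => ∑ n ∈ s,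
    (lp.singleContinuousLinearMap ℂ (fun _ : ℤ => ℂ) 2 n).comp
      ((g n : ℂ) • lp.evalCLM ℂ (fun _ : ℤ => ℂ) 2 n)
  have hF : ∀ s x n, F s x n = if n ∈ s then g n * x n else 0 := by
    intro s x n
    simp only [F, sum_apply, lp.coeFn_sum, Finset.sum_apply]
    have : ∀ m, ((lp.singleContinuousLinearMap ℂ (fun _ : ℤ => ℂ) 2 m).comp
      ((g m : ℂ) • lp.evalCLM ℂ (fun _ : ℤ => ℂ) 2 m)) x n = if n = m then g m * x m else 0 := by
      intro m
      change (lp.single (E := fun _ : ℤ => ℂ) 2 m ((g m : ℂ) * x m) : ℤ → ℂ) n = _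
      rw [lp.single_apply, Pi.single_apply]
    simp only [this, Finset.sum_ite_eq]
  refine isCompactOperator_of_tendsto (F := F) (l := Filter.atTop) ?_
    (Filter.Eventually.of_forall fun s => ?_)
  · rw [Metric.tendsto_nhds]
    intro ε hε
    have hfin := (Metric.tendsto_nhds.1 h0) (ε / 2) (by positivity)
    rw [Filter.eventually_cofinite] at hfin
    filter_upwards [Filter.eventually_ge_atTop hfin.toFinset] with s hs
    rw [dist_eq_norm]
    refine lt_of_le_of_lt (ContinuousLinearMap.opNorm_le_bound _ (half_pos hε).le fun x => ?_)
      (half_lt_self hε)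
    refine norm_le_mul (half_pos hε).le fun n => ?_
    have : (F s - diag g B hg) x n = F s x n - g n * x n := rfl
    rw [this, hF]
    split_ifs with hn
    · rw [sub_self, norm_zero]; positivity
    · have : ¬ ¬ dist (g n) 0 < ε / 2 := fun h => hn (hs (hfin.mem_toFinset.2 h))
      rw [not_not, Real.dist_eq, sub_zero] at this
      rw [zero_sub, norm_neg, norm_mul, Complex.norm_real]
      exact mul_le_mul_of_nonneg_right this.le (norm_nonneg _)
  · refine Finset.induction_on s ?_ ?_
    · simpa [F] using isCompactOperator_zero
    · intro n s hn ih
      have : F (insert n s) = (lp.singleContinuousLinearMap ℂ (fun _ : ℤ => ℂ) 2 n).comp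
          ((g n : ℂ) • lp.evalCLM ℂ (fun _ : ℤ => ℂ) 2 n) + F s := Finset.sum_insert hn
      rw [this]
      have h1 : IsCompactOperator ((lp.singleContinuousLinearMap ℂ (fun _ : ℤ => ℂ) 2 n).comp
          ((g n : ℂ) • lp.evalCLM ℂ (fun _ : ℤ => ℂ) 2 n)) :=
        (isCompactOperator_of_locallyCompactSpace_rng
          (lp.singleContinuousLinearMap ℂ (fun _ : ℤ => ℂ) 2 n)).comp_clm
          ((g n : ℂ) • lp.evalCLM ℂ (fun _ : ℤ => ℂ) 2 n)
      exact IsCompactOperator.add h1 ih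

end EllTwo

namespace IsSmoothing

open EllTwo

variable {K : ℤ → ℤ → ℂ}

theorem summable_mul (hK : IsSmoothing K) {v : ℤ → ℂ} {A : ℝ} (hv : ∀ n, ‖v n‖ ≤ A) (n : ℤ) :
    Summable fun m => K n m * v m := by
  obtain ⟨C, hC, h⟩ := hK.decay 2
  refine Summable.of_norm_bounded (summable_wt_inv.mul_left (C * A)) fun m => ?_
  have hA : 0 ≤ A := (norm_nonneg _).trans (hv 0)
  have hn := one_le_wt n
  have hm := wt_pos m
  rw [norm_mul]
  calc ‖K n m‖ * ‖v m‖ ≤ C / (wt n ^ 2 * wt m ^ 2) * A := by gcongr; exacts [h n m, hv m]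
    _ ≤ C / (1 * wt m ^ 2) * A := by gcongr; exact one_le_pow₀ hn
    _ = _ := by ring

theorem exists_norm_tsum_le (hK : IsSmoothing K) (p : ℕ) : ∃ C, 0 ≤ C ∧ ∀ (v : ℤ → ℂ) (A : ℝ), (∀ n, ‖v n‖ ≤ A) →
    ∀ n, ‖∑' m, K n m * v m‖ ≤ C * A / wt n ^ p := by
  obtain ⟨C, hC, h⟩ := hK.decay (p + 2)
  refine ⟨C * wtSum, mul_nonneg hC wtSum_nonneg, fun v A hv n => ?_⟩
  have hA : 0 ≤ A := (norm_nonneg _).trans (hv 0)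
  have hn := one_le_wt n
  have hn0 := wt_pos n
  have : ∀ m, ‖K n m * v m‖ ≤ C * A / wt n ^ p * (1 / wt m ^ 2) := by
    intro m
    have hm := one_le_wt m
    have hm0 := wt_pos m
    rw [norm_mul]
    calc ‖K n m‖ * ‖v m‖ ≤ C / (wt n ^ (p + 2) * wt m ^ (p + 2)) * A := by
          gcongr; exacts [h n m, hv m]
      _ ≤ C / (wt n ^ p * wt m ^ 2) * A := by
          gcongr <;> first | assumption | omega
      _ = _ := by field_simp
  refine (tsum_of_norm_bounded (summable_wt_inv.hasSum.mul_left _) this).trans (le_of_eq ?_)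
  rw [← wtSum]; ring

/-- The bounded operator on `EllTwo` defined by a smoothing matrix. -/
def op (hK : IsSmoothing K) : EllTwo →L[ℂ] EllTwo :=
  LinearMap.mkContinuousOfExistsBound
    { toFun := fun x => ⟨fun n => ∑' m, K n m * x m, by
        obtain ⟨C, hC, h⟩ := hK.exists_norm_tsum_le 1
        simp only [pow_one] at h
        exact memℓp_of_le (h x ‖x‖ (norm_apply_le x))⟩
      map_add' := fun x y => by
        ext n
        change ∑' m, K n m * (x m + y m) = (∑' m, K n m * x m) + ∑' m, K n m * y m
        rw [← (hK.summable_mul (norm_apply_le x) n).tsum_add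
          (hK.summable_mul (norm_apply_le y) n)]
        simp only [mul_add]
      map_smul' := fun c x => by
        ext n
        change ∑' m, K n m * (c * x m) = c * ∑' m, K n m * x m
        rw [← tsum_mul_left]
        simp only [mul_left_comm] }
    (by
      obtain ⟨C, hC, h⟩ := hK.exists_norm_tsum_le 1
      simp only [pow_one] at h
      refine ⟨C * Real.sqrt wtSum, fun x => ?_⟩
      refine le_of_sq_le_sq ?_ (by positivity)
      refine (norm_sq_le (C := C * ‖x‖) fun n => h x ‖x‖ (norm_apply_le x) n).trans (le_of_eq ?_)
      rw [mul_pow, mul_pow, mul_pow, Real.sq_sqrt wtSum_nonneg]; ring)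

theorem op_apply (hK : IsSmoothing K) (x : EllTwo) (n : ℤ) : hK.op x n = ∑' m, K n m * x m := rfl

theorem op_symm (hK : IsSmoothing K) (x y : EllTwo) : inner ℂ (hK.op x) y = inner ℂ x (hK.op y) := by
  rw [← (inner_hasSum (hK.op x) y).tsum_eq, ← (inner_hasSum x (hK.op y)).tsum_eq]
  have e1 : ∀ n, conj (hK.op x n) * y n = ∑' m, conj (x m) * (K m n * y n) := by
    intro n
    rw [op_apply, Complex.conj_tsum, ← tsum_mul_right]
    congr 1; funext m
    rw [map_mul, ← hK.herm]; ring
  have e2 : ∀ m, conj (x m) * hK.op y m = ∑' n, conj (x m) * (K m n * y n) := by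
    intro m
    rw [op_apply, ← tsum_mul_left]
  simp only [e1, e2]
  refine Summable.tsum_comm ?_
  obtain ⟨C, hC, h⟩ := hK.decay 2
  have hs := (summable_wt_inv.mul_of_nonneg summable_wt_inv (fun n => by
    have := wt_pos n; positivity) (fun n => by have := wt_pos n; positivity)).mul_left
    (‖x‖ * (C * ‖y‖))
  refine Summable.of_norm_bounded hs fun q => ?_
  simp only [Function.uncurry]
  rw [norm_mul, norm_mul, RCLike.norm_conj]
  have h1 := wt_pos q.1
  have h2 := wt_pos q.2
  calc _ ≤ ‖x‖ * (C / (wt q.1 ^ 2 * wt q.2 ^ 2) * ‖y‖) := by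
        gcongr
        exacts [norm_apply_le x _, h _ _, norm_apply_le y _]
    _ = _ := by field_simp

/-- With `G = (|n| + c)^(-1/2)`, formally `|n| + c + K = G⁻¹ (1 + G K G) G⁻¹`. The choice `c = 2 ‖K‖
+ 1` makes `‖G K G‖ ≤ ‖K‖ / c < 1`, so the middle factor has a bounded inverse `M` and `R = G M G`.
Splitting the square root evenly keeps `R` symmetric, and `R` inherits compactness from `G`. -/
theorem exists_resolvent (hK : IsSmoothing K) : ∃ (R : EllTwo →L[ℂ] EllTwo) (c : ℝ), IsCompactOperator R ∧
    (∀ x y, inner ℂ (R x) y = inner ℂ x (R y)) ∧ ∀ (x : EllTwo) (n : ℤ),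
      (|(n : ℝ)| + c : ℝ) * R x n + hK.op (R x) n = x n := by
  set c : ℝ := 2 * ‖hK.op‖ + 1 with hc
  have hc1 : 1 ≤ c := by rw [hc]; linarith [norm_nonneg hK.op]
  have hpos : ∀ n : ℤ, 0 < |(n : ℝ)| + c := fun n => by positivity
  set g : ℤ → ℝ := fun n => 1 / Real.sqrt (|(n : ℝ)| + c) with hg
  have hgpos : ∀ n, 0 < g n := fun n => by have := hpos n; positivity
  have hgsq : ∀ n, g n * g n * (|(n : ℝ)| + c) = 1 := by
    intro n
    have h1 := Real.sq_sqrt (hpos n).le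
    have h2 := Real.sqrt_pos.2 (hpos n)
    simp only [hg]
    field_simp
    rw [h1]
  have hgB : ∀ n, |g n| ≤ 1 / Real.sqrt c := by
    intro n
    rw [abs_of_pos (hgpos n)]
    have : 0 < Real.sqrt c := Real.sqrt_pos.2 (by linarith)
    simp only [hg]
    gcongr
    exact le_add_of_nonneg_left (abs_nonneg _)
  have hg0 : Filter.Tendsto g Filter.cofinite (nhds 0) := by
    have h1 : Filter.Tendsto (fun n : ℤ => |(n : ℝ)| + c) Filter.cofinite Filter.atTop := by
      refine Filter.tendsto_atTop_add_const_right _ _ ?_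
      have := Int.tendsto_coe_cofinite
      exact (tendsto_norm_cocompact_atTop (E := ℝ)).comp this
    have h2 := (Real.tendsto_sqrt_atTop.comp h1).inv_tendsto_atTop
    convert! h2 using 1
    funext n; simp [hg]
  set G := diag g _ hgB with hG
  have hGn : ‖G‖ ≤ 1 / Real.sqrt c := norm_diag_le _ _ _
  have hNu : ‖-(G * hK.op * G)‖ < 1 := by
    rw [norm_neg]
    calc ‖G * hK.op * G‖ ≤ ‖G‖ * ‖hK.op‖ * ‖G‖ :=
          (norm_mul_le _ _).trans (mul_le_mul_of_nonneg_right (norm_mul_le _ _) (norm_nonneg _))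
      _ ≤ 1 / Real.sqrt c * ‖hK.op‖ * (1 / Real.sqrt c) := by gcongr
      _ = ‖hK.op‖ / c := by
          have := Real.sq_sqrt (show 0 ≤ c by linarith)
          have h2 := Real.sqrt_pos.2 (show 0 < c by linarith)
          field_simp
          rw [this, mul_comm]
      _ < 1 := by rw [div_lt_one (by linarith)]; linarith [norm_nonneg hK.op]
  obtain ⟨u, hu⟩ := isUnit_one_sub_of_norm_lt_one hNu
  rw [sub_neg_eq_add] at hu
  set M : EllTwo →L[ℂ] EllTwo := ((u⁻¹ : (EllTwo →L[ℂ] EllTwo)ˣ) : EllTwo →L[ℂ] EllTwo) with hM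
  have hNM : ∀ x, M x + G (hK.op (G (M x))) = x := by
    intro x
    have h1 : (1 + G * hK.op * G) * M = 1 := by rw [← hu]; exact u.mul_inv
    have := congrArg (fun A : EllTwo →L[ℂ] EllTwo => A x) h1
    simpa [add_mul] using this
  have hMsymm : ∀ x y, inner ℂ (M x) y = inner ℂ x (M y) := by
    intro x y
    conv_lhs => rw [← hNM y]
    conv_rhs => rw [← hNM x]
    rw [inner_add_left, inner_add_right]
    congr 1
    rw [hG, diag_symm, op_symm, diag_symm]
  refine ⟨G * M * G, c, ?_, ?_, ?_⟩
  · exact (isCompactOperator_diag g _ hgB hg0).comp_clm (M * G)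
  · intro x y
    change inner ℂ (G (M (G x))) y = inner ℂ x (G (M (G y)))
    rw [hG, diag_symm, hMsymm, diag_symm]
  · intro x n
    change ((|(n : ℝ)| + c : ℝ) : ℂ) * G (M (G x)) n + hK.op (G (M (G x))) n = x n
    have h1 := congrArg (fun w : EllTwo => w n) (hNM (G x))
    have h2 : M (G x) n + g n * hK.op (G (M (G x))) n = g n * x n := h1
    have h3 : G (M (G x)) n = g n * M (G x) n := rfl
    have h4 : (g n : ℂ) ≠ 0 := by exact_mod_cast (hgpos n).ne'
    have h5 : (g n : ℂ) * g n * ((|(n : ℝ)| + c : ℝ) : ℂ) = 1 := by exact_mod_cast hgsq n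
    apply mul_left_cancel₀ h4
    rw [h3]
    linear_combination h2 + M (G x) n * h5

/-- An eigenvector of the resolvent with eigenvalue `r` is one of `|n| + K` with eigenvalue `1 / r -
c`; the resolvent identity shows that the resolvent is injective, so `r ≠ 0`. -/
theorem exists_eigenbasis (hK : IsSmoothing K) :
    ∃ (ι : Type) (b : HilbertBasis ι ℂ EllTwo) (l : ι → ℝ),
      ∀ (i : ι) (n : ℤ), (|(n : ℝ)| : ℝ) * b i n + hK.op (b i) n = l i * b i n := by
  obtain ⟨R, c, hRc, hRs, hR⟩ := hK.exists_resolvent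
  have hinj : ∀ x, R x = 0 → x = 0 := by
    intro x hx
    ext n
    rw [← hR x n, hx]
    simp
  obtain ⟨ι, b, r, hb⟩ := exists_hilbertBasis_eigenvectors R hRc hRs hinj
  have hri : ∀ i, (r i : ℂ) ≠ 0 := by
    intro i h
    apply b.orthonormal.ne_zero i
    apply hinj
    rw [hb, h, zero_smul]
  refine ⟨ι, b, fun i => (r i)⁻¹ - c, fun i n => ?_⟩
  have h1 := hR (b i) n
  have h2 : (R (b i) : ℤ → ℂ) n = r i * b i n := by rw [hb i]; rfl
  have h3 : (hK.op (R (b i)) : ℤ → ℂ) n = r i * hK.op (b i) n := by rw [hb i, map_smul]; rfl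
  have hr := hri i
  rw [h2, h3] at h1
  push_cast at h1 ⊢
  apply mul_left_cancel₀ hr
  field_simp
  linear_combination h1

end IsSmoothing
end

/-! ### Counting eigenvalues by quadratic forms -/

noncomputable section

open ComplexConjugate

/-- An infinite type with a real function whose sublevel sets are finite can be enumerated so that
the function becomes monotone. -/
theorem exists_equiv_nat_monotone {ι : Type} [Infinite ι] (l : ι → ℝ)
    (hfin : ∀ c, {i | l i ≤ c}.Finite) : ∃ e : ℕ ≃ ι, Monotone (l ∘ e) := by
  classical
  have hcount : Countable ι := by
    have : (Set.univ : Set ι) = ⋃ n : ℕ, {i | l i ≤ n} := by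
      ext i; simpa using exists_nat_ge (l i)
    rw [← Set.countable_univ_iff, this]
    exact Set.countable_iUnion fun n => (hfin n).countable
  obtain ⟨enc, henc⟩ := hcount.exists_injective_nat
  -- Ties of `l` are broken by an arbitrary enumeration. The resulting linear order has finite
  -- initial segments and no maximum, hence is isomorphic to `ℕ`.
  let f : ι → ℝ ×ₗ ℕ := fun i => toLex (l i, enc i)
  have hf : Function.Injective f := fun i j h => henc (congrArg (fun x => (ofLex x).2) h)
  let _ : LinearOrder ι := LinearOrder.lift' f hf
  have hle : ∀ i j : ι, i ≤ j → l i ≤ l j := by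
    intro i j h
    have h' : f i ≤ f j := h
    rw [Prod.Lex.le_iff] at h'
    rcases h' with h' | h'
    · exact h'.le
    · exact h'.1.le
  have hIic : ∀ i : ι, (Set.Iic i).Finite := fun i => (hfin (l i)).subset fun j hj => hle j i hj
  let _ : LocallyFiniteOrder ι := LocallyFiniteOrder.ofFiniteIcc fun a b =>
    (hIic b).subset fun x hx => hx.2
  have _ : NoMaxOrder ι := ⟨fun i => by
    by_contra! h
    have : (Set.univ : Set ι) ⊆ Set.Iic i := fun j _ => h j
    exact Set.infinite_univ ((hIic i).subset this)⟩
  obtain ⟨i₀⟩ := (inferInstance : Nonempty ι)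
  obtain ⟨m, hm, hmin⟩ := Set.exists_min_image (Set.Iic i₀) id (hIic i₀) ⟨i₀, Set.mem_Iic.2 le_rfl⟩
  let _ : OrderBot ι :=
    { bot := m
      bot_le := fun j => (le_total j i₀).elim (fun h => hmin j h) fun h => hm.trans h }
  let _ : SuccOrder ι := LinearLocallyFiniteOrder.succOrder ι
  let _ : PredOrder ι := LinearLocallyFiniteOrder.predOrder ι
  let e : ι ≃o ℕ := orderIsoNatOfLinearSuccPredArch
  exact ⟨e.symm.toEquiv, fun a b h => hle _ _ (e.symm.monotone h)⟩

namespace IsSmoothing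

open EllTwo

variable {K : ℤ → ℤ → ℂ}

/-- `w` is the image of `v` under the unbounded operator `|n| + K`. -/
def IsImage (hK : IsSmoothing K) (v w : EllTwo) : Prop :=
  ∀ n : ℤ, w n = (|(n : ℝ)| : ℝ) * v n + hK.op v n

/-- `b` is an orthonormal basis of eigenvectors of `|n| + K` with the eigenvalues `l`. -/
def IsEigenbasis (hK : IsSmoothing K) {ι : Type} (b : HilbertBasis ι ℂ EllTwo) (l : ι → ℝ) :
    Prop := ∀ (i : ι) (n : ℤ), (|(n : ℝ)| : ℝ) * b i n + hK.op (b i) n = l i * b i n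

section Eigenbasis

variable {hK : IsSmoothing K} {ι : Type} {b : HilbertBasis ι ℂ EllTwo} {l : ι → ℝ}

/-- Symmetry of the unbounded operator. Once the bounded part `K` is subtracted on both sides, the
two series agree term by term, because the factor `|n|` may be put on either vector. -/
theorem IsEigenbasis.inner_image (hb : hK.IsEigenbasis b l) {v w : EllTwo} (h : hK.IsImage v w)
    (i : ι) : inner ℂ (b i) w = l i * inner ℂ (b i) v := by
  have h1 := (inner_hasSum (b i) w).sub (inner_hasSum (b i) (hK.op v))
  have h2 := (inner_hasSum ((l i : ℂ) • b i) v).sub (inner_hasSum (hK.op (b i)) v)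
  have h3 : (fun n => conj (b i n) * w n - conj (b i n) * hK.op v n)
      = fun n => conj (((l i : ℂ) • b i : EllTwo) n) * v n - conj (hK.op (b i) n) * v n := by
    funext n
    have e1 : ((l i : ℂ) • b i : EllTwo) n = (|(n : ℝ)| : ℝ) * b i n + hK.op (b i) n :=
      (hb i n).symm
    rw [h n, e1, map_add, map_mul, Complex.conj_ofReal]
    ring
  rw [h3] at h1
  have h4 := h1.unique h2
  rw [hK.op_symm, inner_smul_left, Complex.conj_ofReal] at h4
  linear_combination h4

theorem hasSum_norm_inner_sq (b : HilbertBasis ι ℂ EllTwo) (v : EllTwo) :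
    HasSum (fun i => ‖inner ℂ (b i) v‖ ^ 2) (‖v‖ ^ 2) := by
  have h := Complex.hasSum_re (b.hasSum_inner_mul_inner v v)
  rw [inner_self_eq_norm_sq_to_K] at h
  convert! h using 1
  · funext i
    rw [← inner_conj_symm, RCLike.norm_conj, Complex.mul_conj', ← Complex.ofReal_pow, Complex.ofReal_re]
  · exact_mod_cast (Complex.ofReal_re _).symm

theorem IsEigenbasis.hasSum_inner (hb : hK.IsEigenbasis b l) {v w : EllTwo}
    (h : hK.IsImage v w) :
    HasSum (fun i => l i * ‖inner ℂ (b i) v‖ ^ 2) (inner ℂ v w).re := by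
  have h1 := Complex.hasSum_re (b.hasSum_inner_mul_inner v w)
  convert! h1 using 1
  funext i
  rw [hb.inner_image h, ← inner_conj_symm, RCLike.norm_conj, mul_left_comm, Complex.mul_conj',
    ← Complex.ofReal_pow, ← Complex.ofReal_mul, Complex.ofReal_re]

theorem inner_image_re {v w : EllTwo} (h : hK.IsImage v w) :
    HasSum (fun n : ℤ => |(n : ℝ)| * ‖v n‖ ^ 2) ((inner ℂ v w).re - (inner ℂ v (hK.op v)).re) := by
  have h1 := Complex.hasSum_re ((inner_hasSum v w).sub (inner_hasSum v (hK.op v)))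
  rw [Complex.sub_re] at h1
  convert! h1 using 1
  funext n
  rw [h n, ← mul_sub, add_sub_cancel_right, mul_left_comm, Complex.conj_mul', ← Complex.ofReal_pow,
    ← Complex.ofReal_mul, Complex.ofReal_re]

/-- Dimension count: if `F` were larger than `M`, some nonzero combination of the `b i`, `i ∈ F`,
would vanish on `M`. Its form is less than `c ‖v‖²` because all eigenvalues involved are, against
the assumed lower bound. -/
theorem IsEigenbasis.card_le_of_lower_bound (hb : hK.IsEigenbasis b l) {c : ℝ} (M : Finset ℤ)
    (hM : ∀ v w, hK.IsImage v w → (∀ n ∈ M, v n = 0) → c * ‖v‖ ^ 2 ≤ (inner ℂ v w).re)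
    (F : Finset ι) (hF : ∀ i ∈ F, l i < c) : F.card ≤ M.card := by
  classical
  by_contra! hlt
  let φ : (F → ℂ) →ₗ[ℂ] (M → ℂ) :=
    { toFun := fun a n => ∑ i, a i * b i n
      map_add' := fun a a' => by ext n; simp [add_mul, Finset.sum_add_distrib]
      map_smul' := fun c a => by ext n; simp [Finset.mul_sum, mul_assoc] }
  obtain ⟨a, ha0, ha⟩ : ∃ a, a ≠ 0 ∧ φ a = 0 := by
    have : LinearMap.ker φ ≠ ⊥ := LinearMap.ker_ne_bot_of_finrank_lt (by simpa using hlt)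
    obtain ⟨a, ha, ha0⟩ := (Submodule.ne_bot_iff _).1 this
    exact ⟨a, ha0, ha⟩
  let v : EllTwo := ∑ i : F, a i • b i
  let w : EllTwo := ∑ i : F, (a i * l i) • b i
  have hvn : ∀ n, v n = ∑ i : F, a i * b i n := by
    intro n
    simp only [v, lp.coeFn_sum, Finset.sum_apply, lp.coeFn_smul, Pi.smul_apply, smul_eq_mul]
  have himg : hK.IsImage v w := by
    intro n
    have e1 : w n = ∑ i : F, a i * l i * b i n := by
      simp only [w, lp.coeFn_sum, Finset.sum_apply, lp.coeFn_smul, Pi.smul_apply, smul_eq_mul]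
    have e2 : hK.op v n = ∑ i : F, a i * hK.op (b i) n := by
      simp only [v, map_sum, map_smul, lp.coeFn_sum, Finset.sum_apply, lp.coeFn_smul,
        Pi.smul_apply, smul_eq_mul]
    rw [e1, e2, hvn, Finset.mul_sum, ← Finset.sum_add_distrib]
    refine Finset.sum_congr rfl fun i _ => ?_
    have := hb i n
    linear_combination (-a i) * this
  have hvM : ∀ n ∈ M, v n = 0 := by
    intro n hn
    rw [hvn]
    exact congrFun ha ⟨n, hn⟩
  have hinner : ∀ i : ι, inner ℂ (b i) v = if h : i ∈ F then a ⟨i, h⟩ else 0 := by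
    intro i
    simp only [v, inner_sum, inner_smul_right, orthonormal_iff_ite.1 b.orthonormal]
    split_ifs with h
    · rw [Finset.sum_eq_single (⟨i, h⟩ : F)]
      · simp
      · intro j _ hj
        have : i ≠ j := fun hij => hj (Subtype.ext hij.symm)
        simp [this]
      · simp
    · refine Finset.sum_eq_zero fun j _ => ?_
      have : i ≠ j := fun hij => h (hij ▸ j.2)
      simp [this]
  have h1 := hb.hasSum_inner himg
  have h2 := (hasSum_norm_inner_sq b v).mul_left c
  have h3 := hM v w himg hvM
  obtain ⟨i, hi⟩ := Function.ne_iff.1 ha0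
  have : (inner ℂ v w).re < c * ‖v‖ ^ 2 := by
    refine hasSum_lt (i := (i : ι)) (fun j => ?_) ?_ h1 h2
    · simp only [hinner]
      split_ifs with h
      · exact mul_le_mul_of_nonneg_right (hF j h).le (sq_nonneg _)
      · simp
    · simp only [hinner, dif_pos i.2]
      have : 0 < ‖a i‖ := norm_pos_iff.2 hi
      exact mul_lt_mul_of_pos_right (hF i i.2) (by positivity)
  linarith

/-- The dual count: if `M` were larger than `F`, some nonzero vector supported on `M` would be
orthogonal to all `b i`, `i ∈ F`, so that only eigenvalues above `c` enter its form. -/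
theorem IsEigenbasis.card_le_of_upper_bound (hb : hK.IsEigenbasis b l) {c : ℝ} (M : Finset ℤ)
    (hM : ∀ v w, hK.IsImage v w → (∀ n, n ∉ M → v n = 0) → (inner ℂ v w).re ≤ c * ‖v‖ ^ 2)
    (F : Finset ι) (hF : ∀ i, i ∉ F → c < l i) : M.card ≤ F.card := by
  classical
  by_contra! hlt
  let E : M → EllTwo := fun n => lp.single 2 (n : ℤ) 1
  let φ : (M → ℂ) →ₗ[ℂ] (F → ℂ) :=
    { toFun := fun a i => ∑ n, a n * inner ℂ (b i) (E n)
      map_add' := fun a a' => by ext n; simp [add_mul, Finset.sum_add_distrib]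
      map_smul' := fun c a => by ext n; simp [Finset.mul_sum, mul_assoc] }
  obtain ⟨a, ha0, ha⟩ : ∃ a, a ≠ 0 ∧ φ a = 0 := by
    have : LinearMap.ker φ ≠ ⊥ := LinearMap.ker_ne_bot_of_finrank_lt (by simpa using hlt)
    obtain ⟨a, ha, ha0⟩ := (Submodule.ne_bot_iff _).1 this
    exact ⟨a, ha0, ha⟩
  let v : EllTwo := ∑ n : M, a n • E n
  have hEn : ∀ (m : M) (n : ℤ), E m n = if n = m then 1 else 0 := by
    intro m n
    simp only [E, lp.single_apply, Pi.single_apply]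
  have hvn : ∀ n : ℤ, v n = if h : n ∈ M then a ⟨n, h⟩ else 0 := by
    intro n
    simp only [v, lp.coeFn_sum, Finset.sum_apply, lp.coeFn_smul, Pi.smul_apply, smul_eq_mul, hEn]
    split_ifs with h
    · rw [Finset.sum_eq_single (⟨n, h⟩ : M)]
      · simp
      · intro j _ hj
        have : n ≠ j := fun hij => hj (Subtype.ext hij.symm)
        simp [this]
      · simp
    · refine Finset.sum_eq_zero fun j _ => ?_
      have : n ≠ j := fun hij => h (hij ▸ j.2)
      simp [this]
  let w : EllTwo := (∑ n : M, ((|((n : ℤ) : ℝ)| : ℝ) * a n : ℂ) • E n) + hK.op v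
  have himg : hK.IsImage v w := by
    intro n
    have e1 : w n = (∑ m : M, ((|((m : ℤ) : ℝ)| : ℝ) * a m : ℂ) * E m n) + hK.op v n := by
      simp only [w, lp.coeFn_add, Pi.add_apply, lp.coeFn_sum, Finset.sum_apply, lp.coeFn_smul,
        Pi.smul_apply, smul_eq_mul]
    have e2 : v n = ∑ m : M, a m * E m n := by
      simp only [v, lp.coeFn_sum, Finset.sum_apply, lp.coeFn_smul, Pi.smul_apply, smul_eq_mul]
    rw [e1, e2, Finset.mul_sum]
    congr 1
    refine Finset.sum_congr rfl fun m _ => ?_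
    rw [hEn]
    split_ifs with h
    · rw [h]; ring
    · simp
  have hvM : ∀ n, n ∉ M → v n = 0 := fun n hn => by rw [hvn, dif_neg hn]
  have hv0 : v ≠ 0 := by
    intro h
    apply ha0
    funext n
    have := hvn n
    rw [h, dif_pos n.2] at this
    exact this.symm
  have hinner : ∀ i ∈ F, inner ℂ (b i) v = 0 := by
    intro i hi
    simp only [v, inner_sum, inner_smul_right]
    exact congrFun ha ⟨i, hi⟩
  have h1 := hb.hasSum_inner himg
  have h2 := (hasSum_norm_inner_sq b v).mul_left c
  have h3 := hM v w himg hvM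
  obtain ⟨i, hi⟩ : ∃ i, inner ℂ (b i) v ≠ 0 := by
    by_contra! h
    have := (hasSum_norm_inner_sq b v)
    simp only [h, norm_zero, ne_eq, OfNat.ofNat_ne_zero, not_false_eq_true, zero_pow] at this
    have := this.unique hasSum_zero
    exact hv0 (norm_eq_zero.1 (pow_eq_zero_iff two_ne_zero |>.1 this))
  have : c * ‖v‖ ^ 2 < (inner ℂ v w).re := by
    refine hasSum_lt (i := i) (fun j => ?_) ?_ h2 h1
    · by_cases hj : j ∈ F
      · simp [hinner j hj]
      · exact mul_le_mul_of_nonneg_right (hF j hj).le (sq_nonneg _)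
    · have h4 : 0 < ‖inner ℂ (b i) v‖ := norm_pos_iff.2 hi
      have h5 : i ∉ F := fun h => hi (hinner i h)
      exact mul_lt_mul_of_pos_right (hF i h5) (by positivity)
  linarith

end Eigenbasis

/-- `K` is bounded as a quadratic form by `C (1 + |n|)^{-p}`. -/
def FormBound (hK : IsSmoothing K) (p : ℕ) (C : ℝ) : Prop :=
  0 ≤ C ∧ ∀ v : EllTwo, |(inner ℂ v (hK.op v)).re| ≤ ∑' n : ℤ, C / wt n ^ p * ‖v n‖ ^ 2

theorem summable_weighted (v : EllTwo) (p : ℕ) {C : ℝ} (hC : 0 ≤ C) :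
    Summable fun n : ℤ => C / wt n ^ p * ‖v n‖ ^ 2 := by
  refine Summable.of_nonneg_of_le (fun n => ?_) (fun n => ?_) ((hasSum_norm_sq v).summable.mul_left C)
  · have := wt_pos n; positivity
  · have := one_le_wt n
    gcongr
    exact div_le_self hC (one_le_pow₀ this)

/-- The inequality `|v n| |v m| ≤ (|v n|² + |v m|²) / 2` splits the double sum into two; in each,
`p` powers of decay stay with the surviving index and two powers in the other index are summed out.
-/
theorem exists_formBound (hK : IsSmoothing K) (p : ℕ) : ∃ C, hK.FormBound p C := by
  obtain ⟨C, hC, h⟩ := hK.decay (p + 2)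
  refine ⟨C * wtSum, mul_nonneg hC wtSum_nonneg, fun v => ?_⟩
  set Q : ℝ := ∑' n : ℤ, 1 / wt n ^ p * ‖v n‖ ^ 2 with hQ
  have hQs := summable_weighted v p zero_le_one
  have hq : ∀ n m, ‖v n‖ * ‖K n m * v m‖ ≤ C / 2 * (1 / wt n ^ p * ‖v n‖ ^ 2) * (1 / wt m ^ 2) +
      C / 2 * (1 / wt n ^ 2) * (1 / wt m ^ p * ‖v m‖ ^ 2) := by
    intro n m
    have hn := one_le_wt n
    have hm := one_le_wt m
    have hn0 := wt_pos n
    have hm0 := wt_pos m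
    have h2 : ‖v n‖ * ‖v m‖ ≤ (‖v n‖ ^ 2 + ‖v m‖ ^ 2) / 2 := by
      nlinarith [sq_nonneg (‖v n‖ - ‖v m‖)]
    have k1 : C / (wt n ^ (p + 2) * wt m ^ (p + 2)) ≤ C / (wt n ^ p * wt m ^ 2) := by
      gcongr <;> first | assumption | omega
    have k2 : C / (wt n ^ (p + 2) * wt m ^ (p + 2)) ≤ C / (wt n ^ 2 * wt m ^ p) := by
      gcongr <;> first | assumption | omega
    rw [norm_mul]
    calc ‖v n‖ * (‖K n m‖ * ‖v m‖) = ‖K n m‖ * (‖v n‖ * ‖v m‖) := by ring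
      _ ≤ C / (wt n ^ (p + 2) * wt m ^ (p + 2)) * ((‖v n‖ ^ 2 + ‖v m‖ ^ 2) / 2) := by
          gcongr; exact h n m
      _ = C / (wt n ^ (p + 2) * wt m ^ (p + 2)) * (‖v n‖ ^ 2 / 2) +
          C / (wt n ^ (p + 2) * wt m ^ (p + 2)) * (‖v m‖ ^ 2 / 2) := by ring
      _ ≤ C / (wt n ^ p * wt m ^ 2) * (‖v n‖ ^ 2 / 2) + C / (wt n ^ 2 * wt m ^ p) * (‖v m‖ ^ 2 / 2) := by
          gcongr
      _ = _ := by field_simp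
  have hrow : ∀ n, ‖conj (v n) * hK.op v n‖ ≤ C / 2 * (1 / wt n ^ p * ‖v n‖ ^ 2) * wtSum +
      C / 2 * (1 / wt n ^ 2) * Q := by
    intro n
    rw [op_apply, ← tsum_mul_left]
    refine tsum_of_norm_bounded ((summable_wt_inv.hasSum.mul_left _).add
      (hQs.hasSum.mul_left _)) fun m => ?_
    rw [norm_mul, RCLike.norm_conj]
    exact hq n m
  have hs : HasSum (fun n => C / 2 * (1 / wt n ^ p * ‖v n‖ ^ 2) * wtSum +
      C / 2 * (1 / wt n ^ 2) * Q) (C / 2 * Q * wtSum + C / 2 * wtSum * Q) :=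
    ((hQs.hasSum.mul_left (C / 2)).mul_right wtSum).add
      ((summable_wt_inv.hasSum.mul_left (C / 2)).mul_right Q)
  refine (Complex.abs_re_le_norm _).trans ?_
  rw [← (inner_hasSum v (hK.op v)).tsum_eq]
  refine (tsum_of_norm_bounded hs hrow).trans (le_of_eq ?_)
  have e : (fun n : ℤ => C * wtSum / wt n ^ p * ‖v n‖ ^ 2)
      = fun n => C * wtSum * (1 / wt n ^ p * ‖v n‖ ^ 2) := by funext n; ring
  rw [e, tsum_mul_left, ← hQ]
  ring

end IsSmoothing
end

/-! ### Rapid convergence of the eigenvalues to `0, 1, 1, 2, 2, …` -/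

noncomputable section

open ComplexConjugate

/-- The eigenvalues `0, 1, 1, 2, 2, …` of the unweighted disc. -/
def discEigenvalue (k : ℕ) : ℕ := (k + 1) / 2

namespace IsSmoothing

open EllTwo

variable {K : ℤ → ℤ → ℂ} {hK : IsSmoothing K}

theorem FormBound.lower {p : ℕ} {C : ℝ} (hC : hK.FormBound p C) {v w : EllTwo}
    (h : hK.IsImage v w) {c : ℝ} (hc : ∀ n, v n ≠ 0 → c ≤ |(n : ℝ)| - C / wt n ^ p) :
    c * ‖v‖ ^ 2 ≤ (inner ℂ v w).re := by
  have h1 := inner_image_re h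
  have h2 := (summable_weighted v p hC.1).hasSum
  have h3 := (abs_le.1 (hC.2 v)).1
  have h4 := hasSum_le (fun n => ?_) ((hasSum_norm_sq v).mul_left c) (h1.sub h2)
  · linarith
  · by_cases hv : v n = 0
    · simp [hv]
    · rw [← sub_mul]
      exact mul_le_mul_of_nonneg_right (hc n hv) (sq_nonneg _)

theorem FormBound.upper {p : ℕ} {C : ℝ} (hC : hK.FormBound p C) {v w : EllTwo}
    (h : hK.IsImage v w) {c : ℝ} (hc : ∀ n, v n ≠ 0 → |(n : ℝ)| + C / wt n ^ p ≤ c) :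
    (inner ℂ v w).re ≤ c * ‖v‖ ^ 2 := by
  have h1 := inner_image_re h
  have h2 := (summable_weighted v p hC.1).hasSum
  have h3 := (abs_le.1 (hC.2 v)).2
  have h4 := hasSum_le (fun n => ?_) (h1.add h2) ((hasSum_norm_sq v).mul_left c)
  · linarith
  · by_cases hv : v n = 0
    · simp [hv]
    · rw [← add_mul]
      exact mul_le_mul_of_nonneg_right (hc n hv) (sq_nonneg _)

theorem exists_sorted_eigenbasis (hK : IsSmoothing K) :
    ∃ (b : HilbertBasis ℕ ℂ EllTwo) (lam : ℕ → ℝ), Monotone lam ∧ hK.IsEigenbasis b lam := by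
  obtain ⟨ι, b, l, hb⟩ := hK.exists_eigenbasis
  replace hb : hK.IsEigenbasis b l := hb
  obtain ⟨C, hC⟩ := hK.exists_formBound 0
  have hfin : ∀ c, {i | l i ≤ c}.Finite := by
    intro c
    by_contra hinf
    obtain ⟨N, hN⟩ := exists_nat_gt (c + C)
    obtain ⟨F, hF, hFc⟩ := Set.Infinite.exists_subset_card_eq hinf
      ((Finset.Icc (-(N : ℤ)) N).card + 1)
    have := hb.card_le_of_lower_bound (c := N - C) (Finset.Icc (-(N : ℤ)) N)
      (fun v w h hv => hC.lower h fun n hn => by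
        have h1 : n ∉ Finset.Icc (-(N : ℤ)) N := fun h => hn (hv n h)
        rw [Finset.mem_Icc, ← abs_le, not_le] at h1
        have h2 : (N : ℝ) ≤ |(n : ℝ)| := by rw [← Int.cast_abs]; exact_mod_cast h1.le
        rw [pow_zero, div_one]; linarith) F
      (fun i hi => lt_of_le_of_lt (hF hi) (by linarith))
    omega
  have hinf : Infinite ι := by
    by_contra h
    rw [not_infinite_iff_finite] at h
    have := Fintype.ofFinite ι
    set N := Fintype.card ι
    have := hb.card_le_of_upper_bound (c := N + C) (Finset.Icc (-(N : ℤ)) N)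
      (fun v w h hv => hC.upper h fun n hn => by
        have h1 : n ∈ Finset.Icc (-(N : ℤ)) N := by
          by_contra h; exact hn (hv n h)
        rw [Finset.mem_Icc, ← abs_le] at h1
        have h2 : |(n : ℝ)| ≤ N := by rw [← Int.cast_abs]; exact_mod_cast h1
        rw [pow_zero, div_one]; linarith) Finset.univ (fun i hi => (hi (Finset.mem_univ i)).elim)
    rw [Int.card_Icc, Finset.card_univ] at this
    omega
  obtain ⟨e, he⟩ := exists_equiv_nat_monotone l hfin
  have hs : ⊤ ≤ (Submodule.span ℂ (Set.range (b ∘ e))).topologicalClosure := by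
    rw [e.surjective.range_comp, b.dense_span]
  refine ⟨HilbertBasis.mk (b.orthonormal.comp e e.injective) hs, l ∘ e, he, fun i n => ?_⟩
  rw [HilbertBasis.coe_mk]
  exact hb (e i) n

/-- For `N = discEigenvalue k`, at most `k` integers satisfy `|n| < N`, whereas failure of the bound
would put the `k + 1` eigenvalues `lam 0, …, lam k` below a form bound valid off these integers. -/
theorem IsEigenbasis.le_eigenvalue {b : HilbertBasis ℕ ℂ EllTwo} {lam : ℕ → ℝ}
    (hb : hK.IsEigenbasis b lam) (hmono : Monotone lam) {p : ℕ} {C : ℝ} (hC : hK.FormBound p C)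
    (k : ℕ) : discEigenvalue k - C / (1 + discEigenvalue k) ^ p ≤ lam k := by
  by_contra! hlt
  set N := discEigenvalue k with hN
  have := hb.card_le_of_lower_bound (Finset.Icc (1 - (N : ℤ)) (N - 1))
    (fun v w h hv => hC.lower h fun n hn => by
      have h1 : n ∉ Finset.Icc (1 - (N : ℤ)) (N - 1) := fun h => hn (hv n h)
      have h0 : (N : ℤ) ≤ |n| := by
        rw [Finset.mem_Icc] at h1
        rw [le_abs]; omega
      have h2 : (N : ℝ) ≤ |(n : ℝ)| := by rw [← Int.cast_abs]; exact_mod_cast h0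
      have h3 := hC.1
      have : (1 : ℝ) + N ≤ wt n := by rw [wt]; linarith
      show (N : ℝ) - C / (1 + N) ^ p ≤ _
      gcongr) (Finset.range (k + 1))
    (fun i hi => (hmono (by simpa [Nat.lt_succ_iff] using hi)).trans_lt hlt)
  rw [Int.card_Icc, Finset.card_range] at this
  simp only [discEigenvalue] at hN
  omega

/-- The left side need not increase with `x`. If `1 + x ≥ (1 + N) / 2`, the fraction is comparable
to its value at `N`. Otherwise `N - x > (1 + N) / 2` absorbs `C`, unless `C` itself exceeds `(1 + N)
/ 2`, and then `(2 C)^p / (1 + N)^p ≥ 1`. -/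
theorem add_div_wt_pow_le {C : ℝ} (hC : 0 ≤ C) (p N : ℕ) {x : ℝ} (hx0 : 0 ≤ x) (hx : x ≤ N) :
    x + C / (1 + x) ^ p ≤ N + (C * 2 ^ p + C * (2 * C) ^ p) / (1 + (N : ℝ)) ^ p := by
  have hN : (0 : ℝ) ≤ N := Nat.cast_nonneg N
  rw [add_div]
  have t1 : 0 ≤ C * 2 ^ p / (1 + (N : ℝ)) ^ p := by positivity
  have t2 : 0 ≤ C * (2 * C) ^ p / (1 + (N : ℝ)) ^ p := by positivity
  rcases le_or_gt ((1 + (N : ℝ)) / 2) (1 + x) with h | h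
  · have : C / (1 + x) ^ p ≤ C / ((1 + (N : ℝ)) / 2) ^ p := by gcongr
    have e : C / ((1 + (N : ℝ)) / 2) ^ p = C * 2 ^ p / (1 + (N : ℝ)) ^ p := by
      rw [div_pow]; field_simp
    linarith
  · have h1 : C / (1 + x) ^ p ≤ C := div_le_self hC (one_le_pow₀ (by linarith))
    rcases le_or_gt C ((1 + (N : ℝ)) / 2) with h2 | h2
    · linarith
    · have : C ≤ C * (2 * C) ^ p / (1 + (N : ℝ)) ^ p := by
        rw [le_div_iff₀ (by positivity)]
        gcongr
        linarith
      linarith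

/-- The vectors supported on `|n| ≤ N` form a space of dimension `2 N + 1 > k`, while failure of the
bound leaves at most the `k` eigenvalues `lam 0, …, lam (k - 1)` not above the form bound. -/
theorem IsEigenbasis.eigenvalue_le {b : HilbertBasis ℕ ℂ EllTwo} {lam : ℕ → ℝ}
    (hb : hK.IsEigenbasis b lam) (hmono : Monotone lam) {p : ℕ} {C : ℝ} (hC : hK.FormBound p C)
    (k : ℕ) : lam k ≤ discEigenvalue k +
      (C * 2 ^ p + C * (2 * C) ^ p) / (1 + (discEigenvalue k : ℝ)) ^ p := by
  by_contra! hlt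
  set N := discEigenvalue k with hN
  have := hb.card_le_of_upper_bound (Finset.Icc (-(N : ℤ)) N)
    (fun v w h hv => hC.upper h fun n hn => by
      have h1 : n ∈ Finset.Icc (-(N : ℤ)) N := by
        by_contra h; exact hn (hv n h)
      rw [Finset.mem_Icc, ← abs_le] at h1
      have h2 : |(n : ℝ)| ≤ N := by rw [← Int.cast_abs]; exact_mod_cast h1
      exact add_div_wt_pow_le hC.1 p N (abs_nonneg _) h2) (Finset.range k)
    (fun i hi => hlt.trans_le (hmono (by simpa using hi)))
  rw [Int.card_Icc, Finset.card_range] at this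
  simp only [discEigenvalue] at hN
  omega

theorem IsEigenbasis.exists_abs_sub_le {b : HilbertBasis ℕ ℂ EllTwo} {lam : ℕ → ℝ}
    (hb : hK.IsEigenbasis b lam) (hmono : Monotone lam) (p : ℕ) :
    ∃ C, 0 ≤ C ∧ ∀ k, |lam k - discEigenvalue k| ≤ C / (1 + (discEigenvalue k : ℝ)) ^ p := by
  obtain ⟨C, hC⟩ := hK.exists_formBound p
  have h0 := hC.1
  refine ⟨C + (C * 2 ^ p + C * (2 * C) ^ p), by positivity, fun k => ?_⟩
  have h1 := hb.le_eigenvalue hmono hC k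
  have h2 := hb.eigenvalue_le hmono hC k
  have t1 : 0 ≤ C / (1 + (discEigenvalue k : ℝ)) ^ p := by positivity
  have t2 : 0 ≤ (C * 2 ^ p + C * (2 * C) ^ p) / (1 + (discEigenvalue k : ℝ)) ^ p := by positivity
  rw [add_div, abs_le]
  constructor <;> linarith

theorem IsEigenbasis.eq_discEigenvalue {b : HilbertBasis ℕ ℂ EllTwo} {lam : ℕ → ℝ}
    (hb : hK.IsEigenbasis b lam) (hmono : Monotone lam) (h0 : K = 0) (k : ℕ) :
    lam k = discEigenvalue k := by
  have hC : hK.FormBound 0 0 := by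
    refine ⟨le_rfl, fun v => ?_⟩
    have : hK.op v = 0 := by
      ext n
      rw [op_apply]
      simp [h0]
    rw [this, inner_zero_right]
    simp
  have h1 := hb.le_eigenvalue hmono hC k
  have h2 := hb.eigenvalue_le hmono hC k
  simp only [zero_mul, add_zero, zero_div, sub_zero] at h1 h2
  exact le_antisymm h2 h1

end IsSmoothing
end

/-! ### Spectral measures of the basis vectors and the trace inequality -/

noncomputable section

open ComplexConjugate

namespace IsSmoothing

open EllTwo

variable {K : ℤ → ℤ → ℂ} {hK : IsSmoothing K}

/-- The matrix `|n| + K` applied to a sequence. -/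
def applySeq (K : ℤ → ℤ → ℂ) (v : ℤ → ℂ) (n : ℤ) : ℂ :=
  (|(n : ℝ)| : ℝ) * v n + ∑' m, K n m * v m

theorem exists_applySeq_le (hK : IsSmoothing K) (p : ℕ) : ∃ C, 0 ≤ C ∧ ∀ (v : ℤ → ℂ) (A : ℝ),
    (∀ n, ‖v n‖ ≤ A / wt n ^ (p + 1)) → ∀ n, ‖applySeq K v n‖ ≤ C * A / wt n ^ p := by
  obtain ⟨C, hC, h⟩ := hK.exists_norm_tsum_le p
  refine ⟨1 + C, by positivity, fun v A hv n => ?_⟩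
  have hA : 0 ≤ A := by
    have h1 := (norm_nonneg _).trans (hv 0)
    have h2 := wt_pos 0
    rwa [le_div_iff₀ (by positivity), zero_mul] at h1
  have h1 := h v A (fun m => (hv m).trans (div_le_self hA (one_le_pow₀ (one_le_wt m)))) n
  have hn := wt_pos n
  have h2 : ‖(((|(n : ℝ)| : ℝ) : ℂ)) * v n‖ ≤ A / wt n ^ p := by
    rw [norm_mul, Complex.norm_real, Real.norm_of_nonneg (abs_nonneg _)]
    calc |(n : ℝ)| * ‖v n‖ ≤ wt n * (A / wt n ^ (p + 1)) := by
          gcongr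
          · rw [wt]; linarith
          · exact hv n
      _ = _ := by rw [pow_succ]; field_simp
  calc _ ≤ A / wt n ^ p + C * A / wt n ^ p := (norm_add_le _ _).trans (add_le_add h2 h1)
    _ = _ := by ring

theorem exists_iterate_applySeq_le (hK : IsSmoothing K) (i : ℕ) : ∀ p : ℕ, ∃ C, 0 ≤ C ∧
    ∀ (v : ℤ → ℂ) (A : ℝ), (∀ n, ‖v n‖ ≤ A / wt n ^ (p + i)) →
      ∀ n, ‖(applySeq K)^[i] v n‖ ≤ C * A / wt n ^ p := by
  induction i with
  | zero => exact fun p => ⟨1, zero_le_one, fun v A h n => by simpa using h n⟩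
  | succ i ih =>
    intro p
    obtain ⟨C, hC, h⟩ := ih (p + 1)
    obtain ⟨C', hC', h'⟩ := hK.exists_applySeq_le p
    refine ⟨C' * C, by positivity, fun v A hv n => ?_⟩
    rw [Function.iterate_succ_apply', mul_assoc]
    exact h' _ _ (h v A fun m => by rw [add_assoc, add_comm 1 i]; exact hv m) n

/-- Each application of `|n| + K` costs one power of decay; the initial `1 + i` powers keep all `i`
iterates square summable, so `inner_image` applies every time. -/
theorem IsEigenbasis.exists_iterate {b : HilbertBasis ℕ ℂ EllTwo} {lam : ℕ → ℝ}
    (hb : hK.IsEigenbasis b lam) (i : ℕ) : ∀ (x : EllTwo) (A : ℝ),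
    (∀ n, ‖x n‖ ≤ A / wt n ^ (1 + i)) → ∃ y : EllTwo, (y : ℤ → ℂ) = (applySeq K)^[i] x ∧
      ∀ k, inner ℂ (b k) y = (lam k : ℂ) ^ i * inner ℂ (b k) x := by
  induction i with
  | zero => exact fun x A h => ⟨x, rfl, fun k => by simp⟩
  | succ i ih =>
    intro x A h
    have h' : ∀ n, ‖x n‖ ≤ A / wt n ^ (1 + i) := by
      intro n
      refine (h n).trans ?_
      have hn := one_le_wt n
      have hn0 := wt_pos n
      have hA : 0 ≤ A := by
        have h1 := (norm_nonneg _).trans (h 0)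
        have h2 := wt_pos 0
        rwa [le_div_iff₀ (by positivity), zero_mul] at h1
      gcongr
      omega
    obtain ⟨y, hy, hyk⟩ := ih x A h'
    obtain ⟨C, hC, hCb⟩ := hK.exists_iterate_applySeq_le (i + 1) 1
    have hmem : Memℓp (applySeq K y) 2 := by
      refine memℓp_of_le (C := C * A) fun n => ?_
      have := hCb x A h n
      rw [Function.iterate_succ_apply', ← hy, pow_one] at this
      exact this
    refine ⟨⟨applySeq K y, hmem⟩, ?_, fun k => ?_⟩
    · rw [Function.iterate_succ_apply', ← hy]
    · have himg : hK.IsImage y ⟨applySeq K y, hmem⟩ := fun n => rfl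
      rw [hb.inner_image himg, hyk, pow_succ]; ring

/-- Parseval for the `i`-th iterate of `x`. The constant depends on `i` only, which gives estimates
uniform over families of vectors. -/
theorem IsEigenbasis.exists_moment_le {b : HilbertBasis ℕ ℂ EllTwo} {lam : ℕ → ℝ}
    (hb : hK.IsEigenbasis b lam) (i : ℕ) : ∃ C, 0 ≤ C ∧ ∀ (x : EllTwo) (A : ℝ),
    (∀ n, ‖x n‖ ≤ A / wt n ^ (1 + i)) →
      Summable (fun k => lam k ^ (2 * i) * ‖inner ℂ (b k) x‖ ^ 2) ∧
      ∑' k, lam k ^ (2 * i) * ‖inner ℂ (b k) x‖ ^ 2 ≤ C * A ^ 2 := by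
  obtain ⟨C, hC, hCb⟩ := hK.exists_iterate_applySeq_le i 1
  refine ⟨C ^ 2 * wtSum, mul_nonneg (sq_nonneg _) wtSum_nonneg, fun x A h => ?_⟩
  obtain ⟨y, hy, hyk⟩ := hb.exists_iterate i x A h
  have hs := hasSum_norm_inner_sq b y
  have e : (fun k => ‖inner ℂ (b k) y‖ ^ 2)
      = fun k => lam k ^ (2 * i) * ‖inner ℂ (b k) x‖ ^ 2 := by
    funext k
    rw [hyk, norm_mul, norm_pow, Complex.norm_real, mul_pow, ← pow_mul, mul_comm i 2,
      Real.norm_eq_abs, pow_mul, pow_mul, sq_abs]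
  rw [e] at hs
  refine ⟨hs.summable, ?_⟩
  rw [hs.tsum_eq]
  have := norm_sq_le (x := y) (C := C * A) fun n => by
    rw [hy]; simpa using hCb x A h n
  calc ‖y‖ ^ 2 ≤ (C * A) ^ 2 * wtSum := this
    _ = _ := by ring

/-- The standard basis vector. -/
def unit (n : ℤ) : EllTwo := lp.single 2 n 1

theorem unit_apply (n m : ℤ) : unit n m = if m = n then 1 else 0 := by
  simp only [unit, lp.single_apply, Pi.single_apply]

theorem op_unit (hK : IsSmoothing K) (n m : ℤ) : hK.op (unit n) m = K m n := by
  rw [op_apply, tsum_eq_single n]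
  · simp [unit_apply]
  · intro k hk; simp [unit_apply, hk]

theorem norm_unit (n : ℤ) : ‖unit n‖ = 1 := by
  rw [unit, lp.norm_single (by norm_num), norm_one]

theorem inner_unit (x : EllTwo) (n : ℤ) : inner ℂ x (unit n) = conj (x n) := by
  refine (inner_hasSum x (unit n)).unique ?_
  have h := hasSum_single (f := fun m => conj (x m) * unit n m) n
    (fun m hm => by simp [unit_apply, hm])
  simpa [unit_apply] using h

/-- Off the resonance `lam k = |n|` this expresses the small overlap of `b k` and `unit n` through
the rapidly decreasing vector `K (unit n)`. -/
theorem IsEigenbasis.inner_op_unit {b : HilbertBasis ℕ ℂ EllTwo} {lam : ℕ → ℝ}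
    (hb : hK.IsEigenbasis b lam) (n : ℤ) (k : ℕ) :
    inner ℂ (b k) (hK.op (unit n)) = ((lam k - |(n : ℝ)| : ℝ) : ℂ) * inner ℂ (b k) (unit n) := by
  have himg : hK.IsImage (unit n) (((|(n : ℝ)| : ℝ) : ℂ) • unit n + hK.op (unit n)) := by
    intro m
    rw [lp.coeFn_add, Pi.add_apply, lp.coeFn_smul, Pi.smul_apply, smul_eq_mul, unit_apply]
    split_ifs with h
    · rw [h]
    · simp
  have := hb.inner_image himg k
  rw [inner_add_right, inner_smul_right] at this
  push_cast
  linear_combination this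

/-- The weights of the spectral measure of the standard basis vector with index `n`. -/
def spectralWeight (b : HilbertBasis ℕ ℂ EllTwo) (n : ℤ) (k : ℕ) : ℝ :=
  ‖inner ℂ (b k) (unit n)‖ ^ 2

theorem spectralWeight_nonneg (b : HilbertBasis ℕ ℂ EllTwo) (n : ℤ) (k : ℕ) :
    0 ≤ spectralWeight b n k := sq_nonneg _

theorem hasSum_spectralWeight (b : HilbertBasis ℕ ℂ EllTwo) (n : ℤ) :
    HasSum (spectralWeight b n) 1 := by
  have h := hasSum_norm_inner_sq b (unit n)
  rw [norm_unit, one_pow] at h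
  exact h

theorem hasSum_spectralWeight_left (b : HilbertBasis ℕ ℂ EllTwo) (k : ℕ) :
    HasSum (fun n => spectralWeight b n k) 1 := by
  have := hasSum_norm_sq (b k)
  rw [b.orthonormal.norm_eq_one, one_pow] at this
  simpa only [spectralWeight, inner_unit, RCLike.norm_conj] using this

theorem IsEigenbasis.hasSum_spectralWeight_mul {b : HilbertBasis ℕ ℂ EllTwo} {lam : ℕ → ℝ}
    (hb : hK.IsEigenbasis b lam) (n : ℤ) :
    HasSum (fun k => spectralWeight b n k * lam k) (|(n : ℝ)| + (K n n).re) := by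
  have himg : hK.IsImage (unit n) (((|(n : ℝ)| : ℝ) : ℂ) • unit n + hK.op (unit n)) := by
    intro m
    rw [lp.coeFn_add, Pi.add_apply, lp.coeFn_smul, Pi.smul_apply, smul_eq_mul, unit_apply]
    split_ifs with h
    · rw [h]
    · simp
  have := hb.hasSum_inner himg
  convert! this using 1
  · funext k; exact mul_comm _ _
  · rw [← inner_conj_symm, inner_unit, Complex.conj_conj, lp.coeFn_add, Pi.add_apply,
      lp.coeFn_smul, Pi.smul_apply, smul_eq_mul, unit_apply, if_pos rfl, op_unit]
    simp

theorem exists_norm_unit_le (n : ℤ) (p : ℕ) : ∃ A, ∀ m, ‖unit n m‖ ≤ A / wt m ^ p := by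
  refine ⟨wt n ^ p, fun m => ?_⟩
  have := wt_pos m
  have hn := wt_pos n
  rw [unit_apply]
  split_ifs with h
  · rw [h, norm_one, div_self (by positivity)]
  · rw [norm_zero]; positivity

/-- The properties of a function on `[0, ∞)` that the trace inequality needs. -/
structure TraceFunction (f : ℝ → ℝ) (c : ℝ) (j : ℕ) : Prop where
  growth : ∀ x, 0 ≤ x → |f x| ≤ c * (1 + x ^ (2 * (j + 1)))
  tangent : ∀ x₀, 1 ≤ x₀ → ∃ s, ∀ x, 0 ≤ x → f x₀ + s * (x - x₀) ≤ f x
  zero : f 0 = 0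
  nonneg : ∀ x, 1 ≤ x → 0 ≤ f x
  mono : ∀ x y, 1 ≤ x → x ≤ y → f x ≤ f y

section Trace

variable {b : HilbertBasis ℕ ℂ EllTwo} {lam : ℕ → ℝ} {f : ℝ → ℝ} {c : ℝ} {j : ℕ}

theorem IsEigenbasis.summable_spectralWeight_mul (hb : hK.IsEigenbasis b lam)
    (hpos : ∀ k, 0 ≤ lam k) (hf : TraceFunction f c j) (n : ℤ) :
    Summable fun k => spectralWeight b n k * f (lam k) := by
  obtain ⟨C, -, h⟩ := hb.exists_moment_le (j + 1)
  obtain ⟨A, hA⟩ := exists_norm_unit_le n (1 + (j + 1))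
  have h1 := ((hasSum_spectralWeight b n).summable.add (h _ A hA).1).mul_left c
  refine Summable.of_norm_bounded h1 fun k => ?_
  rw [norm_mul, Real.norm_of_nonneg (spectralWeight_nonneg b n k), Real.norm_eq_abs]
  calc _ ≤ spectralWeight b n k * (c * (1 + lam k ^ (2 * (j + 1)))) :=
        mul_le_mul_of_nonneg_left (hf.growth _ (hpos k)) (spectralWeight_nonneg b n k)
    _ = _ := by rw [spectralWeight]; ring

/-- Jensen's inequality: the spectral measure of `unit n` has mean `d n`, and the tangent of `f` at
`d n ≥ 1` is integrated against it. Tangents are available only from `1` on, so `n = 0` is separate: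
`K` kills `unit 0`, its spectral measure sits at eigenvalue zero, and `f 0 = 0`. -/
theorem IsEigenbasis.le_tsum_spectralWeight (hb : hK.IsEigenbasis b lam)
    (hpos : ∀ k, 0 ≤ lam k) (hf : TraceFunction f c j) {d : ℤ → ℝ}
    (hd : ∀ n, d n = |(n : ℝ)| + (K n n).re) (hdn : ∀ n : ℤ, |(n : ℝ)| ≤ d n)
    (h0 : ∀ m, K m 0 = 0) (n : ℤ) : f (d n) ≤ ∑' k, spectralWeight b n k * f (lam k) := by
  rcases eq_or_ne n 0 with rfl | hn
  · have hd0 : d 0 = 0 := by rw [hd, h0]; simp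
    rw [hd0, hf.zero]
    refine (tsum_congr (fun k => ?_) |>.trans tsum_zero).ge
    have h1 := hb.inner_op_unit 0 k
    have h2 : hK.op (unit 0) = 0 := by
      ext m; rw [op_unit, h0]; rfl
    rw [h2, inner_zero_right] at h1
    rcases mul_eq_zero.1 h1.symm with h3 | h3
    · have : lam k = 0 := by
        have h4 : lam k - |((0 : ℤ) : ℝ)| = 0 := by exact_mod_cast h3
        simpa using h4
      rw [this, hf.zero, mul_zero]
    · rw [spectralWeight, h3, norm_zero]; simp
  · have h1 : (1 : ℝ) ≤ d n := by
      refine le_trans ?_ (hdn n)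
      rw [← Int.cast_abs]; exact_mod_cast Int.one_le_abs hn
    obtain ⟨s, hs⟩ := hf.tangent _ h1
    have hw := hasSum_spectralWeight b n
    have hl := hb.hasSum_spectralWeight_mul n
    rw [← hd] at hl
    have h2 := (hw.mul_right (f (d n) - s * d n)).add (hl.mul_left s)
    have h3 := (hb.summable_spectralWeight_mul hpos hf n).hasSum
    have h4 := hasSum_le (fun k => ?_) h2 h3
    · linarith
    · have := mul_le_mul_of_nonneg_left (hs _ (hpos k)) (spectralWeight_nonneg b n k)
      linarith

theorem sum_discEigenvalue (f : ℝ → ℝ) (N : ℕ) :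
    ∑ k ∈ Finset.range (2 * N + 1), f (discEigenvalue k)
      = ∑ n ∈ Finset.Icc (-(N : ℤ)) N, f |(n : ℝ)| := by
  induction N with
  | zero => simp [discEigenvalue]
  | succ N ih =>
    have e : Finset.Icc (-((N + 1 : ℕ) : ℤ)) (N + 1 : ℕ)
        = insert (-((N + 1 : ℕ) : ℤ)) (insert (((N + 1 : ℕ) : ℤ)) (Finset.Icc (-(N : ℤ)) N)) := by
      ext n
      simp only [Finset.mem_Icc, Finset.mem_insert]
      push_cast
      omega
    rw [e, Finset.sum_insert, Finset.sum_insert, ← ih, show 2 * (N + 1) + 1 = 2 * N + 1 + 1 + 1 by ring,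
      Finset.sum_range_succ, Finset.sum_range_succ]
    · have e1 : discEigenvalue (2 * N + 1) = N + 1 := by rw [discEigenvalue]; omega
      have e2 : discEigenvalue (2 * N + 1 + 1) = N + 1 := by rw [discEigenvalue]; omega
      have e3 : |(((N + 1 : ℕ) : ℤ) : ℝ)| = ((N + 1 : ℕ) : ℝ) := by
        rw [Int.cast_natCast, Nat.abs_cast]
      rw [e1, e2, Int.cast_neg, abs_neg, e3]
      ring
    · simp only [Finset.mem_Icc]; push_cast; omega
    · simp only [Finset.mem_Icc, Finset.mem_insert]; push_cast; omega

/-- For `k > 2 N` and `|n| ≤ N` the gap `lam k - |n|` is at least `1 / 2`. By `inner_op_unit` the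
weight is then governed by the coefficients of `K (unit n)`, whose moments decrease rapidly in `n`.
The bound is uniform in `N` and summable in `n`, as dominated convergence requires. -/
theorem IsEigenbasis.exists_tail_le (hb : hK.IsEigenbasis b lam) (hmono : Monotone lam)
    (hpos : ∀ k, 0 ≤ lam k) (hf : TraceFunction f c j) : ∃ (B : ℝ) (N₀ : ℕ), ∀ N : ℕ, N₀ ≤ N →
      ∀ n : ℤ, |n| ≤ N →
        |∑' k, spectralWeight b n (k + (2 * N + 1)) * f (lam (k + (2 * N + 1)))| ≤ B / wt n ^ 2 := by
  obtain ⟨C₁, hC₁, hC₁b⟩ := hb.exists_abs_sub_le hmono 1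
  obtain ⟨Cj, hCj, hmom⟩ := hb.exists_moment_le j
  obtain ⟨CK, hCK, hCKb⟩ := hK.decay (j + 2)
  -- This makes `lam k` deviate by at most `1 / 2` from an integer that is at least `N + 1`. Taking
  -- `N₀ + 1` below also ensures `N ≥ 1`, hence `lam k ≥ 1`.
  obtain ⟨N₀, hN₀⟩ := exists_nat_ge (2 * C₁)
  have hc : 0 ≤ c := by
    have := hf.growth 0 le_rfl
    rw [hf.zero, abs_zero] at this
    simpa using this
  refine ⟨8 * c * Cj * CK ^ 2, N₀ + 1, fun N hN n hn => ?_⟩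
  have hwn := wt_pos n
  have hA : ∀ m, ‖hK.op (unit n) m‖ ≤ (CK / wt n ^ 2) / wt m ^ (1 + j) := by
    intro m
    have hwm := wt_pos m
    rw [op_unit, div_div]
    refine (hCKb m n).trans (div_le_div_of_nonneg_left hCK (by positivity) ?_)
    rw [mul_comm]
    exact mul_le_mul (pow_le_pow_right₀ (one_le_wt m) (by omega))
      (pow_le_pow_right₀ (one_le_wt n) (by omega)) (by positivity) (by positivity)
  obtain ⟨hs, hle⟩ := hmom _ _ hA
  set g := fun k => lam k ^ (2 * j) * ‖inner ℂ (b k) (hK.op (unit n))‖ ^ 2 with hg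
  have hg0 : ∀ k, 0 ≤ g k := fun k => by have := hpos k; positivity
  have hterm : ∀ k, 2 * N + 1 ≤ k → ‖spectralWeight b n k * f (lam k)‖ ≤ 8 * c * wt n ^ 2 * g k := by
    intro k hk
    have hNn : |(n : ℝ)| ≤ N := by rw [← Int.cast_abs]; exact_mod_cast hn
    have hdk : (N : ℝ) + 1 ≤ discEigenvalue k := by
      have : N + 1 ≤ discEigenvalue k := by rw [discEigenvalue]; omega
      exact_mod_cast this
    have h1 := (abs_le.1 (hC₁b k)).1
    have h2 : C₁ / (1 + (discEigenvalue k : ℝ)) ^ 1 ≤ 1 / 2 := by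
      rw [pow_one, div_le_div_iff₀ (by positivity) (by norm_num)]
      have : (N₀ : ℝ) ≤ N := by exact_mod_cast (Nat.le_succ N₀).trans hN
      linarith
    have hn0 := abs_nonneg (n : ℝ)
    set x := lam k - |(n : ℝ)| with hx
    have hx2 : 1 / 2 ≤ x := by linarith
    have hw : spectralWeight b n k * x ^ 2 = ‖inner ℂ (b k) (hK.op (unit n))‖ ^ 2 := by
      rw [hb.inner_op_unit, norm_mul, Complex.norm_real, mul_pow, Real.norm_eq_abs, sq_abs,
        spectralWeight, mul_comm]
    -- Here `lam k = x + |n|` and `x ≥ 1 / 2`. Two of the `2 (j + 1)` factors `lam k` are traded for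
    -- `x`, to be absorbed by the factor `x ^ 2` in `hw`, at the price of `wt n ^ 2`.
    have hl : lam k ≤ 2 * x * wt n := by rw [wt]; nlinarith
    have hpk := hpos k
    have hW := spectralWeight_nonneg b n k
    rw [norm_mul, Real.norm_of_nonneg hW, Real.norm_eq_abs, hg]
    have hN1 : (1 : ℝ) ≤ N := by exact_mod_cast (Nat.le_add_left 1 N₀).trans hN
    have hl1 : 1 ≤ lam k ^ (2 * (j + 1)) := one_le_pow₀ (by linarith)
    calc spectralWeight b n k * |f (lam k)|
        ≤ spectralWeight b n k * (c * (lam k ^ (2 * (j + 1)) + lam k ^ (2 * (j + 1)))) := by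
          refine mul_le_mul_of_nonneg_left ((hf.growth _ hpk).trans ?_) hW
          gcongr
      _ = 2 * c * lam k ^ (2 * j) * spectralWeight b n k * lam k ^ 2 := by ring
      _ ≤ 2 * c * lam k ^ (2 * j) * spectralWeight b n k * (2 * x * wt n) ^ 2 := by gcongr
      _ = 8 * c * wt n ^ 2 * (lam k ^ (2 * j) * (spectralWeight b n k * x ^ 2)) := by ring
      _ = _ := by rw [hw]
  have hs' : Summable fun k => 8 * c * wt n ^ 2 * g (k + (2 * N + 1)) :=
    ((summable_nat_add_iff (2 * N + 1)).2 hs).mul_left _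
  rw [← Real.norm_eq_abs]
  calc _ ≤ ∑' k, 8 * c * wt n ^ 2 * g (k + (2 * N + 1)) :=
        tsum_of_norm_bounded hs'.hasSum fun k => hterm _ (by omega)
    _ = 8 * c * wt n ^ 2 * ∑' k, g (k + (2 * N + 1)) := tsum_mul_left
    _ ≤ 8 * c * wt n ^ 2 * (Cj * (CK / wt n ^ 2) ^ 2) := by
        gcongr
        refine le_trans ?_ hle
        rw [← hs.sum_add_tsum_nat_add (2 * N + 1)]
        exact le_add_of_nonneg_left (Finset.sum_nonneg fun k _ => hg0 k)
    _ = _ := by field_simp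

/-- Jensen's inequality is summed over `|n| ≤ N` and compared with the first `2 N + 1` eigenvalues,
so that only differences survive the limit. The weights of a fixed `k` sum over `n` to at most `1`,
which suffices where `f (lam k) ≥ 0`. Two errors remain: the spectral tails `T`, which vanish by
dominated convergence, and the missing mass at the finitely many `k < k₁` where `f (lam k)` may be
negative, which vanishes since the total mass is `1`. -/
theorem IsEigenbasis.le_tsum_sub (hb : hK.IsEigenbasis b lam) (hmono : Monotone lam)
    (hpos : ∀ k, 0 ≤ lam k) (hf : TraceFunction f c j) {d : ℤ → ℝ}
    (hd : ∀ n, d n = |(n : ℝ)| + (K n n).re) (hdn : ∀ n : ℤ, |(n : ℝ)| ≤ d n)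
    (h0 : ∀ m, K m 0 = 0) (hs : Summable fun k => f (lam k) - f (discEigenvalue k)) (n₀ : ℕ) :
    f (d n₀) - f n₀ ≤ ∑' k, (f (lam k) - f (discEigenvalue k)) := by
  obtain ⟨B, N₁, hB⟩ := hb.exists_tail_le hmono hpos hf
  obtain ⟨C₁, hC₁, hC₁b⟩ := hb.exists_abs_sub_le hmono 0
  obtain ⟨k₁, hk₁⟩ : ∃ k₁, ∀ k, k₁ ≤ k → 1 ≤ lam k := by
    obtain ⟨M, hM⟩ := exists_nat_ge (1 + C₁)
    refine ⟨2 * M, fun k hk => ?_⟩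
    have h1 := (abs_le.1 (hC₁b k)).1
    have h2 : (M : ℝ) ≤ discEigenvalue k := by
      have : M ≤ discEigenvalue k := by rw [discEigenvalue]; omega
      exact_mod_cast this
    rw [pow_zero, div_one] at h1
    linarith
  set I := fun N : ℕ => Finset.Icc (-(N : ℤ)) N with hI
  have hItop : Filter.Tendsto I Filter.atTop Filter.atTop := by
    refine Filter.tendsto_atTop_finset_of_monotone ?_ ?_
    · intro a b hab
      exact Finset.Icc_subset_Icc (by simpa using hab) (by simpa using hab)
    · intro x
      refine ⟨x.natAbs, ?_⟩
      rw [hI, Finset.mem_Icc]; omega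
  set T := fun (N : ℕ) (n : ℤ) => if |n| ≤ N then
    ∑' k, spectralWeight b n (k + (2 * N + 1)) * f (lam (k + (2 * N + 1))) else 0 with hT
  have hTlim : Filter.Tendsto (fun N => ∑' n, T N n) Filter.atTop (nhds 0) := by
    have := tendsto_tsum_of_dominated_convergence (𝓕 := Filter.atTop) (f := T) (g := fun _ => 0)
      (bound := fun n => |B| / wt n ^ 2) ?_ ?_ ?_
    · simpa using this
    · simpa [div_eq_mul_inv] using summable_wt_inv.mul_left |B|
    · intro n
      have h1 := tendsto_sum_nat_add fun k => spectralWeight b n k * f (lam k)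
      have h2 : Filter.Tendsto (fun N : ℕ => 2 * N + 1) Filter.atTop Filter.atTop :=
        Filter.tendsto_atTop_mono (fun N => by simp only [id]; omega) Filter.tendsto_id
      refine (h1.comp h2).congr' ?_
      filter_upwards [Filter.eventually_ge_atTop n.natAbs] with N hN
      rw [hT]
      simp only
      rw [if_pos (by rw [Int.abs_eq_natAbs]; omega)]
      rfl
    · filter_upwards [Filter.eventually_ge_atTop N₁] with N hN n
      have hwn := wt_pos n
      rw [hT]
      simp only
      split_ifs with h
      · refine (hB N hN n h).trans ?_
        gcongr
        exact le_abs_self B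
      · rw [norm_zero]; positivity
  have hElim : Filter.Tendsto (fun N => ∑ k ∈ Finset.range k₁,
      (1 - ∑ n ∈ I N, spectralWeight b n k) * |f (lam k)|) Filter.atTop (nhds 0) := by
    rw [← Finset.sum_const_zero (s := Finset.range k₁)]
    refine tendsto_finsetSum _ fun k _ => ?_
    have h1 : Filter.Tendsto (fun N => ∑ n ∈ I N, spectralWeight b n k) Filter.atTop (nhds 1) :=
      (hasSum_spectralWeight_left b k).comp hItop
    simpa using (h1.const_sub 1).mul_const |f (lam k)|
  have hSlim : Filter.Tendsto (fun N : ℕ => ∑ k ∈ Finset.range (2 * N + 1),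
      (f (lam k) - f (discEigenvalue k))) Filter.atTop
      (nhds (∑' k, (f (lam k) - f (discEigenvalue k)))) := by
    have h2 : Filter.Tendsto (fun N : ℕ => 2 * N + 1) Filter.atTop Filter.atTop :=
      Filter.tendsto_atTop_mono (fun N => by simp only [id]; omega) Filter.tendsto_id
    exact hs.hasSum.tendsto_sum_nat.comp h2
  have hlim := (hSlim.add hElim).add hTlim
  rw [add_zero, add_zero] at hlim
  refine ge_of_tendsto hlim ?_
  filter_upwards [Filter.eventually_ge_atTop n₀, Filter.eventually_ge_atTop k₁] with N hN hNk
  have hdiff : ∀ n : ℤ, 0 ≤ f (d n) - f |(n : ℝ)| := by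
    intro n
    rcases eq_or_ne n 0 with rfl | hn
    · rw [hd, h0]; simp
    · refine sub_nonneg.2 (hf.mono _ _ ?_ (hdn n))
      rw [← Int.cast_abs]; exact_mod_cast Int.one_le_abs hn
  -- All terms are nonnegative by `hdiff`, so a single one may be kept.
  have s1 : f (d n₀) - f n₀ ≤ ∑ n ∈ I N, (f (d n) - f |(n : ℝ)|) := by
    have := Finset.single_le_sum (f := fun n : ℤ => f (d n) - f |(n : ℝ)|) (s := I N)
      (fun n _ => hdiff n) (a := (n₀ : ℤ)) (by rw [hI, Finset.mem_Icc]; omega)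
    simpa using this
  rw [Finset.sum_sub_distrib, ← sum_discEigenvalue] at s1
  have s2 : ∑ n ∈ I N, f (d n) ≤ ∑ n ∈ I N, (∑ k ∈ Finset.range (2 * N + 1),
      spectralWeight b n k * f (lam k) + T N n) := by
    refine Finset.sum_le_sum fun n hn => ?_
    refine (hb.le_tsum_spectralWeight hpos hf hd hdn h0 n).trans (le_of_eq ?_)
    rw [hT]
    simp only
    rw [if_pos (by rw [hI, Finset.mem_Icc] at hn; exact abs_le.2 hn)]
    exact ((hb.summable_spectralWeight_mul hpos hf n).sum_add_tsum_nat_add _).symm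
  have s3 : ∑ n ∈ I N, T N n = ∑' n, T N n := by
    refine (tsum_eq_sum fun n hn => ?_).symm
    rw [hT]
    simp only
    rw [if_neg]
    intro h
    exact hn (by rw [hI, Finset.mem_Icc]; exact abs_le.1 h)
  rw [Finset.sum_add_distrib, s3, Finset.sum_comm] at s2
  have s4 : ∑ k ∈ Finset.range (2 * N + 1), ∑ n ∈ I N, spectralWeight b n k * f (lam k)
      ≤ ∑ k ∈ Finset.range (2 * N + 1), f (lam k) + ∑ k ∈ Finset.range k₁,
        (1 - ∑ n ∈ I N, spectralWeight b n k) * |f (lam k)| := by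
    have hW1 : ∀ k, ∑ n ∈ I N, spectralWeight b n k ≤ 1 := fun k =>
      sum_le_hasSum _ (fun n _ => spectralWeight_nonneg b n k) (hasSum_spectralWeight_left b k)
    have hW0 : ∀ k, 0 ≤ ∑ n ∈ I N, spectralWeight b n k := fun k =>
      Finset.sum_nonneg fun n _ => spectralWeight_nonneg b n k
    rw [← Finset.sum_range_add_sum_Ico _ (show k₁ ≤ 2 * N + 1 by omega),
      ← Finset.sum_range_add_sum_Ico (fun k => f (lam k)) (show k₁ ≤ 2 * N + 1 by omega)]
    have t1 : ∑ k ∈ Finset.range k₁, ∑ n ∈ I N, spectralWeight b n k * f (lam k)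
        ≤ ∑ k ∈ Finset.range k₁, f (lam k) + ∑ k ∈ Finset.range k₁,
          (1 - ∑ n ∈ I N, spectralWeight b n k) * |f (lam k)| := by
      rw [← Finset.sum_add_distrib]
      refine Finset.sum_le_sum fun k _ => ?_
      rw [← Finset.sum_mul]
      have := mul_le_mul_of_nonneg_left (neg_abs_le (f (lam k))) (sub_nonneg.2 (hW1 k))
      linarith
    have t2 : ∑ k ∈ Finset.Ico k₁ (2 * N + 1), ∑ n ∈ I N, spectralWeight b n k * f (lam k)
        ≤ ∑ k ∈ Finset.Ico k₁ (2 * N + 1), f (lam k) := by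
      refine Finset.sum_le_sum fun k hk => ?_
      rw [← Finset.sum_mul]
      exact mul_le_of_le_one_left (hf.nonneg _ (hk₁ k (Finset.mem_Ico.1 hk).1)) (hW1 k)
    linarith
  rw [Finset.sum_sub_distrib]
  linarith

end Trace

end IsSmoothing
end

/-! ### The test functions `x^s`, `x^s log x` and the entire zeta difference -/

noncomputable section

open ComplexConjugate

theorem one_add_mul_sub_le_rpow {s x x₀ : ℝ} (hs : 1 ≤ s) (hx : 0 ≤ x) (hx₀ : 0 < x₀) :
    1 + s * (x / x₀ - 1) ≤ (x / x₀) ^ s := by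
  have h := one_add_mul_self_le_rpow_one_add (s := x / x₀ - 1) (p := s)
    (by have : 0 ≤ x / x₀ := by positivity
        linarith) hs
  rwa [add_sub_cancel] at h

theorem rpow_le_one_add_pow {s x : ℝ} {m : ℕ} (hs : 0 ≤ s) (hm : s ≤ m) (hx : 0 ≤ x) :
    x ^ s ≤ 1 + x ^ m := by
  rcases le_total x 1 with h | h
  · have := Real.rpow_le_one hx h hs
    have := pow_nonneg hx m
    linarith
  · have := Real.rpow_le_rpow_of_exponent_le h hm
    rw [Real.rpow_natCast] at this
    linarith

theorem traceFunction_rpow {s : ℝ} (hs : 1 ≤ s) :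
    IsSmoothing.TraceFunction (fun x => x ^ s) 1 ⌈s⌉₊ where
  growth x hx := by
    rw [abs_of_nonneg (Real.rpow_nonneg hx s), one_mul]
    refine rpow_le_one_add_pow (by linarith) ?_ hx
    push_cast
    linarith [Nat.le_ceil s]
  tangent x₀ hx₀ := by
    refine ⟨s * x₀ ^ (s - 1), fun x hx => ?_⟩
    have h0 : 0 < x₀ := by linarith
    have h1 := mul_le_mul_of_nonneg_left (one_add_mul_sub_le_rpow hs hx h0)
      (Real.rpow_nonneg h0.le s)
    rw [Real.div_rpow hx h0.le, mul_div_cancel₀ _ (Real.rpow_pos_of_pos h0 s).ne'] at h1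
    rw [Real.rpow_sub_one h0.ne']
    refine le_trans (le_of_eq ?_) h1
    field_simp
  zero := Real.zero_rpow (by linarith)
  nonneg x hx := Real.rpow_nonneg (by linarith) s
  mono x y hx hxy := Real.rpow_le_rpow (by linarith) hxy (by linarith)

theorem sub_one_le_rpow_mul_log {s y : ℝ} (hs : 1 ≤ s) (hy : 0 < y) :
    y - 1 ≤ y ^ s * Real.log y := by
  have h1 : y - 1 ≤ y * Real.log y := by
    have := Real.one_sub_inv_le_log_of_pos hy
    have := mul_le_mul_of_nonneg_left this hy.le
    rwa [mul_sub, mul_one, mul_inv_cancel₀ hy.ne'] at this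
  refine h1.trans ?_
  rcases le_total 1 y with h | h
  · refine mul_le_mul_of_nonneg_right ?_ (Real.log_nonneg h)
    simpa using Real.rpow_le_rpow_of_exponent_le h hs
  · refine mul_le_mul_of_nonpos_right ?_ (Real.log_nonpos hy.le h)
    simpa using Real.rpow_le_rpow_of_exponent_ge hy h hs

/-- The function need not be convex near `0`. With `y = x / x₀` it equals `x₀^s (log x₀ · y^s + y^s
log y)`; both summands lie above their tangents at `y = 1`, the first because `log x₀ ≥ 0`. -/
theorem traceFunction_rpow_mul_log {s : ℝ} (hs : 1 ≤ s) :
    IsSmoothing.TraceFunction (fun x => x ^ s * Real.log x) 1 ⌈s⌉₊ where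
  growth x hx := by
    rcases hx.eq_or_lt with rfl | hx
    · rw [Real.log_zero, mul_zero, abs_zero]; positivity
    rw [abs_mul, abs_of_nonneg (Real.rpow_nonneg hx.le s), one_mul]
    rcases le_total x 1 with h | h
    · have h1 := Real.abs_log_mul_self_lt x hx h
      have h2 : x ^ s ≤ x := by simpa using Real.rpow_le_rpow_of_exponent_ge hx h hs
      rw [abs_mul, abs_of_pos hx] at h1
      have h3 := mul_le_mul_of_nonneg_right h2 (abs_nonneg (Real.log x))
      have := pow_nonneg hx.le (2 * (⌈s⌉₊ + 1))
      linarith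
    · rw [abs_of_nonneg (Real.log_nonneg h)]
      have h1 : Real.log x ≤ x := (Real.log_le_sub_one_of_pos hx).trans (by linarith)
      have h2 := rpow_le_one_add_pow (s := s + 1) (m := 2 * (⌈s⌉₊ + 1)) (by linarith)
        (by push_cast; linarith [Nat.le_ceil s]) hx.le
      rw [Real.rpow_add_one hx.ne'] at h2
      exact (mul_le_mul_of_nonneg_left h1 (Real.rpow_nonneg hx.le s)).trans h2
  tangent x₀ hx₀ := by
    have h0 : 0 < x₀ := by linarith
    have hl := Real.log_nonneg hx₀
    refine ⟨x₀ ^ s / x₀ * (s * Real.log x₀ + 1), fun x hx => ?_⟩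
    have h1 := mul_le_mul_of_nonneg_left (one_add_mul_sub_le_rpow hs hx h0) hl
    have h2 : x / x₀ - 1 ≤ (x / x₀) ^ s * Real.log (x / x₀) := by
      rcases hx.eq_or_lt with rfl | hx
      · simp
      · exact sub_one_le_rpow_mul_log hs (by positivity)
    have h3 := mul_le_mul_of_nonneg_left (add_le_add h1 h2) (Real.rpow_nonneg h0.le s)
    have h4 : x₀ ^ s * (Real.log x₀ * (x / x₀) ^ s + (x / x₀) ^ s * Real.log (x / x₀))
        = x ^ s * Real.log x := by
      rcases hx.eq_or_lt with rfl | hx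
      · rw [zero_div, Real.zero_rpow (by linarith)]; ring
      · rw [Real.log_div hx.ne' h0.ne', Real.div_rpow hx.le h0.le]
        field_simp
        ring
    rw [h4] at h3
    refine le_trans (le_of_eq ?_) h3
    field_simp
    ring
  zero := by simp
  nonneg x hx := mul_nonneg (Real.rpow_nonneg (by linarith) s) (Real.log_nonneg hx)
  mono x y hx hxy := mul_le_mul (Real.rpow_le_rpow (by linarith) hxy (by linarith))
    (Real.log_le_log (by linarith) hxy) (Real.log_nonneg hx) (Real.rpow_nonneg (by linarith) s)

/-- Bernoulli's inequality gives `P^s - N^s ≥ s (P - N) N^(s-1)`, and `N^(s-1) ≥ e^(α (s-1))`. -/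
theorem exp_mul_le_rpow_sub {α s N P : ℝ} (hs : 1 ≤ s) (hN : Real.exp α ≤ N) (hP : N ≤ P) :
    (P - N) * Real.exp (-α) * Real.exp (α * s) ≤ P ^ s - N ^ s := by
  have hN0 : 0 < N := (Real.exp_pos α).trans_le hN
  have hP0 : 0 < P := hN0.trans_le hP
  have h1 := mul_le_mul_of_nonneg_left (one_add_mul_sub_le_rpow hs hP0.le hN0)
      (Real.rpow_nonneg hN0.le s)
  rw [Real.div_rpow hP0.le hN0.le, mul_div_cancel₀ _ (Real.rpow_pos_of_pos hN0 s).ne'] at h1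
  have h2 : N ^ s * (1 + s * (P / N - 1)) = N ^ s + s * (P - N) * N ^ (s - 1) := by
    rw [Real.rpow_sub_one hN0.ne']
    field_simp
  have h3 : Real.exp (-α) * Real.exp (α * s) ≤ N ^ (s - 1) := by
    rw [← Real.exp_add, show -α + α * s = α * (s - 1) by ring, Real.exp_mul]
    exact Real.rpow_le_rpow (Real.exp_pos α).le hN (by linarith)
  have h4 : (P - N) * (Real.exp (-α) * Real.exp (α * s)) ≤ (P - N) * N ^ (s - 1) :=
    mul_le_mul_of_nonneg_left h3 (by linarith)
  have h5 : 0 ≤ (s - 1) * ((P - N) * N ^ (s - 1)) :=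
    mul_nonneg (by linarith) (mul_nonneg (by linarith) (Real.rpow_nonneg hN0.le _))
  linarith

/-- The difference is at least `(P^s - N^s) log N`, and `N ≥ e` makes the logarithm at least `1`. -/
theorem exp_mul_le_rpow_mul_log_sub {α s N P : ℝ} (hs : 1 ≤ s) (hN : Real.exp α ≤ N)
    (hN1 : Real.exp 1 ≤ N) (hP : N ≤ P) :
    (P - N) * Real.exp (-α) * Real.exp (α * s) ≤ P ^ s * Real.log P - N ^ s * Real.log N := by
  have h1 := exp_mul_le_rpow_sub hs hN hP
  have hN0 : 0 < N := (Real.exp_pos α).trans_le hN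
  have hl : 1 ≤ Real.log N := (Real.le_log_iff_exp_le hN0).2 hN1
  have hlP : Real.log N ≤ Real.log P := Real.log_le_log hN0 hP
  have h2 := mul_le_mul_of_nonneg_left hlP (Real.rpow_nonneg (hN0.le.trans hP) s)
  have h3 : 0 ≤ P ^ s - N ^ s :=
    sub_nonneg.2 (Real.rpow_le_rpow hN0.le hP (by linarith))
  have h4 := mul_le_mul_of_nonneg_left hl h3
  linarith

/-- A positive list of numbers that is rapidly asymptotic to `0, 1, 1, 2, 2, …`. -/
structure IsDiscAsymptotic (lam : ℕ → ℝ) : Prop where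
  zero : lam 0 = 0
  pos : 0 < lam 1
  mono : Monotone lam
  decay : ∀ p : ℕ, ∃ C, 0 ≤ C ∧
    ∀ k, |lam k - discEigenvalue k| ≤ C / (1 + (discEigenvalue k : ℝ)) ^ p

/-- The difference between the zeta functions of `lam` and of `0, 1, 1, 2, 2, …`. -/
def zetaDifference (lam : ℕ → ℝ) (s : ℂ) : ℂ :=
  ∑' k : ℕ, ((lam (k + 1) : ℂ) ^ (-s) - ((discEigenvalue (k + 1) : ℝ) : ℂ) ^ (-s))

namespace IsDiscAsymptotic

variable {lam : ℕ → ℝ}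

theorem pos_succ (h : IsDiscAsymptotic lam) (k : ℕ) : 0 < lam (k + 1) :=
  h.pos.trans_le (h.mono (by omega))

theorem nonneg (h : IsDiscAsymptotic lam) (k : ℕ) : 0 ≤ lam k := by
  rw [← h.zero]; exact h.mono (Nat.zero_le k)

theorem discEigenvalue_pos (k : ℕ) : (1 : ℝ) ≤ discEigenvalue (k + 1) := by
  have : 1 ≤ discEigenvalue (k + 1) := by rw [discEigenvalue]; omega
  exact_mod_cast this

theorem exists_bounds (h : IsDiscAsymptotic lam) : ∃ B, 1 ≤ B ∧ ∀ k x,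
    x ∈ Set.uIcc (discEigenvalue (k + 1) : ℝ) (lam (k + 1)) →
      0 < x ∧ x ≤ B * (1 + discEigenvalue (k + 1)) ∧ x⁻¹ ≤ B * (1 + discEigenvalue (k + 1)) := by
  obtain ⟨C, hC, hCb⟩ := h.decay 0
  refine ⟨1 + C + (lam 1)⁻¹, by have := h.pos; have : 0 < (lam 1)⁻¹ := by positivity
                                linarith, fun k x hx => ?_⟩
  have h1 := discEigenvalue_pos k
  have hp := h.pos
  have hi : 0 < (lam 1)⁻¹ := by positivity
  have h2 : lam 1 ≤ lam (k + 1) := h.mono (by omega)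
  have h3 := (abs_le.1 (hCb (k + 1))).2
  rw [pow_zero, div_one] at h3
  set w := (discEigenvalue (k + 1) : ℝ)
  have hx1 : min 1 (lam 1) ≤ x := by
    have := hx.1
    exact (le_inf ((min_le_left _ _).trans h1) ((min_le_right _ _).trans h2)).trans this
  have hx2 : x ≤ w + C := hx.2.trans (sup_le (by linarith) (by linarith))
  have hx0 : 0 < x := (lt_min one_pos hp).trans_le hx1
  refine ⟨hx0, by nlinarith, ?_⟩
  have h4 : x⁻¹ ≤ 1 + (lam 1)⁻¹ := by
    rcases min_le_iff.1 hx1 with h5 | h5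
    · have := inv_le_one_of_one_le₀ h5
      linarith
    · have := inv_anti₀ hp h5
      linarith
  nlinarith

theorem rpow_le_pow {x q r : ℝ} {m : ℕ} (hx : 0 < x) (hq : x ≤ q) (hq' : x⁻¹ ≤ q) (hr : |r| ≤ m)
    (hq1 : 1 ≤ q) : x ^ r ≤ q ^ m := by
  have hq0 : 0 < q := by linarith
  rw [← Real.rpow_natCast]
  rcases le_total 0 r with h | h
  · rw [abs_of_nonneg h] at hr
    exact (Real.rpow_le_rpow hx.le hq h).trans (Real.rpow_le_rpow_of_exponent_le hq1 hr)
  · rw [abs_of_nonpos h] at hr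
    have : x ^ r = x⁻¹ ^ (-r) := by rw [Real.inv_rpow hx.le, Real.rpow_neg hx.le, inv_inv]
    rw [this]
    exact (Real.rpow_le_rpow (by positivity) hq' (by linarith)).trans
      (Real.rpow_le_rpow_of_exponent_le hq1 hr)

theorem summable_one_div_sq : Summable fun k : ℕ => 1 / (1 + (discEigenvalue (k + 1) : ℝ)) ^ 2 := by
  have h1 : Summable fun k : ℕ => 4 * (1 / ((k : ℝ) + 1) ^ 2) := by
    have := (summable_nat_add_iff 1).2 (Real.summable_one_div_nat_pow.2 one_lt_two)
    exact (this.congr fun k => by push_cast; rfl).mul_left 4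
  refine Summable.of_nonneg_of_le (fun k => by positivity) (fun k => ?_) h1
  have h2 : ((k : ℝ) + 1) / 2 ≤ 1 + discEigenvalue (k + 1) := by
    have : k + 1 ≤ 2 * (1 + discEigenvalue (k + 1)) := by rw [discEigenvalue]; omega
    have : (k : ℝ) + 1 ≤ 2 * (1 + discEigenvalue (k + 1)) := by exact_mod_cast this
    linarith
  calc 1 / (1 + (discEigenvalue (k + 1) : ℝ)) ^ 2 ≤ 1 / (((k : ℝ) + 1) / 2) ^ 2 := by gcongr
    _ = _ := by rw [div_pow, one_div_div]; ring

/-- Mean value inequality for `x ↦ x^(-s)`: between the two eigenvalues the derivative is at most `R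
(B w)^(R + 1)` with `w = 1 + discEigenvalue (k + 1)`. The eigenvalues differ by `C / w^(R + 3)`,
which leaves the summable `w^(-2)`, locally uniformly in `s`. -/
theorem exists_norm_sub_le (h : IsDiscAsymptotic lam) (R : ℕ) : ∃ C, ∀ s : ℂ, ‖s‖ ≤ R → ∀ k,
    ‖(lam (k + 1) : ℂ) ^ (-s) - ((discEigenvalue (k + 1) : ℝ) : ℂ) ^ (-s)‖
      ≤ C * (1 / (1 + (discEigenvalue (k + 1) : ℝ)) ^ 2) := by
  obtain ⟨B, hB, hBb⟩ := h.exists_bounds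
  obtain ⟨C, hC, hCb⟩ := h.decay (R + 3)
  refine ⟨R * B ^ (R + 1) * C, fun s hs k => ?_⟩
  have hd := discEigenvalue_pos k
  have hlk := hCb (k + 1)
  set w := 1 + (discEigenvalue (k + 1) : ℝ) with hw
  have hw1 : 1 ≤ w := by linarith
  have key := (convex_uIcc (discEigenvalue (k + 1) : ℝ) (lam (k + 1))).norm_image_sub_le_of_norm_hasDerivWithin_le
    (f := fun x : ℝ => (x : ℂ) ^ (-s)) (f' := fun x : ℝ => -s * (x : ℂ) ^ (-s - 1))
    (C := R * (B * w) ^ (R + 1)) ?_ ?_ Set.left_mem_uIcc Set.right_mem_uIcc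
  · refine key.trans ?_
    rw [Real.norm_eq_abs]
    calc _ ≤ R * (B * w) ^ (R + 1) * (C / w ^ (R + 3)) := by gcongr
      _ = _ := by rw [mul_pow]; field_simp; ring
  · intro x hx
    obtain ⟨hx0, -, -⟩ := hBb k x hx
    rcases eq_or_ne s 0 with rfl | hs0
    · simp only [neg_zero, Complex.cpow_zero, zero_mul]
      exact hasDerivWithinAt_const _ _ _
    · exact (hasDerivAt_ofReal_cpow_const hx0.ne' (neg_ne_zero.2 hs0)).hasDerivWithinAt
  · intro x hx
    obtain ⟨hx0, hx1, hx2⟩ := hBb k x hx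
    rw [norm_mul, norm_neg, Complex.norm_cpow_eq_rpow_re_of_pos hx0]
    refine mul_le_mul hs (rpow_le_pow hx0 hx1 hx2 ?_ (by nlinarith)) (by positivity) (by positivity)
    have := Complex.abs_re_le_norm s
    simp only [Complex.sub_re, Complex.neg_re, Complex.one_re]
    push_cast
    rw [abs_le] at this ⊢
    constructor <;> linarith

theorem hasSum_zetaDifference (h : IsDiscAsymptotic lam) (s : ℂ) :
    HasSum (fun k : ℕ => (lam (k + 1) : ℂ) ^ (-s) - ((discEigenvalue (k + 1) : ℝ) : ℂ) ^ (-s))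
      (zetaDifference lam s) := by
  obtain ⟨C, hC⟩ := h.exists_norm_sub_le ⌈‖s‖⌉₊
  exact (Summable.of_norm_bounded (summable_one_div_sq.mul_left C)
    (hC s (Nat.le_ceil _))).hasSum

theorem hasDerivAt_term {x : ℝ} (hx : 0 < x) (s : ℂ) :
    HasDerivAt (fun s : ℂ => (x : ℂ) ^ (-s)) (-((x : ℂ) ^ (-s) * Real.log x)) s := by
  have h1 := (hasDerivAt_neg s).const_cpow (c := (x : ℂ)) (Or.inl (by exact_mod_cast hx.ne'))
  rw [← Complex.ofReal_log hx.le] at h1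
  simpa using h1

theorem hasDerivAt_sub_term (h : IsDiscAsymptotic lam) (k : ℕ) (s : ℂ) :
    HasDerivAt (fun s : ℂ => (lam (k + 1) : ℂ) ^ (-s) - ((discEigenvalue (k + 1) : ℝ) : ℂ) ^ (-s))
      (-((lam (k + 1) : ℂ) ^ (-s) * Real.log (lam (k + 1))
        - ((discEigenvalue (k + 1) : ℝ) : ℂ) ^ (-s) * Real.log (discEigenvalue (k + 1)))) s := by
  have h1 := (hasDerivAt_term (h.pos_succ k) s).fun_sub
    (hasDerivAt_term (x := discEigenvalue (k + 1)) (one_pos.trans_le (discEigenvalue_pos k)) s)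
  convert! h1 using 1
  ring

theorem differentiable_zetaDifference (h : IsDiscAsymptotic lam) :
    Differentiable ℂ (zetaDifference lam) := by
  intro s
  obtain ⟨C, hC⟩ := h.exists_norm_sub_le ⌈‖s‖ + 1⌉₊
  have h1 : DifferentiableOn ℂ (zetaDifference lam) (Metric.ball 0 (‖s‖ + 1)) :=
    Complex.differentiableOn_tsum_of_summable_norm (summable_one_div_sq.mul_left C)
      (fun k z _ => (h.hasDerivAt_sub_term k z).differentiableAt.differentiableWithinAt)
      Metric.isOpen_ball
      (fun k z hz => hC z ((mem_ball_zero_iff.1 hz).le.trans (Nat.le_ceil _)) k)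
  exact h1.differentiableAt (Metric.isOpen_ball.mem_nhds (by simp))

theorem hasSum_deriv_zetaDifference (h : IsDiscAsymptotic lam) (s : ℂ) :
    HasSum (fun k : ℕ => -((lam (k + 1) : ℂ) ^ (-s) * Real.log (lam (k + 1))
        - ((discEigenvalue (k + 1) : ℝ) : ℂ) ^ (-s) * Real.log (discEigenvalue (k + 1))))
      (deriv (zetaDifference lam) s) := by
  obtain ⟨C, hC⟩ := h.exists_norm_sub_le ⌈‖s‖ + 1⌉₊
  have h1 := Complex.hasSum_deriv_of_summable_norm (U := Metric.ball 0 (‖s‖ + 1)) (z := s)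
      (summable_one_div_sq.mul_left C)
      (fun k z _ => (h.hasDerivAt_sub_term k z).differentiableAt.differentiableWithinAt)
      Metric.isOpen_ball
      (fun k z hz => hC z ((mem_ball_zero_iff.1 hz).le.trans (Nat.le_ceil _)) k) (by simp)
  simp only [(h.hasDerivAt_sub_term _ s).deriv] at h1
  exact h1

/-- The index `0`, absent from the zeta functions, may be added because `0^s = 0` for `s ≥ 1`. -/
theorem exists_hasSum_rpow_sub (h : IsDiscAsymptotic lam) {s : ℝ} (hs : 1 ≤ s) :
    ∃ v : ℝ, zetaDifference lam (-(s : ℂ)) = v ∧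
      HasSum (fun k => lam k ^ s - (discEigenvalue k : ℝ) ^ s) v := by
  have h1 := h.hasSum_zetaDifference (-(s : ℂ))
  have e : (fun k : ℕ => (lam (k + 1) : ℂ) ^ (-(-(s : ℂ)))
      - ((discEigenvalue (k + 1) : ℝ) : ℂ) ^ (-(-(s : ℂ))))
      = fun k => ((lam (k + 1) ^ s - (discEigenvalue (k + 1) : ℝ) ^ s : ℝ) : ℂ) := by
    funext k
    rw [neg_neg, Complex.ofReal_sub, Complex.ofReal_cpow (h.nonneg _),
      Complex.ofReal_cpow (Nat.cast_nonneg _)]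
  rw [e] at h1
  have h2 := (Complex.hasSum_re h1).summable
  simp only [Complex.ofReal_re] at h2
  refine ⟨_, h1.unique (Complex.hasSum_ofReal.2 h2.hasSum), ?_⟩
  have h3 := (hasSum_nat_add_iff (f := fun k => lam k ^ s - (discEigenvalue k : ℝ) ^ s) 1).1 h2.hasSum
  simpa [h.zero, discEigenvalue, Real.zero_rpow (show s ≠ 0 by linarith)] using h3

theorem exists_hasSum_rpow_mul_log_sub (h : IsDiscAsymptotic lam) (s : ℝ) :
    ∃ v : ℝ, HasDerivAt (fun s : ℝ => zetaDifference lam (-(s : ℂ))) v s ∧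
      HasSum (fun k => lam k ^ s * Real.log (lam k)
        - (discEigenvalue k : ℝ) ^ s * Real.log (discEigenvalue k)) v := by
  have h1 := (h.hasSum_deriv_zetaDifference (-(s : ℂ))).neg
  have e : (fun k : ℕ => -(-((lam (k + 1) : ℂ) ^ (-(-(s : ℂ))) * Real.log (lam (k + 1))
      - ((discEigenvalue (k + 1) : ℝ) : ℂ) ^ (-(-(s : ℂ))) * Real.log (discEigenvalue (k + 1)))))
      = fun k => ((lam (k + 1) ^ s * Real.log (lam (k + 1))
        - (discEigenvalue (k + 1) : ℝ) ^ s * Real.log (discEigenvalue (k + 1)) : ℝ) : ℂ) := by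
    funext k
    rw [neg_neg, neg_neg, Complex.ofReal_sub, Complex.ofReal_mul, Complex.ofReal_mul,
      Complex.ofReal_cpow (h.nonneg _), Complex.ofReal_cpow (Nat.cast_nonneg _)]
  rw [e] at h1
  have h2 := (Complex.hasSum_re h1).summable
  simp only [Complex.ofReal_re] at h2
  have h3 := (hasSum_nat_add_iff (f := fun k => lam k ^ s * Real.log (lam k)
        - (discEigenvalue k : ℝ) ^ s * Real.log (discEigenvalue k)) 1).1 h2.hasSum
  have h4 := (h.differentiable_zetaDifference (-(s : ℂ))).hasDerivAt
  have h5 : HasDerivAt (fun s : ℂ => zetaDifference lam (-s))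
      (-deriv (zetaDifference lam) (-(s : ℂ))) (s : ℂ) := by
    simpa [Function.comp_def] using h4.scomp (s : ℂ) (hasDerivAt_neg (s : ℂ))
  rw [h1.unique (Complex.hasSum_ofReal.2 h2.hasSum)] at h5
  refine ⟨_, h5.comp_ofReal, ?_⟩
  -- The added term at index `0` vanishes by the convention `Real.log 0 = 0`.
  simpa [h.zero, discEigenvalue] using h3

theorem hasSum_discEigenvalue_cpow {s : ℂ} (hs : 1 < s.re) :
    HasSum (fun k : ℕ => ((discEigenvalue (k + 1) : ℝ) : ℂ) ^ (-s)) (2 * riemannZeta s) := by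
  have h1 : Summable fun n : ℕ => 1 / ((n : ℂ) + 1) ^ s := by
    have := (summable_nat_add_iff 1).2 (Complex.summable_one_div_nat_cpow.2 hs)
    exact this.congr fun n => by push_cast; rfl
  have h2 := h1.hasSum
  rw [← zeta_eq_tsum_one_div_nat_add_one_cpow hs] at h2
  rw [two_mul]
  refine HasSum.even_add_odd ?_ ?_
  · convert! h2 using 1
    funext n
    have : discEigenvalue (2 * n + 1) = n + 1 := by rw [discEigenvalue]; omega
    rw [this, Complex.cpow_neg, one_div]
    push_cast; rfl
  · convert! h2 using 1
    funext n
    have : discEigenvalue (2 * n + 1 + 1) = n + 1 := by rw [discEigenvalue]; omega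
    rw [this, Complex.cpow_neg, one_div]
    push_cast; rfl

theorem hasSum_cpow (h : IsDiscAsymptotic lam) {s : ℂ} (hs : 1 < s.re) :
    HasSum (fun k : ℕ => (lam (k + 1) : ℂ) ^ (-s)) (2 * riemannZeta s + zetaDifference lam s) := by
  have := (hasSum_discEigenvalue_cpow hs).add (h.hasSum_zetaDifference s)
  simpa using this

end IsDiscAsymptotic
end

/-! ### Meromorphic continuation of the zeta function -/

noncomputable section

open ComplexConjugate

/-- The zeta function of `lam / ℓ`. -/
def rescaledZeta (lam : ℕ → ℝ) (l : ℝ) (s : ℂ) : ℂ :=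
  (l : ℂ) ^ s * (2 * riemannZeta s + zetaDifference lam s)

namespace IsDiscAsymptotic

variable {lam : ℕ → ℝ} {l : ℝ}

theorem hasSum_rescaledZeta (h : IsDiscAsymptotic lam) (hl : 0 < l) {s : ℂ} (hs : 1 < s.re) :
    HasSum (fun k : ℕ => ((lam (k + 1) / l : ℝ) : ℂ) ^ (-s)) (rescaledZeta lam l s) := by
  have h1 := (h.hasSum_cpow hs).mul_left ((l : ℂ) ^ s)
  convert! h1 using 1
  funext k
  have h2 := h.pos_succ k
  have : (lam (k + 1) : ℂ) ^ (-s) = (l : ℂ) ^ (-s) * ((lam (k + 1) / l : ℝ) : ℂ) ^ (-s) := by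
    rw [← Complex.mul_cpow_ofReal_nonneg hl.le (by positivity), ← Complex.ofReal_mul,
      mul_div_cancel₀ _ hl.ne']
  rw [this, ← mul_assoc, ← Complex.cpow_add _ _ (by exact_mod_cast hl.ne'), add_neg_cancel,
    Complex.cpow_zero, one_mul]

theorem differentiableOn_rescaledZeta (h : IsDiscAsymptotic lam) (hl : 0 < l) :
    DifferentiableOn ℂ (rescaledZeta lam l) {1}ᶜ := by
  intro s hs
  have h1 : DifferentiableAt ℂ (fun s : ℂ => (l : ℂ) ^ s) s :=
    differentiableAt_id.const_cpow (Or.inl (by exact_mod_cast hl.ne'))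
  exact (h1.mul (((differentiableAt_riemannZeta hs).const_mul 2).add
    (h.differentiable_zetaDifference s))).differentiableWithinAt

/-- The zeta difference is entire, so the pole is that of `2 l^s ζ_R(s)`, with residue `2 l ≠ 0`;
this is the value that fills the removable singularity of `(s - 1)` times the function. -/
theorem meromorphicOrderAt_rescaledZeta (h : IsDiscAsymptotic lam) (hl : 0 < l) :
    meromorphicOrderAt (rescaledZeta lam l) 1 = -1 := by
  set G : ℂ → ℂ := Function.update (fun s => (s - 1) * rescaledZeta lam l s) 1 (2 * l) with hG
  have hlim : Filter.Tendsto (fun s => (s - 1) * rescaledZeta lam l s) (nhdsWithin 1 {1}ᶜ)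
      (nhds (2 * l)) := by
    have h1 : Filter.Tendsto (fun s : ℂ => (l : ℂ) ^ s) (nhdsWithin 1 {1}ᶜ) (nhds ((l : ℂ) ^ (1 : ℂ))) :=
      ((differentiableAt_id.const_cpow (Or.inl (by exact_mod_cast hl.ne'))
        : DifferentiableAt ℂ (fun s : ℂ => (l : ℂ) ^ s) 1).continuousAt.tendsto).mono_left
        nhdsWithin_le_nhds
    have h2 := ((h.differentiable_zetaDifference 1).continuousAt.tendsto).mono_left
        (nhdsWithin_le_nhds (s := {1}ᶜ))
    have h3 : Filter.Tendsto (fun s : ℂ => s - 1) (nhdsWithin 1 {1}ᶜ) (nhds (1 - 1)) :=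
      (((continuous_id.sub continuous_const).tendsto (1 : ℂ))).mono_left nhdsWithin_le_nhds
    have h4 := h1.mul ((riemannZeta_residue_one.const_mul 2).add (h3.mul h2))
    rw [Complex.cpow_one, sub_self, zero_mul, add_zero, mul_one, mul_comm] at h4
    refine h4.congr fun s => ?_
    rw [rescaledZeta]
    ring
  have hana : AnalyticAt ℂ G 1 := by
    refine Complex.analyticAt_of_differentiable_on_punctured_nhds_of_continuousAt ?_ ?_
    · filter_upwards [self_mem_nhdsWithin] with s hs
      have h1 := (h.differentiableOn_rescaledZeta hl).differentiableAt
        (isOpen_compl_singleton.mem_nhds hs)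
      have h2 : DifferentiableAt ℂ (fun s => (s - 1) * rescaledZeta lam l s) s :=
        (differentiableAt_id.sub_const 1).mul h1
      refine h2.congr_of_eventuallyEq ?_
      filter_upwards [isOpen_compl_singleton.mem_nhds hs] with z hz
      rw [hG, Function.update_of_ne hz]
    · rw [hG, continuousAt_update_same]
      exact hlim
  have heq : ∀ᶠ s in nhdsWithin (1 : ℂ) {1}ᶜ, rescaledZeta lam l s = (s - 1) ^ (-1 : ℤ) • G s := by
    filter_upwards [self_mem_nhdsWithin] with s hs
    have : s - 1 ≠ 0 := sub_ne_zero.2 hs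
    rw [hG, Function.update_of_ne hs, smul_eq_mul, zpow_neg_one, inv_mul_cancel_left₀ this]
  have hmer : MeromorphicAt (rescaledZeta lam l) 1 := by
    have h1 : MeromorphicAt (fun s : ℂ => (s - 1) ^ (-1 : ℤ) • G s) 1 := by
      have h2 : MeromorphicAt (fun s : ℂ => s - 1) 1 :=
        (analyticAt_id.sub analyticAt_const).meromorphicAt
      exact (h2.zpow (-1)).smul hana.meromorphicAt
    exact h1.congr (heq.mono fun s hs => hs.symm)
  rw [show (-1 : WithTop ℤ) = ((-1 : ℤ) : WithTop ℤ) from rfl, meromorphicOrderAt_eq_int_iff hmer]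
  refine ⟨G, hana, ?_, heq⟩
  rw [hG, Function.update_self]
  have : (l : ℂ) ≠ 0 := by exact_mod_cast hl.ne'
  simpa using this

/-- Identity theorem on the connected set `{1}ᶜ`; both functions are the same Dirichlet series near
`2`. -/
theorem eq_rescaledZeta (h : IsDiscAsymptotic lam) (hl : 0 < l) {Z : ℂ → ℂ}
    (hZ : ∀ s : ℂ, 1 < s.re → HasSum (fun k : ℕ => ((lam (k + 1) / l : ℝ) : ℂ) ^ (-s)) (Z s))
    (hd : DifferentiableOn ℂ Z {1}ᶜ) {s : ℂ} (hs : s ≠ 1) : Z s = rescaledZeta lam l s := by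
  have h1 := hd.analyticOnNhd isOpen_compl_singleton
  have h2 := (h.differentiableOn_rescaledZeta hl).analyticOnNhd isOpen_compl_singleton
  refine h1.eqOn_of_preconnected_of_eventuallyEq h2 (z₀ := 2) ?_ (by simp) ?_ hs
  · exact (isConnected_compl_singleton_of_one_lt_rank (by simp) 1).isPreconnected
  · have : {s : ℂ | 1 < s.re} ∈ nhds (2 : ℂ) :=
      (isOpen_lt continuous_const Complex.continuous_re).mem_nhds (by simp)
    filter_upwards [this] with s hs
    exact (hZ s hs).unique (h.hasSum_rescaledZeta hl hs)

/-- The factors `l^s` and `l^(-s)` cancel and so do the Riemann zeta terms. At `s = -1` the argument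
would be the pole. -/
theorem zetaExcess_eq {a : Circle → ℝ} (hl : l = steklovLength a / (2 * Real.pi))
    (hl0 : 0 < l) {Z : ℂ → ℂ} (hZ : ∀ s : ℂ, s ≠ 1 → Z s = rescaledZeta lam l s) {s : ℝ}
    (hs : s ≠ -1) : zetaExcess a Z s = zetaDifference lam (-(s : ℂ)) := by
  have hs' : -(s : ℂ) ≠ 1 := by
    intro h; apply hs
    have : ((-s : ℝ) : ℂ) = (1 : ℝ) := by push_cast; exact h
    have := Complex.ofReal_injective this
    linarith
  rw [zetaExcess, ← hl, hZ _ hs', rescaledZeta, ← mul_assoc,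
    ← Complex.cpow_add _ _ (by exact_mod_cast hl0.ne'), add_neg_cancel, Complex.cpow_zero]
  ring

end IsDiscAsymptotic
end

/-! ### The Steklov equation as a matrix equation -/

noncomputable section

open ComplexConjugate

/-- The function on the circle with given Fourier coefficients. -/
def circleSeries (c : ℤ → ℂ) (z : Circle) : ℂ := ∑' n : ℤ, c n * (z : ℂ) ^ n

theorem hasSum_circleSeries {c : ℤ → ℂ} (hc : Summable c) (z : Circle) :
    HasSum (fun n : ℤ => c n * (z : ℂ) ^ n) (circleSeries c z) := by
  refine Summable.hasSum (Summable.of_norm ?_)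
  refine hc.norm.congr fun n => ?_
  rw [norm_mul, norm_circle_zpow, mul_one]

theorem circleCoeff_circle_zpow (m n : ℤ) :
    circleCoeff (fun z => (z : ℂ) ^ m) n = if m = n then 1 else 0 := by
  rw [circleCoeff_eq_circleMean]
  simp only [← zpow_add₀ (Circle.coe_ne_zero _), CircleDensity.circleMean_zpow, ← sub_eq_add_neg,
    sub_eq_zero]

theorem circleCoeff_circleSeries {c : ℤ → ℂ} (hc : Summable c) (n : ℤ) :
    circleCoeff (circleSeries c) n = c n := by
  have h := intervalIntegral.hasSum_integral_of_dominated_convergence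
    (μ := MeasureTheory.volume) (a := -Real.pi) (b := Real.pi)
    (F := fun (m : ℤ) (θ : ℝ) => c m * ((Circle.exp θ : Circle) : ℂ) ^ m
      * Complex.exp (-(n * θ * Complex.I)))
    (f := fun θ => circleSeries c (Circle.exp θ) * Complex.exp (-(n * θ * Complex.I)))
    (fun m _ => ‖c m‖) (fun m => ?_) (fun m => ?_) ?_ ?_ ?_
  · have h1 := h.mul_left (1 / (2 * Real.pi) : ℂ)
    have h2 : (fun m : ℤ => (1 / (2 * Real.pi) : ℂ) * ∫ θ in (-Real.pi)..Real.pi,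
        c m * ((Circle.exp θ : Circle) : ℂ) ^ m * Complex.exp (-(n * θ * Complex.I)))
        = fun m => if m = n then c n else 0 := by
      funext m
      have := circleCoeff_const_mul (c m) (fun z => (z : ℂ) ^ m) n
      rw [circleCoeff, circleCoeff_circle_zpow] at this
      rw [this]
      split_ifs with h
      · rw [h, mul_one]
      · rw [mul_zero]
    rw [h2] at h1
    exact h1.unique (hasSum_ite_eq n (c n))
  · have : Continuous fun θ : ℝ => c m * ((Circle.exp θ : Circle) : ℂ) ^ m
        * Complex.exp (-(n * θ * Complex.I)) := by
      have h1 := (continuous_circle_zpow m).comp Circle.exp.continuous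
      exact (continuous_const.mul h1).mul (by fun_prop)
    exact this.aestronglyMeasurable
  · refine Filter.Eventually.of_forall fun θ _ => le_of_eq ?_
    have : Complex.exp (-(n * θ * Complex.I)) = ((Circle.exp θ : Circle) : ℂ) ^ (-n) := by
      rw [Circle.coe_exp_zpow]; push_cast; congr 1; ring
    rw [this, norm_mul, norm_mul, norm_circle_zpow, norm_circle_zpow, mul_one, mul_one]
  · exact Filter.Eventually.of_forall fun θ _ => hc.norm
  · exact intervalIntegrable_const
  · exact Filter.Eventually.of_forall fun θ _ => (hasSum_circleSeries hc _).mul_right _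

theorem isSmoothOnCircle_circleSeries {c : ℤ → ℂ}
    (hc : ∀ p : ℕ, Summable fun n : ℤ => |(n : ℝ)| ^ p * ‖c n‖) :
    IsSmoothOnCircle (circleSeries c) := by
  have hiter : ∀ (a : ℂ) (k : ℕ), iteratedDeriv k (fun θ : ℝ => Complex.exp (a * θ))
      = fun θ : ℝ => a ^ k * Complex.exp (a * θ) := by
    intro a k
    induction k with
    | zero => simp
    | succ k ih =>
      rw [iteratedDeriv_succ, ih]
      funext θ
      have h1 : HasDerivAt (fun θ : ℝ => a * (θ : ℂ)) a θ := by
        simpa using (hasDerivAt_id θ).ofReal_comp.const_mul a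
      rw [(h1.cexp.const_mul (a ^ k)).deriv]
      ring
  have key : ∀ (n : ℤ) (θ : ℝ), ((Circle.exp θ : Circle) : ℂ) ^ n
      = Complex.exp ((n * Complex.I) * θ) := by
    intro n θ
    rw [Circle.coe_exp_zpow]
    congr 1; ring
  unfold IsSmoothOnCircle circleSeries
  refine contDiff_tsum (v := fun k (n : ℤ) => |(n : ℝ)| ^ k * ‖c n‖) ?_ ?_ ?_
  · intro n
    simp only [key]
    have : ContDiff ℝ ((⊤ : ℕ∞) : WithTop ℕ∞) fun θ : ℝ => (n * Complex.I) * (θ : ℂ) :=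
      contDiff_const.mul Complex.ofRealCLM.contDiff
    exact contDiff_const.mul this.cexp
  · intro k _
    exact hc k
  · intro k n θ _
    simp only [key]
    rw [norm_iteratedFDeriv_eq_norm_iteratedDeriv, iteratedDeriv_const_mul_field, hiter]
    have hx : ‖Complex.exp ((n * Complex.I) * θ)‖ = 1 := by
      rw [← key, norm_circle_zpow]
    rw [norm_mul, norm_mul, hx, norm_pow, norm_mul, Complex.norm_I, mul_one,
      Complex.norm_intCast, mul_one, mul_comm]

theorem circleCoeff_dnFun {u : Circle → ℂ} (hu : IsSmoothOnCircle u) (n : ℤ) :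
    circleCoeff (dnFun u) n = ((|(n : ℝ)| : ℝ) : ℂ) * circleCoeff u n := by
  have hs : Summable fun n : ℤ => ((|n| : ℤ) : ℂ) * circleCoeff u n := by
    refine Summable.of_norm ((summable_circleCoeff hu 1).congr fun n => ?_)
    rw [norm_mul, pow_one]
    simp
  have := circleCoeff_circleSeries hs n
  rw [← Int.cast_abs, Complex.ofReal_intCast]
  exact this

theorem hasSum_dnFun_mul_conj {u v : Circle → ℂ} (hu : IsSmoothOnCircle u) (hv : Continuous v) :
    HasSum (fun n : ℤ => ((|(n : ℝ)| : ℝ) : ℂ) * circleCoeff u n * conj (circleCoeff v n))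
      (circleMean fun z => dnFun u z * conj (v z)) := by
  have := hasSum_circleCoeff_mul_conj (dnFun_smooth hu).continuous hv
  simpa only [circleCoeff_dnFun hu] using this

theorem circleMean_dnFun_symm {u v : Circle → ℂ} (hu : IsSmoothOnCircle u)
    (hv : IsSmoothOnCircle v) : (circleMean fun z => dnFun u z * conj (v z))
      = circleMean fun z => u z * conj (dnFun v z) := by
  have h1 := hasSum_dnFun_mul_conj hu hv.continuous
  have h2 := hasSum_circleCoeff_mul_conj hu.continuous (dnFun_smooth hv).continuous
  refine h1.unique ?_
  convert! h2 using 1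
  funext n
  rw [circleCoeff_dnFun hv, map_mul, Complex.conj_ofReal]
  ring

namespace CircleDensity

variable (D : CircleDensity)

theorem τ_ne_zero (z : Circle) : (D.τ z : ℂ) ≠ 0 := by exact_mod_cast (D.pos z).ne'

/-- Substitution by `e`, whose Jacobian `τ` cancels the denominator: pairings with powers of `e` are
ordinary Fourier coefficients in the coordinate `T`. -/
theorem circleCoeff_div_τ {g : Circle → ℂ} (hg : Continuous g) (n : ℤ) :
    circleCoeff (fun z => g (D.σ z) / D.τ (D.σ z)) n
      = circleMean fun z => g z * conj ((D.e z : ℂ) ^ n) := by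
  have hc : Continuous fun z => g (D.σ z) / D.τ (D.σ z) * (z : ℂ) ^ (-n) :=
    (((hg.comp D.continuous_σ).div (D.continuous_τ.comp D.continuous_σ)
      fun z => D.τ_ne_zero _)).mul (continuous_circle_zpow _)
  rw [circleCoeff_eq_circleMean, ← D.circleMean_comp_e hc]
  congr 1
  funext z
  rw [σ_e, Circle.conj_coe_zpow, ← mul_assoc, mul_div_cancel₀ _ (D.τ_ne_zero z)]

theorem circleCoeff_comp_σ {w : Circle → ℂ} (hw : Continuous w) (n : ℤ) :
    circleCoeff (fun z => w (D.σ z)) n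
      = circleMean fun z => D.τ z * w z * conj ((D.e z : ℂ) ^ n) := by
  rw [← D.circleCoeff_div_τ (D.continuous_τ.fun_mul hw)]
  congr 1
  funext z
  rw [mul_div_cancel_left₀ _ (D.τ_ne_zero _)]

theorem circleMean_dnFun_e (n m : ℤ) :
    (circleMean fun z => dnFun (fun z => (D.e z : ℂ) ^ m) z * conj ((D.e z : ℂ) ^ n)) = D.P n m :=
  ((hasSum_dnFun_mul_conj (D.smooth_e_zpow m) (D.continuous_e_zpow n)).tsum_eq).symm

/-- Self-adjointness puts `Λ` on the power of `e`. Parseval for `w ∘ σ` and `(Λ e^n / τ) ∘ σ` then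
yields row `n` of the matrix, without interchanging a double series. -/
theorem hasSum_P_mul {w : Circle → ℂ} (hw : IsSmoothOnCircle w) (n : ℤ) :
    HasSum (fun m => D.P n m * circleCoeff (fun z => w (D.σ z)) m)
      (circleMean fun z => dnFun w z * conj ((D.e z : ℂ) ^ n)) := by
  rw [circleMean_dnFun_symm hw (D.smooth_e_zpow n)]
  set g := dnFun (fun z => (D.e z : ℂ) ^ n) with hg
  have hgc : Continuous g := (dnFun_smooth (D.smooth_e_zpow n)).continuous
  have hc1 : Continuous fun z => w (D.σ z) := hw.continuous.comp D.continuous_σ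
  have hc2 : Continuous fun z => g (D.σ z) / D.τ (D.σ z) :=
    (hgc.comp D.continuous_σ).div (D.continuous_τ.comp D.continuous_σ) fun z => D.τ_ne_zero _
  have h := hasSum_circleCoeff_mul_conj hc1 hc2
  have hW : Continuous fun z => w (D.σ z) * conj (g (D.σ z) / D.τ (D.σ z)) :=
    hc1.mul (Complex.continuous_conj.comp hc2)
  rw [← D.circleMean_comp_e hW] at h
  convert! h using 1
  · funext m
    rw [D.circleCoeff_div_τ hgc, hg, D.circleMean_dnFun_e, ← D.P_herm]
    exact mul_comm _ _
  · congr 1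
    funext z
    simp only [σ_e, map_div₀, Complex.conj_ofReal]
    have := D.τ_ne_zero z
    field_simp

/-- The coefficients of a function in the coordinate `T`. -/
def toEllTwo (w : Circle → ℂ) (hw : Continuous w) : EllTwo :=
  ⟨circleCoeff fun z => w (D.σ z), by
    refine memℓp_gen ?_
    simpa using summable_norm_circleCoeff_sq
      (u := fun z => w (D.σ z)) (hw.comp D.continuous_σ)⟩

theorem toEllTwo_apply (w : Circle → ℂ) (hw : Continuous w) (n : ℤ) :
    D.toEllTwo w hw n = circleCoeff (fun z => w (D.σ z)) n := rfl

theorem circleMean_dnFun_eq {w : Circle → ℂ} (hw : IsSmoothOnCircle w) (n : ℤ) :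
    (circleMean fun z => dnFun w z * conj ((D.e z : ℂ) ^ n))
      = ((|(n : ℝ)| : ℝ) : ℂ) * D.toEllTwo w hw.continuous n
        + D.isSmoothing_K.op (D.toEllTwo w hw.continuous) n := by
  refine (D.hasSum_P_mul hw n).unique ?_
  have h1 := (D.isSmoothing_K.summable_mul
    (fun m => EllTwo.norm_apply_le (D.toEllTwo w hw.continuous) m) n).hasSum
  have h2 := (hasSum_ite_eq n (((|(n : ℝ)| : ℝ) : ℂ) * D.toEllTwo w hw.continuous n)).add h1
  rw [← IsSmoothing.op_apply D.isSmoothing_K] at h2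
  convert! h2 using 1
  funext m
  rw [K, toEllTwo_apply, toEllTwo_apply]
  rcases eq_or_ne m n with rfl | h
  · simp; ring
  · rw [if_neg h, if_neg h.symm]; ring

/-- Forward, the equation is paired with the powers of `e`. Backward, these pairings are the Fourier
coefficients of the defect divided by `τ`, composed with `σ`, and a continuous function with
vanishing coefficients is zero. -/
theorem dnFun_eq_iff {w : Circle → ℂ} (hw : IsSmoothOnCircle w) (ν : ℂ) :
    (∀ z, dnFun w z = ν * (D.τ z * w z)) ↔
      ∀ n : ℤ, ((|(n : ℝ)| : ℝ) : ℂ) * D.toEllTwo w hw.continuous n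
        + D.isSmoothing_K.op (D.toEllTwo w hw.continuous) n = ν * D.toEllTwo w hw.continuous n := by
  constructor
  · intro h n
    rw [← D.circleMean_dnFun_eq hw, toEllTwo_apply, D.circleCoeff_comp_σ hw.continuous,
      ← circleMean_mul_left]
    congr 1
    funext z
    rw [h]; ring
  · intro h
    set g := fun z => dnFun w z - ν * (D.τ z * w z) with hg
    have hgc1 : Continuous (dnFun w) := (dnFun_smooth hw).continuous
    have hgc2 : Continuous fun z => ν * (D.τ z * w z) :=
      continuous_const.fun_mul (D.continuous_τ.fun_mul hw.continuous)
    have hgc : Continuous g := hgc1.sub hgc2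
    have hgσ : Continuous fun z => g (D.σ z) / D.τ (D.σ z) :=
      (hgc.comp D.continuous_σ).div (D.continuous_τ.comp D.continuous_σ) fun z => D.τ_ne_zero _
    have h0 : ∀ n, circleCoeff (fun z => g (D.σ z) / D.τ (D.σ z)) n = 0 := by
      intro n
      have h1 : (fun z => g (D.σ z) / D.τ (D.σ z))
          = fun z => dnFun w (D.σ z) / D.τ (D.σ z) - ν * w (D.σ z) := by
        funext z
        have := D.τ_ne_zero (D.σ z)
        rw [hg]
        field_simp
      have c1 : Continuous fun z => dnFun w (D.σ z) / D.τ (D.σ z) :=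
        (hgc1.comp D.continuous_σ).div (D.continuous_τ.comp D.continuous_σ) fun z => D.τ_ne_zero _
      have c2 : Continuous fun z => ν * w (D.σ z) :=
        continuous_const.mul (hw.continuous.comp D.continuous_σ)
      rw [h1, circleCoeff_sub c1 c2, D.circleCoeff_div_τ hgc1, D.circleMean_dnFun_eq hw, h, circleCoeff_const_mul, sub_eq_zero]
      rfl
    intro z
    have h2 := congrFun (eq_zero_of_circleCoeff_eq_zero hgσ h0) (D.e z)
    simp only [σ_e, Pi.zero_apply, div_eq_zero_iff, D.τ_ne_zero, or_false] at h2
    exact sub_eq_zero.1 h2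

end CircleDensity
end

/-! ### Regularity of eigenvectors and equality of multiplicities -/

noncomputable section

open ComplexConjugate

namespace IsSmoothing

open EllTwo

variable {K : ℤ → ℤ → ℂ} {hK : IsSmoothing K}

/-- Bootstrap: `(1 + |n|) v = (1 + x) v - K v`, where `K v` decays rapidly, so `v` gains one power
of decay at each stage. -/
theorem exists_eigenvector_le {v : EllTwo} {x : ℝ}
    (hv : ∀ n : ℤ, (|(n : ℝ)| : ℝ) * v n + hK.op v n = x * v n) (p : ℕ) :
    ∃ C, ∀ n, ‖v n‖ ≤ C / wt n ^ p := by
  induction p with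
  | zero => exact ⟨‖v‖, fun n => by simpa using norm_apply_le v n⟩
  | succ p ih =>
    obtain ⟨C, hC⟩ := ih
    obtain ⟨C', -, hC'⟩ := hK.exists_norm_tsum_le p
    refine ⟨(1 + |x|) * C + C' * ‖v‖, fun n => ?_⟩
    have hn := wt_pos n
    have h1 : (wt n : ℂ) * v n = ((1 + x : ℝ) : ℂ) * v n - hK.op v n := by
      rw [wt]; push_cast; push_cast at hv; linear_combination hv n
    have h2 : wt n * ‖v n‖ ≤ (1 + |x|) * (C / wt n ^ p) + C' * ‖v‖ / wt n ^ p := by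
      calc wt n * ‖v n‖ = ‖(wt n : ℂ) * v n‖ := by
            rw [norm_mul, Complex.norm_real, Real.norm_of_nonneg hn.le]
        _ ≤ ‖((1 + x : ℝ) : ℂ) * v n‖ + ‖hK.op v n‖ := by rw [h1]; exact norm_sub_le _ _
        _ ≤ _ := by
          rw [norm_mul, Complex.norm_real, Real.norm_eq_abs]
          gcongr
          · exact (abs_add_le _ _).trans (by rw [abs_one])
          · exact hC n
          · exact hC' v ‖v‖ (norm_apply_le v) n
    rw [le_div_iff₀ (by positivity), pow_succ]
    calc ‖v n‖ * (wt n ^ p * wt n) = (wt n * ‖v n‖) * wt n ^ p := by ring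
      _ ≤ ((1 + |x|) * (C / wt n ^ p) + C' * ‖v‖ / wt n ^ p) * wt n ^ p := by gcongr
      _ = _ := by field_simp

theorem summable_eigenvector {v : EllTwo} {x : ℝ}
    (hv : ∀ n : ℤ, (|(n : ℝ)| : ℝ) * v n + hK.op v n = x * v n) (p : ℕ) :
    Summable fun n : ℤ => |(n : ℝ)| ^ p * ‖v n‖ := by
  obtain ⟨C, hC⟩ := exists_eigenvector_le hv (p + 2)
  refine Summable.of_nonneg_of_le (fun n => by positivity) (fun n => ?_)
    (summable_wt_inv.mul_left C)
  have hn := wt_pos n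
  calc |(n : ℝ)| ^ p * ‖v n‖ ≤ wt n ^ p * (C / wt n ^ (p + 2)) := by
        gcongr
        · rw [wt]; linarith
        · exact hC n
    _ = _ := by field_simp; ring

/-- Symmetry kills the coefficient at `b i` unless `lam i = x`. Finiteness of this set makes the
expansion finite, so the algebraic span suffices. -/
theorem IsEigenbasis.mem_span {b : HilbertBasis ℕ ℂ EllTwo} {lam : ℕ → ℝ}
    (hb : hK.IsEigenbasis b lam) {v : EllTwo} {x : ℂ}
    (hv : ∀ n : ℤ, (|(n : ℝ)| : ℝ) * v n + hK.op v n = x * v n)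
    (hfin : {i | (lam i : ℂ) = x}.Finite) :
    v ∈ Submodule.span ℂ (b '' {i | (lam i : ℂ) = x}) := by
  have himg : hK.IsImage v (x • v) := by
    intro n
    rw [lp.coeFn_smul, Pi.smul_apply, smul_eq_mul, hv n]
  have h0 : ∀ i, i ∉ hfin.toFinset → (inner ℂ (b i) v) • b i = 0 := by
    intro i hi
    have h1 := hb.inner_image himg i
    rw [inner_smul_right] at h1
    have h2 : ((lam i : ℂ) - x) * inner ℂ (b i) v = 0 := by linear_combination -h1
    rcases mul_eq_zero.1 h2 with h3 | h3
    · exact (hi (by simpa using sub_eq_zero.1 h3)).elim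
    · rw [h3, zero_smul]
  have h1 := b.hasSum_repr v
  simp only [b.repr_apply_apply] at h1
  rw [h1.unique (hasSum_sum_of_ne_finset_zero h0)]
  exact Submodule.sum_mem _ fun i hi => Submodule.smul_mem _ _
    (Submodule.subset_span ⟨i, by simpa using hi, rfl⟩)

theorem finite_setOf_eq {lam : ℕ → ℝ} {C : ℝ} (h : ∀ k, |lam k - discEigenvalue k| ≤ C) (x : ℂ) :
    {i | (lam i : ℂ) = x}.Finite := by
  obtain ⟨M, hM⟩ := exists_nat_gt (x.re + C)
  refine (Set.finite_lt_nat (2 * M)).subset fun i hi => ?_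
  by_contra hlt
  have h1 : M ≤ discEigenvalue i := by
    rw [Set.mem_ofPred_eq, not_lt] at hlt
    rw [discEigenvalue]; omega
  have h2 : (M : ℝ) ≤ discEigenvalue i := by exact_mod_cast h1
  have h3 : lam i = x.re := by rw [← (show (lam i : ℂ) = x from hi), Complex.ofReal_re]
  have h4 := (abs_le.1 (h i)).1
  linarith

end IsSmoothing

namespace CircleDensity

variable (D : CircleDensity)

theorem isSmoothOnCircle_comp_e {W : Circle → ℂ} (hW : IsSmoothOnCircle W) :
    IsSmoothOnCircle fun z => W (D.e z) := by
  have : (fun θ : ℝ => W (D.e (Circle.exp θ))) = (fun t : ℝ => W (Circle.exp t)) ∘ D.T := by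
    funext θ; rw [Function.comp, e_exp]
  rw [IsSmoothOnCircle, this]
  exact ContDiff.comp hW D.contDiff_T

/-- A smooth eigenfunction with a given sequence of coefficients. -/
theorem exists_smooth_of_eigenvector {v : EllTwo} {x : ℝ}
    (hv : ∀ n : ℤ, (|(n : ℝ)| : ℝ) * v n + D.isSmoothing_K.op v n = x * v n) :
    ∃ (w : Circle → ℂ) (hw : IsSmoothOnCircle w), D.toEllTwo w hw.continuous = v ∧
      ∀ z, dnFun w z = x * (D.τ z * w z) := by
  have hs := isSmoothOnCircle_circleSeries (IsSmoothing.summable_eigenvector hv)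
  have hw := D.isSmoothOnCircle_comp_e hs
  have h1 : D.toEllTwo _ hw.continuous = v := by
    ext n
    rw [toEllTwo_apply]
    simp only [e_σ]
    refine circleCoeff_circleSeries (Summable.of_norm ?_) n
    simpa using IsSmoothing.summable_eigenvector hv 0
  refine ⟨_, hw, h1, (D.dnFun_eq_iff hw x).2 ?_⟩
  rw [h1]
  exact hv

theorem toEllTwo_injective {w : Circle → ℂ} (hw : Continuous w) (h : D.toEllTwo w hw = 0) :
    w = 0 := by
  have h1 := eq_zero_of_circleCoeff_eq_zero (u := fun z => w (D.σ z)) (hw.comp D.continuous_σ)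
    fun n => by rw [← D.toEllTwo_apply w hw, h]; rfl
  funext z
  have := congrFun h1 (D.e z)
  simp only [σ_e] at this
  exact this

section Spectrum

variable {D} {a : Circle → ℝ} {ha : IsSmoothOnCircle a} {hpos : ∀ z, 0 < a z} {l : ℝ}

theorem mem_eigenspace_iff (hl : 0 < l) (hτ : ∀ z, D.τ z = (l * a z)⁻¹) (u : SmoothCircle) (μ : ℂ) :
    u ∈ Module.End.eigenspace (steklovOp a ha hpos) μ ↔
      ∀ z, dnFun (fun z => ((Real.sqrt (a z) : ℝ) : ℂ) * (u : Circle → ℂ) z) z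
        = (μ * l) * (D.τ z * (((Real.sqrt (a z) : ℝ) : ℂ) * (u : Circle → ℂ) z)) := by
  rw [Module.End.mem_eigenspace_iff, Subtype.ext_iff, funext_iff]
  refine forall_congr' fun z => ?_
  change ((Real.sqrt (a z) : ℝ) : ℂ)
    * dnFun (fun z => ((Real.sqrt (a z) : ℝ) : ℂ) * (u : Circle → ℂ) z) z
    = μ * (u : Circle → ℂ) z ↔ _
  set X := dnFun (fun z => ((Real.sqrt (a z) : ℝ) : ℂ) * (u : Circle → ℂ) z) z
  have hs : ((Real.sqrt (a z) : ℝ) : ℂ) ≠ 0 := by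
    exact_mod_cast (Real.sqrt_pos.2 (hpos z)).ne'
  have hl' : (l : ℂ) ≠ 0 := by exact_mod_cast hl.ne'
  have ha' : (a z : ℂ) = ((Real.sqrt (a z) : ℝ) : ℂ) ^ 2 := by
    exact_mod_cast (Real.sq_sqrt (hpos z).le).symm
  rw [hτ, Complex.ofReal_inv, Complex.ofReal_mul, ha']
  set r := ((Real.sqrt (a z) : ℝ) : ℂ)
  constructor
  · intro h
    field_simp
    rw [mul_comm]
    exact h
  · intro h
    rw [h]
    field_simp

/-- The coefficients of `a ^ (1 / 2) * u` in the coordinate `T`. -/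
def coeffMap (D : CircleDensity) (ha : IsSmoothOnCircle a) (hpos : ∀ z, 0 < a z) :
    SmoothCircle →ₗ[ℂ] EllTwo where
  toFun u := D.toEllTwo (fun z => ((Real.sqrt (a z) : ℝ) : ℂ) * (u : Circle → ℂ) z)
    ((sqrt_smooth ha hpos).mul u.2).continuous
  map_add' u v := by
    ext n
    have h : ∀ w : SmoothCircle, Continuous fun z => ((Real.sqrt (a (D.σ z)) : ℝ) : ℂ)
        * (w : Circle → ℂ) (D.σ z) * (z : ℂ) ^ (-n) := fun w =>
      (((sqrt_smooth ha hpos).mul w.2).continuous.comp D.continuous_σ).fun_mul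
        (continuous_circle_zpow _)
    rw [lp.coeFn_add, Pi.add_apply, toEllTwo_apply, toEllTwo_apply, toEllTwo_apply,
      circleCoeff_eq_circleMean, circleCoeff_eq_circleMean, circleCoeff_eq_circleMean,
      ← circleMean_add (h u) (h v)]
    congr 1
    funext z
    change _ * ((u : Circle → ℂ) _ + (v : Circle → ℂ) _) * _ = _
    ring
  map_smul' c u := by
    ext n
    rw [lp.coeFn_smul, Pi.smul_apply, toEllTwo_apply, toEllTwo_apply, RingHom.id_apply, smul_eq_mul,
      ← circleCoeff_const_mul]
    congr 1
    funext z
    exact mul_left_comm _ _ _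

theorem coeffMap_apply (u : SmoothCircle) : coeffMap D ha hpos u =
    D.toEllTwo (fun z => ((Real.sqrt (a z) : ℝ) : ℂ) * (u : Circle → ℂ) z)
      ((sqrt_smooth ha hpos).mul u.2).continuous := rfl

theorem coeffMap_injective : Function.Injective (coeffMap D ha hpos) := by
  rw [injective_iff_map_eq_zero]
  intro u hu
  rw [coeffMap_apply] at hu
  have h := D.toEllTwo_injective _ hu
  refine Subtype.ext (funext fun z => ?_)
  have hs : ((Real.sqrt (a z) : ℝ) : ℂ) ≠ 0 := by
    exact_mod_cast (Real.sqrt_pos.2 (hpos z)).ne'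
  exact (mul_eq_zero.1 (congrFun h z)).resolve_left hs

/-- Every basis eigenvector comes from a smooth `w`, and dividing by `a^(1/2)` brings it back to a
smooth eigenfunction of the Steklov operator; thus no eigenvector is lost in passing from sequences
to smooth functions. -/
theorem map_eigenspace (hl : 0 < l) (hτ : ∀ z, D.τ z = (l * a z)⁻¹) {b : HilbertBasis ℕ ℂ EllTwo}
    {lam : ℕ → ℝ} (hb : D.isSmoothing_K.IsEigenbasis b lam) (μ : ℂ)
    (hfin : {i | (lam i : ℂ) = μ * l}.Finite) :
    (Module.End.eigenspace (steklovOp a ha hpos) μ).map (coeffMap D ha hpos)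
      = Submodule.span ℂ (b '' {i | (lam i : ℂ) = μ * l}) := by
  apply le_antisymm
  · rintro _ ⟨u, hu, rfl⟩
    refine hb.mem_span (fun n => ?_) hfin
    exact (D.dnFun_eq_iff ((sqrt_smooth ha hpos).mul u.2) _).1
      ((mem_eigenspace_iff hl hτ u μ).1 hu) n
  · rw [Submodule.span_le]
    rintro _ ⟨i, hi, rfl⟩
    obtain ⟨w, hw, h1, h2⟩ := D.exists_smooth_of_eigenvector (hb i)
    have hs : ∀ z, ((Real.sqrt (a z) : ℝ) : ℂ) ≠ 0 := fun z => by
      exact_mod_cast (Real.sqrt_pos.2 (hpos z)).ne'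
    have hsm : IsSmoothOnCircle fun z => (((Real.sqrt (a z) : ℝ) : ℂ))⁻¹ * w z := by
      refine IsSmoothOnCircle.mul ?_ hw
      exact ContDiff.inv (sqrt_smooth ha hpos) fun θ => hs _
    have he : (fun z => ((Real.sqrt (a z) : ℝ) : ℂ)
        * ((((Real.sqrt (a z) : ℝ) : ℂ))⁻¹ * w z)) = w :=
      funext fun z => mul_inv_cancel_left₀ (hs z) _
    refine ⟨(⟨fun z => (((Real.sqrt (a z) : ℝ) : ℂ))⁻¹ * w z, hsm⟩ : SmoothCircle), (mem_eigenspace_iff hl hτ _ μ).2 fun z => ?_, ?_⟩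
    · change dnFun (fun z => ((Real.sqrt (a z) : ℝ) : ℂ)
        * ((((Real.sqrt (a z) : ℝ) : ℂ))⁻¹ * w z)) z = _ * (_ * (_ * (_ * w z)))
      rw [he, mul_inv_cancel_left₀ (hs z), h2, show (lam i : ℂ) = μ * l from hi]
    · rw [← h1, coeffMap_apply]
      congr 1

theorem encard_eq_rank (hl : 0 < l) (hτ : ∀ z, D.τ z = (l * a z)⁻¹) {b : HilbertBasis ℕ ℂ EllTwo}
    {lam : ℕ → ℝ} (hb : D.isSmoothing_K.IsEigenbasis b lam) (μ : ℂ)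
    (hfin : {i | (lam i : ℂ) = μ * l}.Finite) :
    {i | (lam i : ℂ) = μ * l}.encard
      = Cardinal.toENat (Module.rank ℂ (Module.End.eigenspace (steklovOp a ha hpos) μ)) := by
  have h1 := (Submodule.equivMapOfInjective (coeffMap D ha hpos) coeffMap_injective
    (Module.End.eigenspace (steklovOp a ha hpos) μ)).rank_eq
  rw [h1, map_eigenspace hl hτ hb μ hfin]
  have hinj : Function.Injective b := b.orthonormal.linearIndependent.injective
  rw [rank_span_set (b.orthonormal.linearIndependent.linearIndepOn_id.mono
    (Set.image_subset_range _ _)), ← hinj.encard_image]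
  rfl

end Spectrum

end CircleDensity
end

/-! ### The bottom of the spectrum and uniqueness of the eigenvalue list -/

noncomputable section

open ComplexConjugate

namespace CircleDensity

open EllTwo

variable (D : CircleDensity)

/-- Pairing the equation with `w` equates the Dirichlet energy with `x` times the `τ`-weighted
square norm of `w`, which is `‖v‖²` in the coordinate `T`. -/
theorem hasSum_abs_mul_of_eigenvector {v : EllTwo} {x : ℝ} {w : Circle → ℂ}
    (hw : IsSmoothOnCircle w) (hv : D.toEllTwo w hw.continuous = v)
    (h : ∀ z, dnFun w z = x * (D.τ z * w z)) :
    HasSum (fun n : ℤ => |(n : ℝ)| * ‖circleCoeff w n‖ ^ 2) (x * ‖v‖ ^ 2) := by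
  have h1 := hasSum_dnFun_mul_conj hw hw.continuous
  have h2 := hasSum_circleCoeff_mul_conj (hw.continuous.comp D.continuous_σ)
    (hw.continuous.comp D.continuous_σ)
  have hW : Continuous fun z => w (D.σ z) * conj (w (D.σ z)) :=
    (hw.continuous.comp D.continuous_σ).mul
      (Complex.continuous_conj.comp (hw.continuous.comp D.continuous_σ))
  have h3 : (circleMean fun z => dnFun w z * conj (w z))
      = x * circleMean fun z => w (D.σ z) * conj (w (D.σ z)) := by
    rw [← D.circleMean_comp_e hW, ← circleMean_mul_left]
    congr 1
    funext z
    rw [σ_e, h]; ring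
  have h4 := EllTwo.hasSum_norm_sq v
  rw [← hv] at h4
  have h5 : (circleMean fun z => w (D.σ z) * conj (w (D.σ z))) = ((‖v‖ ^ 2 : ℝ) : ℂ) := by
    rw [← hv]
    refine h2.unique ?_
    convert! Complex.hasSum_ofReal.2 h4 using 1
    funext n
    rw [toEllTwo_apply, Complex.mul_conj', Complex.ofReal_pow]
    rfl
  rw [h3, h5] at h1
  have h6 := Complex.hasSum_re h1
  rw [← Complex.ofReal_mul, Complex.ofReal_re] at h6
  convert! h6 using 1
  funext n
  rw [mul_assoc, Complex.mul_conj', ← Complex.ofReal_pow, ← Complex.ofReal_mul, Complex.ofReal_re]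

theorem K_zero_right (m : ℤ) : D.K m 0 = 0 := by
  have : D.P m 0 = 0 := by
    rw [P]
    have : (fun k : ℤ => ((|(k : ℝ)| : ℝ) : ℂ) * D.U 0 k * conj (D.U m k)) = fun _ => 0 := by
      funext k
      rw [U_zero]
      split_ifs with h
      · simp [h]
      · simp
    rw [this, tsum_zero]
  rw [K, this]
  simp

variable {D} {b : HilbertBasis ℕ ℂ EllTwo} {lam : ℕ → ℝ}

theorem eigenvalue_nonneg (hb : D.isSmoothing_K.IsEigenbasis b lam) (k : ℕ) : 0 ≤ lam k := by
  obtain ⟨w, hw, h1, h2⟩ := D.exists_smooth_of_eigenvector (hb k)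
  have h3 := (D.hasSum_abs_mul_of_eigenvector hw h1 h2).nonneg fun n => by positivity
  rwa [b.orthonormal.norm_eq_one, one_pow, mul_one] at h3

/-- Zero Dirichlet energy forces `w` to be constant. -/
theorem eigenvector_apply_eq_zero (hb : D.isSmoothing_K.IsEigenbasis b lam) {k : ℕ}
    (hk : lam k = 0) {n : ℤ} (hn : n ≠ 0) : b k n = 0 := by
  obtain ⟨w, hw, h1, h2⟩ := D.exists_smooth_of_eigenvector (hb k)
  have h3 := D.hasSum_abs_mul_of_eigenvector hw h1 h2
  rw [hk, zero_mul] at h3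
  have h4 : ∀ m : ℤ, m ≠ 0 → circleCoeff w m = 0 := by
    intro m hm
    have := congrFun ((hasSum_zero_iff_of_nonneg fun n => by positivity).1 h3) m
    have hm' : (m : ℝ) ≠ 0 := by exact_mod_cast hm
    simpa [hm'] using this
  have h5 : ∀ z, w z = circleCoeff w 0 := by
    intro z
    have hs : HasSum (fun m : ℤ => circleCoeff w m * (z : ℂ) ^ m) (circleCoeff w 0) := by
      have := hasSum_single (f := fun m : ℤ => circleCoeff w m * (z : ℂ) ^ m) 0
        (fun m hm => by rw [h4 m hm, zero_mul])
      simpa using this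
    have hsum : Summable (circleCoeff w) :=
      (hasSum_single 0 fun m hm => h4 m hm).summable
    exact (hasSum_circleCoeff_of_summable hw.continuous hsum z).unique hs
  rw [← h1, toEllTwo_apply]
  simp only [h5 (D.σ _)]
  have h6 := circleCoeff_const_mul (circleCoeff w 0) (fun z => (z : ℂ) ^ (0 : ℤ)) n
  rw [circleCoeff_circle_zpow, if_neg hn.symm, mul_zero] at h6
  simpa using h6

theorem isDiscAsymptotic (hb : D.isSmoothing_K.IsEigenbasis b lam) (hmono : Monotone lam) :
    IsDiscAsymptotic lam where
  mono := hmono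
  decay p := hb.exists_abs_sub_le hmono p
  -- `K` kills `unit 0`, so `lam k` times the overlap of `b k` with `unit 0` vanishes. If no
  -- eigenvalue were zero, all spectral weights of `unit 0` would vanish, though they sum to `1`.
  zero := by
    refine le_antisymm ?_ (eigenvalue_nonneg hb 0)
    by_contra! h
    have h1 : D.isSmoothing_K.op (IsSmoothing.unit 0) = 0 := by
      ext m
      rw [IsSmoothing.op_unit, K_zero_right]
      rfl
    have h2 : IsSmoothing.spectralWeight b 0 = fun _ => 0 := by
      funext k
      have h3 := hb.inner_op_unit 0 k
      have h4 : lam k ≠ 0 := (h.trans_le (hmono (Nat.zero_le k))).ne'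
      rw [h1, inner_zero_right] at h3
      have h5 : inner ℂ (b k) (IsSmoothing.unit 0) = 0 := by
        simpa [h4] using h3.symm
      rw [IsSmoothing.spectralWeight, h5, norm_zero]
      simp
    have h6 := IsSmoothing.hasSum_spectralWeight b 0
    rw [h2] at h6
    exact zero_ne_one (hasSum_zero.unique h6)
  -- If `lam 1 = 0`, then `b 0` and `b 1` are both supported at index `0`, which contradicts their
  -- orthogonality.
  pos := by
    refine lt_of_le_of_ne (eigenvalue_nonneg hb 1) fun h => ?_
    have h0 : lam 0 = 0 := le_antisymm ((hmono zero_le_one).trans h.symm.le) (eigenvalue_nonneg hb 0)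
    have e : ∀ k, lam k = 0 → ‖b k 0‖ ^ 2 = 1 := by
      intro k hk
      have h1 := hasSum_norm_sq (b k)
      rw [b.orthonormal.norm_eq_one, one_pow] at h1
      refine HasSum.unique ?_ h1
      exact hasSum_single (f := fun n => ‖b k n‖ ^ 2) 0
        fun n hn => by rw [eigenvector_apply_eq_zero hb hk hn, norm_zero]; simp
    have h2 := inner_hasSum (b 0) (b 1)
    rw [b.orthonormal.inner_eq_zero zero_ne_one] at h2
    have h3 := hasSum_single (f := fun n => conj (b 0 n) * b 1 n) 0
      fun n hn => by rw [eigenvector_apply_eq_zero hb h.symm hn, mul_zero]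
    have h4 := h2.unique h3
    have h5 := e 0 h0
    have h6 := e 1 h.symm
    rcases mul_eq_zero.1 h4.symm with h7 | h7
    · rw [(map_eq_zero _).1 h7] at h5; simp at h5
    · rw [h7] at h6; simp at h6

variable {a : Circle → ℝ} {ha : IsSmoothOnCircle a} {hpos : ∀ z, 0 < a z} {l : ℝ}

theorem isSteklovSpectrum (hl : 0 < l) (hτ : ∀ z, D.τ z = (l * a z)⁻¹)
    (hb : D.isSmoothing_K.IsEigenbasis b lam) (hmono : Monotone lam) :
    IsSteklovSpectrum a ha hpos fun k => lam k / l where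
  zero := by rw [(isDiscAsymptotic hb hmono).zero, zero_div]
  pos := div_pos (isDiscAsymptotic hb hmono).pos hl
  mono := fun i j h => div_le_div_of_nonneg_right (hmono h) hl.le
  multiplicity μ := by
    obtain ⟨C, -, hC⟩ := (isDiscAsymptotic hb hmono).decay 0
    simp only [pow_zero, div_one] at hC
    rw [← encard_eq_rank hl hτ hb μ (IsSmoothing.finite_setOf_eq hC _)]
    congr 1
    ext n
    have hl' : (l : ℂ) ≠ 0 := by exact_mod_cast hl.ne'
    change ((lam n / l : ℝ) : ℂ) = μ ↔ (lam n : ℂ) = μ * l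
    rw [Complex.ofReal_div, div_eq_iff hl']

end CircleDensity

/-- If `f n < g n`, monotonicity confines the level `f n` of `g` to indices below `n`, where `f`
takes the same values. That level of `f` also contains `n`, so the two finite level sets would
differ in size. -/
theorem le_of_encard_eq {f g : ℕ → ℝ} (hg : Monotone g)
    (hfin : ∀ x, {n | f n = x}.Finite)
    (h : ∀ x, {n | f n = x}.encard = {n | g n = x}.encard) {n : ℕ} (hn : ∀ m < n, f m = g m) :
    g n ≤ f n := by
  by_contra! hlt
  have hsub : {m | g m = f n} ⊆ {m | f m = f n} \ {n} := by
    intro m hm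
    have hm' : g m = f n := hm
    have hmn : m < n := by
      by_contra! hge
      have := hg hge
      linarith
    exact ⟨(hn m hmn).trans hm', hmn.ne⟩
  have h1 := Set.encard_le_encard hsub
  rw [← h] at h1
  have h2 := (hfin (f n)).eq_of_subset_of_encard_le' (Set.sdiff_subset (t := {n})) h1
  have h3 : n ∈ {m | f m = f n} \ {n} := by rw [h2]; rfl
  exact h3.2 rfl

theorem eq_of_encard_eq {f g : ℕ → ℝ} (hf : Monotone f) (hg : Monotone g)
    (hfin : ∀ x, {n | f n = x}.Finite)
    (h : ∀ x, {n | f n = x}.encard = {n | g n = x}.encard) : f = g := by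
  funext n
  induction n using Nat.strong_induction_on with
  | _ n ih =>
    have hfin' : ∀ x, {n | g n = x}.Finite := fun x =>
      Set.encard_ne_top_iff.1 (by rw [← h]; exact Set.encard_ne_top_iff.2 (hfin x))
    exact le_antisymm (le_of_encard_eq hf hfin' (fun x => (h x).symm) fun m hm => (ih m hm).symm)
      (le_of_encard_eq hg hfin h ih)

theorem IsSteklovSpectrum.unique {a : Circle → ℝ} {ha : IsSmoothOnCircle a} {hpos : ∀ z, 0 < a z}
    {f g : ℕ → ℝ} (hf : IsSteklovSpectrum a ha hpos f) (hg : IsSteklovSpectrum a ha hpos g)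
    (hfin : ∀ x, {n | f n = x}.Finite) : f = g := by
  refine eq_of_encard_eq hf.mono hg.mono hfin fun x => ?_
  have := (hf.multiplicity x).trans (hg.multiplicity x).symm
  simpa only [Complex.ofReal_inj] using this
end

/-! ### Growth or vanishing of the zeta difference -/

noncomputable section

open ComplexConjugate

namespace CircleDensity

variable {D : CircleDensity} {b : HilbertBasis ℕ ℂ EllTwo} {lam : ℕ → ℝ}

theorem d_eq_abs_add (n : ℤ) : D.d n = |(n : ℝ)| + (D.K n n).re := by
  rw [d, K, if_pos rfl, Complex.sub_re, Complex.ofReal_re]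
  ring

theorem le_sub_of_hasSum (hb : D.isSmoothing_K.IsEigenbasis b lam) (hmono : Monotone lam)
    {f : ℝ → ℝ} {c : ℝ} {j : ℕ} (hf : IsSmoothing.TraceFunction f c j) {v : ℝ}
    (hv : HasSum (fun k => f (lam k) - f (discEigenvalue k)) v) (n : ℕ) :
    f (D.d n) - f n ≤ v := by
  rw [← hv.tsum_eq]
  exact hb.le_tsum_sub hmono (eigenvalue_nonneg hb) hf d_eq_abs_add D.abs_le_d D.K_zero_right
    hv.summable n

/-- The trace inequality at one index `n`, chosen beyond `e^α` and `e` with `d n > n`. The same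
constant `(d n - n) e^(-α)` serves the function and its derivative. -/
theorem exists_exp_le (hb : D.isSmoothing_K.IsEigenbasis b lam) (hmono : Monotone lam)
    (hinf : ∀ M : ℕ, ∃ n : ℕ, M ≤ n ∧ (n : ℝ) < D.d n) (α : ℝ) :
    ∃ C, 0 < C ∧ ∀ s : ℝ, 1 ≤ s →
      (∃ v : ℝ, zetaDifference lam (-(s : ℂ)) = v ∧ C * Real.exp (α * s) ≤ v) ∧
      ∃ v : ℝ, HasDerivAt (fun s : ℝ => zetaDifference lam (-(s : ℂ))) v s ∧
        C * Real.exp (α * s) ≤ v := by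
  obtain ⟨M, hM⟩ := exists_nat_ge (max (Real.exp α) (Real.exp 1))
  obtain ⟨n, hn, hd⟩ := hinf M
  have hMn : (M : ℝ) ≤ n := by exact_mod_cast hn
  have h1 : Real.exp α ≤ n := ((le_max_left _ _).trans hM).trans hMn
  have h2 : Real.exp 1 ≤ n := ((le_max_right _ _).trans hM).trans hMn
  have has := isDiscAsymptotic hb hmono
  refine ⟨(D.d n - n) * Real.exp (-α), mul_pos (sub_pos.2 hd) (Real.exp_pos _), fun s hs => ?_⟩
  obtain ⟨v, hv, hvs⟩ := has.exists_hasSum_rpow_sub hs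
  obtain ⟨v', hv', hvs'⟩ := has.exists_hasSum_rpow_mul_log_sub s
  exact ⟨⟨v, hv, (exp_mul_le_rpow_sub hs h1 hd.le).trans
      (le_sub_of_hasSum hb hmono (traceFunction_rpow hs) hvs n)⟩,
    ⟨v', hv', (exp_mul_le_rpow_mul_log_sub hs h1 h2 hd.le).trans
      (le_sub_of_hasSum hb hmono (traceFunction_rpow_mul_log hs) hvs' n)⟩⟩

/-- The powers of `e` have one-sided spectrum, so on the support of `U m` the weight `|k|` is `k`
times the sign of `m`, and the matrix reduces to the exact identity `hasSum_mul_U_mul_conj`. -/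
theorem K_eq_zero (h : ∀ n : ℕ, D.d n = n) : D.K = 0 := by
  have hU : ∀ n : ℤ, 0 ≤ n → ∀ k < 0, D.U n k = 0 := by
    intro n hn
    lift n to ℕ using hn
    exact (D.d_eq_iff n).1 (by rw [h]; simp)
  have hU' : ∀ n : ℤ, n ≤ 0 → ∀ k : ℤ, 0 < k → D.U n k = 0 := by
    intro n hn k hk
    have := D.U_neg (-n) k
    rw [neg_neg] at this
    rw [this, hU (-n) (by omega) (-k) (by omega), map_zero]
  funext n m
  rw [K, P]
  have key : ∀ ε : ℝ, (∀ k : ℤ, ((|(k : ℝ)| : ℝ) : ℂ) * D.U m k = ε * ((k : ℂ) * D.U m k)) →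
      |(m : ℝ)| = ε * m →
      (∑' k : ℤ, ((|(k : ℝ)| : ℝ) : ℂ) * D.U m k * conj (D.U n k))
        = if n = m then ((|(m : ℝ)| : ℝ) : ℂ) else 0 := by
    intro ε hε hm
    have h1 := (D.hasSum_mul_U_mul_conj m n).mul_left (ε : ℂ)
    have h2 : (fun k : ℤ => ((|(k : ℝ)| : ℝ) : ℂ) * D.U m k * conj (D.U n k))
        = fun k : ℤ => (ε : ℂ) * ((k : ℂ) * D.U m k * conj (D.U n k)) := by
      funext k
      rw [hε]; ring
    rw [h2, h1.tsum_eq, hm]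
    split_ifs <;> simp
  rw [Pi.zero_apply, Pi.zero_apply, sub_eq_zero]
  rcases le_total 0 m with hm | hm
  · refine key 1 (fun k => ?_) ?_
    · rcases lt_or_ge k 0 with hk | hk
      · simp [hU m hm k hk]
      · rw [abs_of_nonneg (by exact_mod_cast hk)]; simp
    · rw [abs_of_nonneg (by exact_mod_cast hm), one_mul]
  · refine key (-1) (fun k => ?_) ?_
    · rcases lt_or_ge 0 k with hk | hk
      · simp [hU' m hm k hk]
      · rw [abs_of_nonpos (by exact_mod_cast hk)]; simp
    · rw [abs_of_nonpos (by exact_mod_cast hm)]; ring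

theorem zetaDifference_eq_zero (hb : D.isSmoothing_K.IsEigenbasis b lam) (hmono : Monotone lam)
    (h : ∀ n : ℕ, D.d n = n) : zetaDifference lam = 0 := by
  funext s
  rw [zetaDifference]
  simp [hb.eq_discEigenvalue hmono (K_eq_zero h)]

end CircleDensity
end

/-! ### Holomorphic extension of the boundary diffeomorphism -/

noncomputable section

open ComplexConjugate

/-- The function on the circle is the boundary value of a function which is continuous on the closed
disc and holomorphic in the open disc. -/
def HasDiscExtension (h : Circle → ℂ) : Prop :=
  ∃ F : ℂ → ℂ, DiffContOnCl ℂ F (Metric.ball 0 1) ∧ ∀ z : Circle, F z = h z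

theorem closure_unitBall : closure (Metric.ball (0 : ℂ) 1) = Metric.closedBall 0 1 :=
  closure_ball 0 one_ne_zero

theorem frontier_unitBall : frontier (Metric.ball (0 : ℂ) 1) = Metric.sphere 0 1 :=
  frontier_ball 0 one_ne_zero

theorem eqOn_closedBall_of_circle {F G : ℂ → ℂ} (hF : DiffContOnCl ℂ F (Metric.ball 0 1))
    (hG : DiffContOnCl ℂ G (Metric.ball 0 1)) (h : ∀ z : Circle, F z = G z) :
    Set.EqOn F G (Metric.closedBall 0 1) := by
  rw [← closure_unitBall]
  refine Complex.eqOn_closure_of_eqOn_frontier Metric.isBounded_ball hF hG ?_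
  rw [frontier_unitBall]
  intro z hz
  exact h ⟨z, hz⟩

theorem HasDiscExtension.pow {h : Circle → ℂ} (hh : HasDiscExtension h) (n : ℕ) :
    HasDiscExtension fun z => h z ^ n := by
  obtain ⟨F, hF, hFh⟩ := hh
  exact ⟨fun z => F z ^ n, ⟨hF.differentiableOn.pow n, hF.continuousOn.pow n⟩,
    fun z => congrArg (· ^ n) (hFh z)⟩

theorem HasDiscExtension.rotate {h : Circle → ℂ} (hh : HasDiscExtension h) (c : Circle) :
    HasDiscExtension fun z => h (c * z) := by
  obtain ⟨F, hF, hFh⟩ := hh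
  have h1 : Set.MapsTo (fun z : ℂ => (c : ℂ) * z) (Metric.ball 0 1) (Metric.ball 0 1) := by
    intro z hz
    simpa [Circle.norm_coe] using hz
  have h2 : Differentiable ℂ fun z : ℂ => (c : ℂ) * z := differentiable_id.const_mul _
  refine ⟨fun z => F (c * z), hF.comp h2.diffContOnCl h1, fun z => ?_⟩
  change F (c * z) = h (c * z)
  rw [← hFh (c * z), Circle.coe_mul]

theorem HasDiscExtension.conj {h : Circle → ℂ} (hh : HasDiscExtension h) :
    HasDiscExtension fun z => conj (h z⁻¹) := by
  obtain ⟨F, hF, hFh⟩ := hh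
  refine ⟨fun z => conj (F (conj z)), ⟨fun z hz => ?_, ?_⟩, fun z => ?_⟩
  · have hz' : conj z ∈ Metric.ball (0 : ℂ) 1 := by simpa using hz
    have h1 := (hF.differentiableAt Metric.isOpen_ball hz').conj_conj
    rw [Complex.conj_conj] at h1
    exact h1.differentiableWithinAt
  · have h1 := hF.continuousOn
    rw [closure_unitBall] at h1 ⊢
    refine Complex.continuous_conj.comp_continuousOn
      (h1.comp Complex.continuous_conj.continuousOn fun z hz => ?_)
    simpa using hz
  · change starRingEnd ℂ (F (starRingEnd ℂ z)) = starRingEnd ℂ (h z⁻¹)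
    rw [← hFh z⁻¹, Circle.coe_inv_eq_conj]

theorem HasDiscExtension.circleCoeff_eq_zero {h : Circle → ℂ} (hh : HasDiscExtension h) {k : ℤ}
    (hk : k < 0) : circleCoeff h k = 0 := by
  obtain ⟨F, hF, hFh⟩ := hh
  obtain ⟨n, rfl⟩ : ∃ n : ℕ, k = -((n : ℤ) + 1) := ⟨(-k - 1).toNat, by omega⟩
  have hd : Differentiable ℂ fun z : ℂ => z ^ n := differentiable_id.pow n
  have h1 : DiffContOnCl ℂ (fun z => F z * z ^ n) (Metric.ball 0 1) :=
    ⟨hF.differentiableOn.mul hd.differentiableOn, hF.continuousOn.mul hd.continuous.continuousOn⟩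
  have h2 := h1.circleIntegral_eq_zero zero_le_one
  rw [circleIntegral] at h2
  have h3 : (fun θ : ℝ => deriv (circleMap 0 1) θ • (F (circleMap 0 1 θ) * circleMap 0 1 θ ^ n))
      = fun θ => Complex.I * (h (Circle.exp θ) * ((Circle.exp θ : Circle) : ℂ) ^ ((n : ℤ) + 1)) := by
    funext θ
    have : circleMap 0 1 θ = (Circle.exp θ : Circle) := by
      rw [Circle.coe_exp, circleMap_zero, Complex.ofReal_one, one_mul]
    rw [deriv_circleMap, this, hFh, zpow_add₀ (Circle.coe_ne_zero _), zpow_natCast, zpow_one,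
      smul_eq_mul]
    ring
  rw [h3, intervalIntegral.integral_const_mul] at h2
  have h4 := (mul_eq_zero.1 h2).resolve_left Complex.I_ne_zero
  have hper : Function.Periodic (fun θ : ℝ => h (Circle.exp θ)
      * ((Circle.exp θ : Circle) : ℂ) ^ ((n : ℤ) + 1)) (2 * Real.pi) := fun x => by
    simp only [Circle.exp_add_two_pi]
  have h5 := hper.intervalIntegral_add_eq 0 (-Real.pi)
  rw [zero_add, h4, show -Real.pi + 2 * Real.pi = Real.pi by ring] at h5
  rw [circleCoeff_eq_circleMean, circleMean, neg_neg, ← h5, mul_zero]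

theorem HasDiscExtension.of_circleCoeff {h : Circle → ℂ} (hh : IsSmoothOnCircle h)
    (h0 : ∀ k < 0, circleCoeff h k = 0) : HasDiscExtension h := by
  have hs : Summable fun n : ℕ => ‖circleCoeff h n‖ := by
    have h1 : Summable fun n : ℤ => ‖circleCoeff h n‖ := by simpa using summable_circleCoeff hh 0
    exact h1.comp_injective Nat.cast_injective
  have hle : ∀ (n : ℕ), ∀ z ∈ Metric.closedBall (0 : ℂ) 1, ‖circleCoeff h n * z ^ n‖
      ≤ ‖circleCoeff h n‖ := by
    intro n z hz
    rw [norm_mul, norm_pow]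
    exact mul_le_of_le_one_right (norm_nonneg _)
      (pow_le_one₀ (norm_nonneg _) (mem_closedBall_zero_iff.1 hz))
  have hd : ∀ n : ℕ, Differentiable ℂ fun z : ℂ => circleCoeff h n * z ^ n := fun n =>
    (differentiable_id.pow n).const_mul _
  refine ⟨fun z => ∑' n : ℕ, circleCoeff h n * z ^ n, ⟨?_, ?_⟩, fun z => ?_⟩
  · exact Complex.differentiableOn_tsum_of_summable_norm hs (fun n => (hd n).differentiableOn)
      Metric.isOpen_ball fun n z hz => hle n z (Metric.ball_subset_closedBall hz)
  · rw [closure_unitBall]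
    exact continuousOn_tsum (fun n => (hd n).continuous.continuousOn) hs hle
  · have h1 : Summable (circleCoeff h) :=
      Summable.of_norm (by simpa using summable_circleCoeff hh 0)
    have h2 := hasSum_circleCoeff_of_summable hh.continuous h1 z
    have hinj : Function.Injective ((↑) : ℕ → ℤ) := Nat.cast_injective
    have h3 := (hinj.hasSum_iff (f := fun n : ℤ => circleCoeff h n * (z : ℂ) ^ n) ?_).2 h2
    · simpa [Function.comp_def] using h3.tsum_eq
    · intro n hn
      have : n < 0 := by
        by_contra hn0
        exact hn ⟨n.toNat, by omega⟩
      rw [h0 n this, zero_mul]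

/-- Two consecutive powers of a unimodular function extend to the disc only if it does itself. -/
theorem HasDiscExtension.of_pow {u : Circle → Circle} {N : ℕ} (hN : N ≠ 0)
    (h1 : HasDiscExtension fun z => (u z : ℂ) ^ N)
    (h2 : HasDiscExtension fun z => (u z : ℂ) ^ (N + 1)) : HasDiscExtension fun z => (u z : ℂ) := by
  obtain ⟨F, hF, hFu⟩ := h1
  obtain ⟨G, hG, hGu⟩ := h2
  have hpow : Set.EqOn (fun z => G z ^ N) (fun z => F z ^ (N + 1)) (Metric.closedBall 0 1) := by
    refine eqOn_closedBall_of_circle ⟨hG.differentiableOn.pow N, hG.continuousOn.pow N⟩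
      ⟨hF.differentiableOn.pow (N + 1), hF.continuousOn.pow (N + 1)⟩ fun z => ?_
    rw [hFu, hGu, ← pow_mul, ← pow_mul, mul_comm]
  have hFc := hF.continuousOn
  have hGc := hG.continuousOn
  rw [closure_unitBall] at hFc hGc
  -- `G^N = F^(N+1)` holds on the circle, hence on the disc, so the quotient tends to `0` at zeros
  -- of `F`. There `G / F` has the value `0` by the convention on division, so it is continuous.
  have hq : ∀ z ∈ Metric.closedBall (0 : ℂ) 1, ‖G z / F z‖ = ‖F z‖ ^ ((N : ℝ)⁻¹) := by
    intro z hz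
    have e : ‖G z / F z‖ ^ N = ‖F z‖ := by
      have := congrArg norm (hpow hz)
      simp only [norm_pow] at this
      rcases eq_or_ne (F z) 0 with h0 | h0
      · simp [h0, hN]
      · have := norm_pos_iff.2 h0
        rw [norm_div, div_pow, ‹‖G z‖ ^ N = ‖F z‖ ^ (N + 1)›, pow_succ]
        field_simp
    rw [← e, Real.pow_rpow_inv_natCast (norm_nonneg _) hN]
  have hcont : ContinuousOn (fun z => G z / F z) (Metric.closedBall 0 1) := by
    intro z hz
    rcases eq_or_ne (F z) 0 with h0 | h0
    · rw [ContinuousWithinAt, h0, div_zero, tendsto_zero_iff_norm_tendsto_zero]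
      have h3 : Filter.Tendsto (fun z => ‖F z‖ ^ ((N : ℝ)⁻¹))
          (nhdsWithin z (Metric.closedBall 0 1)) (nhds (‖F z‖ ^ ((N : ℝ)⁻¹))) :=
        ((hFc z hz).norm).rpow_const (Or.inr (by positivity))
      rw [h0, norm_zero, Real.zero_rpow (by positivity)] at h3
      refine h3.congr' ?_
      filter_upwards [self_mem_nhdsWithin] with w hw
      exact (hq w hw).symm
    · exact (hGc z hz).div (hFc z hz) h0
  refine ⟨fun z => G z / F z, ⟨fun z hz => ?_, by rwa [closure_unitBall]⟩, fun z => ?_⟩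
  · have hFa : AnalyticAt ℂ F z := hF.differentiableOn.analyticAt (Metric.isOpen_ball.mem_nhds hz)
    have hca : ContinuousAt (fun z => G z / F z) z := hcont.continuousAt
      (Filter.mem_of_superset (Metric.isOpen_ball.mem_nhds hz) Metric.ball_subset_closedBall)
    refine DifferentiableAt.differentiableWithinAt ?_
    -- Either the quotient is locally zero, or the zeros of `F` are isolated and continuity removes
    -- the singularity.
    rcases hFa.eventually_eq_zero_or_eventually_ne_zero with h0 | h0
    · refine (differentiableAt_const (0 : ℂ)).congr_of_eventuallyEq ?_
      filter_upwards [h0] with w hw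
      rw [hw, div_zero]
    · refine (Complex.analyticAt_of_differentiable_on_punctured_nhds_of_continuousAt ?_
        hca).differentiableAt
      filter_upwards [h0, nhdsWithin_le_nhds (Metric.isOpen_ball.mem_nhds hz)] with w hw hwb
      exact (hG.differentiableAt Metric.isOpen_ball hwb).div
        (hF.differentiableAt Metric.isOpen_ball hwb) hw
  · simp only [hFu, hGu]
    rw [pow_succ, mul_div_cancel_left₀ _ (pow_ne_zero _ (Circle.coe_ne_zero _))]

namespace CircleDensity

variable {D : CircleDensity}

theorem hasDiscExtension_e_pow_iff (n : ℕ) :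
    HasDiscExtension (fun z => (D.e z : ℂ) ^ n) ↔ D.d n = n := by
  have h := D.d_eq_iff n
  rw [Int.cast_natCast] at h
  rw [h]
  have hs := D.smooth_e_zpow n
  simp only [zpow_natCast] at hs
  constructor
  · intro he k hk
    have := he.circleCoeff_eq_zero hk
    simpa only [U, zpow_natCast] using this
  · intro h
    refine HasDiscExtension.of_circleCoeff hs fun k hk => ?_
    simpa only [U, zpow_natCast] using h k hk

theorem hasDiscExtension_e_iff :
    HasDiscExtension (fun z => (D.e z : ℂ)) ↔ ∀ n : ℕ, D.d n = n := by
  constructor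
  · exact fun h n => (hasDiscExtension_e_pow_iff n).1 (h.pow n)
  · intro h
    simpa using (hasDiscExtension_e_pow_iff 1).2 (h 1)

/-- If equality held from `M` on, the powers `M + 1` and `M + 2` of `e` would extend to the disc,
hence so would `e` and all its powers. -/
theorem exists_lt_d (h : ¬ ∀ n : ℕ, D.d n = n) (M : ℕ) : ∃ n : ℕ, M ≤ n ∧ (n : ℝ) < D.d n := by
  by_contra! hM
  have h1 : ∀ n : ℕ, M ≤ n → D.d n = n := fun n hn =>
    le_antisymm (hM n hn) (by simpa using D.d_sub_nonneg n)
  refine h (hasDiscExtension_e_iff.1 (HasDiscExtension.of_pow (N := M + 1) (by omega) ?_ ?_))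
  · exact (hasDiscExtension_e_pow_iff _).2 (h1 _ (by omega))
  · exact (hasDiscExtension_e_pow_iff _).2 (h1 _ (by omega))

/-- By the duality `mul_U_eq`, for `k < 0` the `k`-th coefficient of one map is, up to a nonzero
factor, the coefficient with index `-1` of the power `-k` of the other, and positive powers of an
extendable map extend. -/
theorem hasDiscExtension_σ_iff :
    HasDiscExtension (fun z => (D.σ z : ℂ)) ↔ HasDiscExtension fun z => (D.e z : ℂ) := by
  constructor
  · intro h
    have hs := D.smooth_e_zpow 1
    simp only [zpow_one] at hs
    refine HasDiscExtension.of_circleCoeff hs fun k hk => ?_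
    have h1 := D.mul_U_eq 1 k
    have h2 := (h.pow (-k).toNat).circleCoeff_eq_zero (k := -1) (by omega)
    have h3 : (fun z => (D.σ z : ℂ) ^ (-k).toNat) = fun z => (D.σ z : ℂ) ^ (-k) := by
      funext z
      rw [← zpow_natCast]; congr 1; omega
    rw [← h3, h2, mul_zero] at h1
    have hk' : (k : ℂ) ≠ 0 := by exact_mod_cast hk.ne
    simpa [U] using (mul_eq_zero.1 h1).resolve_left hk'
  · intro h
    have hs := D.smooth_σ_zpow 1
    simp only [zpow_one] at hs
    refine HasDiscExtension.of_circleCoeff hs fun k hk => ?_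
    have h1 := D.mul_U_eq (-k) (-1)
    have h2 := (h.pow (-k).toNat).circleCoeff_eq_zero (k := -1) (by omega)
    have h3 : D.U (-k) (-1) = 0 := by
      rw [U, ← h2]
      congr 1
      funext z
      rw [← zpow_natCast]; congr 1; omega
    rw [h3, mul_zero, neg_neg, neg_neg] at h1
    simp only [zpow_one] at h1
    have hk' : ((-k : ℤ) : ℂ) ≠ 0 := by
      rw [Int.cast_ne_zero]; omega
    exact (mul_eq_zero.1 h1.symm).resolve_left hk'

/-- Orientation: the same duality would remove all positive frequencies of `e`, against the degree
identity `∑ k |U 1 k|² = 1`. -/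
theorem not_hasDiscExtension_conj_σ : ¬ HasDiscExtension fun z => conj (D.σ z : ℂ) := by
  intro h
  have h0 : ∀ k : ℤ, 0 < k → D.U 1 k = 0 := by
    intro k hk
    have h1 := D.mul_U_eq 1 k
    have h2 := (h.pow k.toNat).circleCoeff_eq_zero (k := -1) (by omega)
    have h3 : (fun z => conj (D.σ z : ℂ) ^ k.toNat) = fun z => (D.σ z : ℂ) ^ (-k) := by
      funext z
      rw [← Circle.coe_inv_eq_conj, Circle.coe_inv, inv_pow, zpow_neg, ← zpow_natCast]
      congr 2; omega
    rw [← h3, h2, mul_zero] at h1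
    have hk' : (k : ℂ) ≠ 0 := by exact_mod_cast hk.ne'
    exact (mul_eq_zero.1 h1).resolve_left hk'
  have h1 := D.hasSum_int_mul_norm_U 1
  have h2 : ((1 : ℤ) : ℝ) ≤ 0 := by
    refine hasSum_le (fun k => ?_) h1 hasSum_zero
    rcases lt_or_ge 0 k with hk | hk
    · rw [h0 k hk]; simp
    · exact mul_nonpos_of_nonpos_of_nonneg (by exact_mod_cast hk) (by positivity)
  norm_num at h2

end CircleDensity
end

/-! ### Conformal equivalence with the constant function -/

noncomputable section

open ComplexConjugate

namespace CircleDensity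

variable (D : CircleDensity)

theorem hasDerivAt_σ_exp (t : ℝ) : HasDerivAt (fun t : ℝ => (D.σ (Circle.exp t) : ℂ))
    (Complex.I * ((D.τ (D.σ (Circle.exp t)) : ℂ)⁻¹ * D.σ (Circle.exp t))) t := by
  simp only [σ_exp, Circle.coe_exp]
  convert! ((D.hasDerivAt_S t).ofReal_comp.mul_const Complex.I).cexp using 1
  push_cast
  ring

theorem σ_injective : Function.Injective D.σ := fun x y h => by rw [← D.e_σ x, h, D.e_σ]

/-- Maximum principle; a value of modulus one inside would make `F` constant, hence `u` equal at `1`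
and `-1`. -/
theorem mapsTo_ball {F : ℂ → ℂ} (hF : DiffContOnCl ℂ F (Metric.ball 0 1)) {u : Circle → Circle}
    (hFu : ∀ z : Circle, F z = u z) (hu : Function.Injective u) :
    Set.MapsTo F (Metric.ball 0 1) (Metric.ball 0 1) := by
  have hle : ∀ z ∈ closure (Metric.ball (0 : ℂ) 1), ‖F z‖ ≤ 1 := fun z hz => by
    refine Complex.norm_le_of_forall_mem_frontier_norm_le Metric.isBounded_ball hF (fun w hw => ?_) hz
    rw [frontier_unitBall] at hw
    have := hFu ⟨w, hw⟩
    change F w = _ at this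
    rw [this, Circle.norm_coe]
  intro z hz
  rw [mem_ball_zero_iff]
  refine lt_of_le_of_ne (hle z (subset_closure hz)) fun h => ?_
  have hmax : IsMaxOn (norm ∘ F) (Metric.ball 0 1) z := fun w hw => by
    change ‖F w‖ ≤ ‖F z‖
    rw [h]; exact hle w (subset_closure hw)
  have hconst := Complex.eqOn_closure_of_isPreconnected_of_isMaxOn_norm
    (convex_ball (0 : ℂ) 1).isPreconnected Metric.isOpen_ball hF hz hmax
  have hc : ∀ x : Circle, (u x : ℂ) = F z := fun x => by
    rw [← hFu x]
    refine hconst ?_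
    rw [closure_unitBall]
    simp [Circle.norm_coe]
  have h1 : (1 : Circle) = Circle.exp Real.pi := hu (Circle.ext ((hc _).trans (hc _).symm))
  have h2 := congrArg (fun x : Circle => (x : ℂ)) h1
  simp only [Circle.coe_one, Circle.coe_exp, Complex.exp_pi_mul_I] at h2
  norm_num at h2

/-- The extensions of `e` and `σ` are mutually inverse by uniqueness of extensions, and the speed of
`σ` is `1 / τ ∘ σ = c ∘ σ`. -/
theorem conformallyEquivalent_of_hasDiscExtension {c : Circle → ℝ} (hc : ∀ z, D.τ z = (c z)⁻¹)
    (he : HasDiscExtension fun z => (D.e z : ℂ)) : ConformallyEquivalent c fun _ => 1 := by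
  obtain ⟨F, hF, hFe⟩ := id he
  obtain ⟨G, hG, hGσ⟩ := D.hasDiscExtension_σ_iff.2 he
  replace hFe : ∀ z : Circle, F z = D.e z := hFe
  replace hGσ : ∀ z : Circle, G z = D.σ z := hGσ
  have hGm := mapsTo_ball hG hGσ D.σ_injective
  have hFm := mapsTo_ball hF hFe fun x y h => by rw [← D.σ_e x, h, D.σ_e]
  have hid : DiffContOnCl ℂ (fun z : ℂ => z) (Metric.ball 0 1) := differentiable_id.diffContOnCl
  have hFG : ∀ z ∈ Metric.ball (0 : ℂ) 1, F (G z) = z := fun z hz =>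
    eqOn_closedBall_of_circle (F := fun z => F (G z)) (hF.comp hG hGm) hid
      (fun z => by rw [hGσ, hFe, e_σ]) (Metric.ball_subset_closedBall hz)
  have hGF : ∀ z ∈ Metric.ball (0 : ℂ) 1, G (F z) = z := fun z hz =>
    eqOn_closedBall_of_circle (F := fun z => G (F z)) (hG.comp hF hFm) hid
      (fun z => by rw [hFe, hGσ, σ_e]) (Metric.ball_subset_closedBall hz)
  refine ⟨G, Or.inl ⟨by simpa only [closure_unitBall] using hG.continuousOn, hG.differentiableOn, hGm,
    F, hF.differentiableOn, hFm, hFG, hGF⟩, D.σ, fun z => (hGσ z).symm, fun θ => ?_⟩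
  have hp := D.pos (D.σ (Circle.exp θ))
  rw [(D.hasDerivAt_σ_exp θ).deriv, norm_mul, norm_mul, Complex.norm_I, Circle.norm_coe, norm_inv,
    Complex.norm_real, Real.norm_of_nonneg hp.le, one_mul, mul_one, inv_inv, hc]
  rw [hc] at hp
  exact (mul_inv_cancel₀ (inv_pos.1 hp).ne').symm

/-- A unimodular curve of constant angular speed. -/
theorem eq_mul_exp_of_hasDerivAt {E : ℝ → Circle} {r : ℝ → ℝ}
    (hE : ∀ t, HasDerivAt (fun t => (E t : ℂ)) (Complex.I * (r t * E t)) t) (hr : ∀ t, |r t| = 1) :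
    (∀ t, E t = E 0 * Circle.exp t) ∨ ∀ t, E t = E 0 * Circle.exp (-t) := by
  have hcont : Continuous fun t => (E t : ℂ) :=
    continuous_iff_continuousAt.2 fun t => (hE t).continuousAt
  -- No continuity of `r` is assumed, so Darboux's theorem is used: near `t₀` the derivative `r(t)
  -- Re (E(t) conj E(t₀))` of `Im (E(t) conj E(t₀))` never vanishes, so it has constant sign, and so
  -- has `r`.
  have hloc : IsLocallyConstant r := by
    rw [IsLocallyConstant.iff_exists_open]
    intro t₀
    have hre : Continuous fun t => ((E t : ℂ) * conj (E t₀ : ℂ)).re :=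
      Complex.continuous_re.comp (hcont.mul continuous_const)
    have h1 : 0 < ((E t₀ : ℂ) * conj (E t₀ : ℂ)).re := by
      rw [Complex.mul_conj']; simp [Circle.norm_coe]
    obtain ⟨δ, hδ, hball⟩ := Metric.mem_nhds_iff.1
      (hre.continuousAt.preimage_mem_nhds (Ioi_mem_nhds h1))
    refine ⟨Metric.ball t₀ δ, Metric.isOpen_ball, Metric.mem_ball_self hδ, fun t ht => ?_⟩
    have hd : ∀ t ∈ Metric.ball t₀ δ, HasDerivWithinAt
        (fun t => ((E t : ℂ) * conj (E t₀ : ℂ)).im) (r t * ((E t : ℂ) * conj (E t₀ : ℂ)).re)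
        (Metric.ball t₀ δ) t := by
      intro t _
      have h2 := (hE t).mul_const (conj (E t₀ : ℂ))
      have h3 := (Complex.imCLM.hasFDerivAt.comp_hasDerivAt t h2)
      convert! h3.hasDerivWithinAt using 1
      simp
      ring
    have hne : ∀ t ∈ Metric.ball t₀ δ, r t * ((E t : ℂ) * conj (E t₀ : ℂ)).re ≠ 0 := by
      intro t ht
      refine mul_ne_zero ?_ (hball ht).ne'
      intro h
      have := hr t
      rw [h] at this
      simp at this
    have hp := hball ht
    have hcase : ∀ s, r s = 1 ∨ r s = -1 := fun s => (abs_eq zero_le_one).1 (hr s)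
    rcases hasDerivWithinAt_forall_lt_or_forall_gt_of_forall_ne (convex_ball t₀ δ) hd hne with h | h
    · have a1 := h t ht
      have a2 := h t₀ (Metric.mem_ball_self hδ)
      have b1 : r t < 0 := by
        by_contra! hh
        exact absurd (mul_nonneg hh (le_of_lt hp)) (not_le.2 a1)
      have b2 : r t₀ < 0 := by
        by_contra! hh
        exact absurd (mul_nonneg hh h1.le) (not_le.2 a2)
      rcases hcase t with c1 | c1 <;> rcases hcase t₀ with c2 | c2 <;> linarith
    · have a1 := h t ht
      have a2 := h t₀ (Metric.mem_ball_self hδ)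
      have b1 : 0 < r t := by
        by_contra! hh
        exact absurd (mul_nonpos_of_nonpos_of_nonneg hh (le_of_lt hp)) (not_le.2 a1)
      have b2 : 0 < r t₀ := by
        by_contra! hh
        exact absurd (mul_nonpos_of_nonpos_of_nonneg hh h1.le) (not_le.2 a2)
      rcases hcase t with c1 | c1 <;> rcases hcase t₀ with c2 | c2 <;> linarith
  have hconst : ∀ t, r t = r 0 := fun t => hloc.apply_eq_of_isPreconnected isPreconnected_univ
    (Set.mem_univ t) (Set.mem_univ 0)
  have key : ∀ t, E t = E 0 * Circle.exp (r 0 * t) := by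
    intro t
    have hd : ∀ t : ℝ, HasDerivAt (fun t : ℝ => (E t : ℂ) * Complex.exp (-(r 0 * t) * Complex.I)) 0 t := by
      intro t
      have h1 := (((hasDerivAt_id t).ofReal_comp.const_mul (r 0 : ℂ)).neg.mul_const Complex.I).cexp
      have h2 := (hE t).mul h1
      convert! h2 using 1
      rw [hconst t]
      simp
      ring
    have h3 := is_const_of_deriv_eq_zero (fun t => (hd t).differentiableAt) (fun t => (hd t).deriv) t 0
    apply Circle.ext
    have h4 : Complex.exp (-(r 0 * t) * Complex.I) * Complex.exp (r 0 * t * Complex.I) = 1 := by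
      rw [← Complex.exp_add]; simp
    simp only [Complex.ofReal_zero, mul_zero, neg_zero, zero_mul, Complex.exp_zero, mul_one] at h3
    rw [Circle.coe_mul, Circle.coe_exp, ← h3]
    push_cast
    rw [mul_assoc, h4, mul_one]
  rcases (abs_eq zero_le_one).1 (hr 0) with h | h
  · left; intro t; simpa [h] using key t
  · right; intro t; simpa [h] using key t

/-- Chain rule through the local lift `θ₀ + arg (g s · conj (g t))`, on which `arg` is smooth near
`s = t` because its argument is near `1`. -/
theorem hasDerivAt_e_comp {g : ℝ → Circle} {ρ t : ℝ}
    (hg : HasDerivAt (fun t => (g t : ℂ)) (Complex.I * (ρ * g t)) t) :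
    HasDerivAt (fun s => (D.e (g s) : ℂ)) (Complex.I * ((D.τ (g t) * ρ : ℝ) * D.e (g t))) t := by
  set θ₀ := Complex.arg (g t) with hθ₀
  have hθ : Circle.exp θ₀ = g t := Circle.exp_arg _
  have h1 : HasDerivAt (fun s => Complex.log ((g s : ℂ) * conj (g t : ℂ))) (Complex.I * ρ) t := by
    have hc : (g t : ℂ) * conj (g t : ℂ) = 1 := by
      rw [Complex.mul_conj']; simp [Circle.norm_coe]
    have h2 := (hg.mul_const (conj (g t : ℂ))).clog_real (by rw [hc]; simp)
    rw [hc] at h2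
    convert! h2 using 1
    rw [div_one]
    linear_combination (-Complex.I * ρ) * hc
  have h2 : HasDerivAt (fun s => Complex.arg ((g s : ℂ) * conj (g t : ℂ))) ρ t := by
    have := Complex.imCLM.hasFDerivAt.comp_hasDerivAt t h1
    simpa [Function.comp_def, Complex.log_im] using this
  have h3 : ∀ s, g s = Circle.exp (θ₀ + Complex.arg ((g s : ℂ) * conj (g t : ℂ))) := by
    intro s
    have : (g s : ℂ) * conj (g t : ℂ) = ((g s * (g t)⁻¹ : Circle) : ℂ) := by
      rw [Circle.coe_mul, Circle.coe_inv_eq_conj]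
    rw [Circle.exp_add, hθ, this, Circle.exp_arg, mul_comm, inv_mul_cancel_right]
  have h4 : ∀ s, (D.e (g s) : ℂ) = Complex.exp
      (D.T (θ₀ + Complex.arg ((g s : ℂ) * conj (g t : ℂ))) * Complex.I) := by
    intro s
    conv_lhs => rw [h3 s, e_exp, Circle.coe_exp]
  have h0 : Complex.arg ((g t : ℂ) * conj (g t : ℂ)) = 0 := by
    rw [Complex.mul_conj']; simp [Circle.norm_coe]
  have h5 : HasDerivAt (fun s => D.T (θ₀ + Complex.arg ((g s : ℂ) * conj (g t : ℂ))))
      (D.τ (g t) * ρ) t := by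
    have h6 := D.hasDerivAt_T (θ₀ + Complex.arg ((g t : ℂ) * conj (g t : ℂ)))
    have h7 := h6.comp t (h2.const_add θ₀)
    rw [← h3 t] at h7
    exact h7
  have h8 := (h5.ofReal_comp.mul_const Complex.I).cexp
  simp only [← h4] at h8
  convert! h8 using 1
  ring

/-- A nonzero `deriv` is not the default value, so `g` is differentiable; differentiating `g conj g
= 1` shows that the derivative is tangent to the circle. -/
theorem exists_hasDerivAt_of_norm_deriv {g : ℝ → Circle} {t : ℝ}
    (hg : ‖deriv (fun t => (g t : ℂ)) t‖ ≠ 0) : ∃ ρ : ℝ,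
      |ρ| = ‖deriv (fun t => (g t : ℂ)) t‖ ∧
      HasDerivAt (fun t => (g t : ℂ)) (Complex.I * (ρ * g t)) t := by
  have hd : DifferentiableAt ℝ (fun t => (g t : ℂ)) t := by
    by_contra h
    rw [deriv_zero_of_not_differentiableAt h, norm_zero] at hg
    exact hg rfl
  have h1 := hd.hasDerivAt
  set g' := deriv (fun t => (g t : ℂ)) t
  have hone : ∀ s, (g s : ℂ) * conj (g s : ℂ) = 1 := fun s => by
    rw [Complex.mul_conj']; simp [Circle.norm_coe]
  have h2 : HasDerivAt (fun s => (g s : ℂ) * conj (g s : ℂ))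
      (g' * conj (g t : ℂ) + g t * conj g') t := by
    have h3 := Complex.conjCLE.toContinuousLinearMap.hasFDerivAt.comp_hasDerivAt t h1
    exact h1.mul h3
  simp only [hone] at h2
  have h3 := h2.unique (hasDerivAt_const t (1 : ℂ))
  have h4 : (g' * conj (g t : ℂ)).re = 0 := by
    have := congrArg Complex.re h3
    rw [Complex.add_re, show ((g t : ℂ) * conj g').re = (g' * conj (g t : ℂ)).re by
      simp; ring] at this
    simpa using this
  refine ⟨(g' * conj (g t : ℂ)).im, ?_, ?_⟩
  · rw [Complex.abs_im_eq_norm.2 h4, norm_mul, RCLike.norm_conj, Circle.norm_coe, mul_one]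
  · convert! h1 using 1
    have h5 : Complex.I * ((g' * conj (g t : ℂ)).im : ℂ) = g' * conj (g t : ℂ) := by
      conv_rhs => rw [← Complex.re_add_im (g' * conj (g t : ℂ)), h4]
      simp [mul_comm]
    rw [← mul_assoc, h5, mul_assoc, mul_comm (conj _), hone, mul_one]

theorem hasDiscExtension_of_conformal {Ψ : ℂ → ℂ} (hΨ : IsConformalOfDisc Ψ) {h : Circle → ℂ}
    (hh : ∀ z : Circle, Ψ z = h z) : HasDiscExtension h :=
  ⟨Ψ, ⟨hΨ.holomorphic, by rw [closure_unitBall]; exact hΨ.continuousOn⟩, hh⟩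

/-- Since `|ψ'| = c ∘ ψ` and `e` has speed `1 / c`, the curve `e ∘ ψ` has unit speed, so it is a
rotation, possibly composed with a reflection. Solving for `σ` expresses it through `ψ`. Of the four
combinations with `Ψ` conformal or anticonformal, two extend `σ` to the disc and the other two would
extend its conjugate, which is impossible. -/
theorem hasDiscExtension_e_of_conformallyEquivalent {c : Circle → ℝ}
    (hc : ∀ z, D.τ z = (c z)⁻¹) (h : ConformallyEquivalent c fun _ => 1) :
    HasDiscExtension fun z => (D.e z : ℂ) := by
  obtain ⟨Ψ, hΨ, ψ, hψ, hθ⟩ := h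
  have hcpos : ∀ z, 0 < c z := fun z => by
    have := D.pos z
    rw [hc] at this
    exact inv_pos.1 this
  have hnorm : ∀ t : ℝ, ‖deriv (fun t : ℝ => (ψ (Circle.exp t) : ℂ)) t‖ = c (ψ (Circle.exp t)) := by
    intro t
    have h1 := hθ t
    have h2 : ‖deriv (fun t : ℝ => (ψ (Circle.exp t) : ℂ)) t‖ ≠ 0 := by
      intro h0
      rw [h0, inv_zero, mul_zero] at h1
      exact one_ne_zero h1
    field_simp at h1
    exact h1
  have hex : ∀ t : ℝ, ∃ r : ℝ, |r| = 1 ∧ HasDerivAt (fun t : ℝ => (D.e (ψ (Circle.exp t)) : ℂ))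
      (Complex.I * (r * D.e (ψ (Circle.exp t)))) t := by
    intro t
    have hp := hcpos (ψ (Circle.exp t))
    obtain ⟨ρ, hρ, hd⟩ := exists_hasDerivAt_of_norm_deriv (g := fun t : ℝ => ψ (Circle.exp t)) (t := t)
      (by rw [hnorm]; exact hp.ne')
    refine ⟨_, ?_, D.hasDerivAt_e_comp hd⟩
    rw [hnorm] at hρ
    rw [abs_mul, hρ, hc, abs_of_pos (inv_pos.2 hp), inv_mul_cancel₀ hp.ne']
  choose r hr hE using hex
  set E₀ := D.e (ψ (Circle.exp 0))
  rw [← D.hasDiscExtension_σ_iff]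
  rcases eq_mul_exp_of_hasDerivAt (E := fun t : ℝ => D.e (ψ (Circle.exp t))) hE hr with h | h
  · have h1 : ∀ z, D.σ z = ψ (E₀⁻¹ * z) := by
      intro z
      have h2 := h (Complex.arg (E₀⁻¹ * z : Circle))
      simp only [Circle.exp_arg] at h2
      rw [← D.σ_e (ψ (E₀⁻¹ * z)), h2, mul_inv_cancel_left]
    simp only [h1]
    rcases hΨ with hΨ | hΨ
    · exact (hasDiscExtension_of_conformal hΨ (h := fun z => (ψ z : ℂ))
        fun z => (hψ z).symm).rotate E₀⁻¹
    · refine (D.not_hasDiscExtension_conj_σ ?_).elim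
      simp only [h1]
      exact (hasDiscExtension_of_conformal hΨ (h := fun z => conj (ψ z : ℂ))
        fun z => congrArg _ (hψ z).symm).rotate E₀⁻¹
  · have h1 : ∀ z, D.σ z = ψ (E₀⁻¹ * z)⁻¹ := by
      intro z
      have h2 := h (-Complex.arg (E₀⁻¹ * z : Circle))
      simp only [neg_neg, Circle.exp_neg, Circle.exp_arg] at h2
      rw [← D.σ_e (ψ (E₀⁻¹ * z)⁻¹), h2, mul_inv_cancel_left]
    rcases hΨ with hΨ | hΨ
    · refine (D.not_hasDiscExtension_conj_σ ?_).elim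
      simp only [h1]
      exact (hasDiscExtension_of_conformal hΨ (h := fun z => (ψ z : ℂ))
        fun z => (hψ z).symm).conj.rotate E₀⁻¹
    · simp only [h1]
      have := ((hasDiscExtension_of_conformal hΨ (h := fun z => conj (ψ z : ℂ))
        fun z => congrArg _ (hψ z).symm).conj.rotate E₀⁻¹)
      simpa only [Complex.conj_conj] using this

theorem conformallyEquivalent_iff {c : Circle → ℝ} (hc : ∀ z, D.τ z = (c z)⁻¹) :
    ConformallyEquivalent c (fun _ => 1) ↔ ∀ n : ℕ, D.d n = n := by
  rw [← D.hasDiscExtension_e_iff]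
  exact ⟨D.hasDiscExtension_e_of_conformallyEquivalent hc,
    D.conformallyEquivalent_of_hasDiscExtension hc⟩

end CircleDensity
end

/-! ### Assembly of the theorem -/

noncomputable section

theorem steklovLength_pos {a : Circle → ℝ} (ha : IsSmoothOnCircle a) (hpos : ∀ z, 0 < a z) :
    0 < steklovLength a := by
  have hc : Continuous fun θ : ℝ => (a (Circle.exp θ))⁻¹ :=
    (ContDiff.continuous ha).inv₀ fun θ => (hpos _).ne'
  exact intervalIntegral.intervalIntegral_pos_of_pos (hc.intervalIntegrable _ _)
    (fun θ => inv_pos.2 (hpos _)) (by linarith [Real.pi_pos])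

/-- The density with respect to which the angle becomes the normalized arc length of the weight. -/
def steklovDensity {a : Circle → ℝ} (ha : IsSmoothOnCircle a) (hpos : ∀ z, 0 < a z) :
    CircleDensity where
  τ z := (steklovLength a / (2 * Real.pi) * a z)⁻¹
  smooth := by
    have hl : 0 < steklovLength a / (2 * Real.pi) :=
      div_pos (steklovLength_pos ha hpos) Real.two_pi_pos
    exact ContDiff.inv (contDiff_const.mul ha) fun θ => (mul_pos hl (hpos _)).ne'
  pos z := inv_pos.2 (mul_pos (div_pos (steklovLength_pos ha hpos) Real.two_pi_pos) (hpos z))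
  mass := by
    have h := (steklovLength_pos ha hpos).ne'
    have hpi := Real.pi_ne_zero
    simp only [mul_inv, intervalIntegral.integral_const_mul]
    rw [← steklovLength]
    field_simp

theorem theorem1p2 (a : Circle → ℝ) (ha : IsSmoothOnCircle a) (hpos : ∀ z, 0 < a z) :
    (∃ Z : ℂ → ℂ, IsSteklovZeta a ha hpos Z) ∧
    ∀ Z : ℂ → ℂ, IsSteklovZeta a ha hpos Z →
      ((∀ s : ℂ, s ≠ 1 →
          Z s = 2 * ((steklovLength a / (2 * Real.pi) : ℝ) : ℂ) ^ s * riemannZeta s) ↔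
        ConformallyEquivalent (fun z => steklovLength a / (2 * Real.pi) * a z) (fun _ => 1)) ∧
      Xor
        (∀ s : ℂ, s ≠ 1 →
          Z s = 2 * ((steklovLength a / (2 * Real.pi) : ℝ) : ℂ) ^ s * riemannZeta s)
        (∀ α : ℝ, 0 < α →
          (∃ C : ℝ, 0 < C ∧ ∀ s : ℝ, 1 ≤ s →
            ∃ d : ℝ, HasDerivAt (zetaExcess a Z) (d : ℂ) s ∧ C * Real.exp (α * s) ≤ d) ∧
          (∃ C₁ : ℝ, 0 < C₁ ∧ ∀ s : ℝ, 1 ≤ s →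
            ∃ v : ℝ, zetaExcess a Z s = (v : ℂ) ∧ C₁ * Real.exp (α * s) ≤ v)) := by
  set l := steklovLength a / (2 * Real.pi) with hl_def
  have hl : 0 < l := div_pos (steklovLength_pos ha hpos) Real.two_pi_pos
  set D := steklovDensity ha hpos
  have hτ : ∀ z, D.τ z = (l * a z)⁻¹ := fun z => rfl
  obtain ⟨b, lam, hmono, hb⟩ := IsSmoothing.exists_sorted_eigenbasis D.isSmoothing_K
  have has := CircleDensity.isDiscAsymptotic hb hmono
  have hspec : IsSteklovSpectrum a ha hpos fun k => lam k / l :=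
    CircleDensity.isSteklovSpectrum hl hτ hb hmono
  refine ⟨⟨rescaledZeta lam l, ⟨⟨_, hspec, fun s hs => has.hasSum_rescaledZeta hl hs⟩,
    has.differentiableOn_rescaledZeta hl, has.meromorphicOrderAt_rescaledZeta hl⟩⟩, fun Z hZ => ?_⟩
  -- The spectrum behind an arbitrary admissible `Z` is the constructed one, since multiplicities
  -- determine a monotone list with finite levels.
  have hZeq : ∀ s : ℂ, s ≠ 1 → Z s = rescaledZeta lam l s := by
    obtain ⟨f, hf, hsum⟩ := hZ.hasSum
    have hfin : ∀ x, {n | lam n / l = x}.Finite := by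
      intro x
      obtain ⟨C, -, hC⟩ := has.decay 0
      simp only [pow_zero, div_one] at hC
      refine (IsSmoothing.finite_setOf_eq hC ((x * l : ℝ) : ℂ)).subset fun n hn => ?_
      have hn' : lam n / l = x := hn
      change ((lam n : ℝ) : ℂ) = _
      rw [← hn', div_mul_cancel₀ _ hl.ne']
    rw [← hspec.unique hf hfin] at hsum
    exact fun s hs => has.eq_rescaledZeta hl hsum hZ.holomorphic hs
  have hone : (∀ n : ℕ, D.d n = n) →
      ∀ s : ℂ, s ≠ 1 → Z s = 2 * (l : ℂ) ^ s * riemannZeta s := by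
    intro h s hs
    rw [hZeq s hs, rescaledZeta, CircleDensity.zetaDifference_eq_zero hb hmono h]
    simp only [Pi.zero_apply]
    ring
  have hexc : ∀ s : ℝ, s ≠ -1 → zetaExcess a Z s = zetaDifference lam (-(s : ℂ)) := fun s hs =>
    IsDiscAsymptotic.zetaExcess_eq hl_def hl hZeq hs
  have htwo : (¬ ∀ n : ℕ, D.d n = n) → ∀ α : ℝ, 0 < α →
          (∃ C : ℝ, 0 < C ∧ ∀ s : ℝ, 1 ≤ s →
            ∃ d : ℝ, HasDerivAt (zetaExcess a Z) (d : ℂ) s ∧ C * Real.exp (α * s) ≤ d) ∧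
          (∃ C₁ : ℝ, 0 < C₁ ∧ ∀ s : ℝ, 1 ≤ s →
            ∃ v : ℝ, zetaExcess a Z s = (v : ℂ) ∧ C₁ * Real.exp (α * s) ≤ v) := by
    intro h α _
    obtain ⟨C, hC, hCs⟩ := CircleDensity.exists_exp_le hb hmono (CircleDensity.exists_lt_d h) α
    refine ⟨⟨C, hC, fun s hs => ?_⟩, ⟨C, hC, fun s hs => ?_⟩⟩
    · obtain ⟨v, hv, hvs⟩ := (hCs s hs).2
      refine ⟨v, hv.congr_of_eventuallyEq ?_, hvs⟩
      filter_upwards [lt_mem_nhds (show (-1 : ℝ) < s by linarith)] with t ht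
      exact hexc t ht.ne'
    · obtain ⟨v, hv, hvs⟩ := (hCs s hs).1
      exact ⟨v, (hexc s (by linarith)).trans hv, hvs⟩
  -- The alternatives exclude each other: under the first the excess vanishes at `s = 1`, where the
  -- second, with `α = 1`, makes it positive.
  have hnot : (∀ s : ℂ, s ≠ 1 → Z s = 2 * (l : ℂ) ^ s * riemannZeta s) →
      ¬ ∃ C₁ : ℝ, 0 < C₁ ∧ ∀ s : ℝ, 1 ≤ s →
            ∃ v : ℝ, zetaExcess a Z s = (v : ℂ) ∧ C₁ * Real.exp ((1 : ℝ) * s) ≤ v := by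
    rintro h ⟨C, hC, hCs⟩
    obtain ⟨v, hv, hvs⟩ := hCs 1 le_rfl
    have hl' : (l : ℂ) ≠ 0 := by exact_mod_cast hl.ne'
    have h1 : -((1 : ℝ) : ℂ) ≠ 1 := by norm_num
    rw [zetaExcess, h _ h1, ← hl_def, mul_comm 2, mul_assoc, ← mul_assoc,
      ← Complex.cpow_add _ _ hl', add_neg_cancel, Complex.cpow_zero, one_mul, sub_self] at hv
    have h2 : v = 0 := by exact_mod_cast hv.symm
    rw [h2] at hvs
    exact absurd hvs (not_le.2 (by positivity))
  have hiff : (∀ s : ℂ, s ≠ 1 → Z s = 2 * (l : ℂ) ^ s * riemannZeta s) ↔ ∀ n : ℕ, D.d n = n :=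
    ⟨fun h => by
      by_contra hA
      exact hnot h (htwo hA 1 one_pos).2, hone⟩
  refine ⟨hiff.trans (CircleDensity.conformallyEquivalent_iff D hτ).symm, ?_⟩
  by_cases hA : ∀ n : ℕ, D.d n = n
  · exact Or.inl ⟨hone hA, fun h => hnot (hone hA) (h 1 one_pos).2⟩
  · exact Or.inr ⟨htwo hA, fun h => hA (hiff.1 h)⟩
end
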